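/- Let $n,k\ge 0$ be integers and $\mathcal S\subseteq[1,n]=\{1,\dots,n\}$. Write $[0,n]=\{0,\dots,n\}$ and let $V(n,k)$ be the set of $k$-element subsets of $[0,n]$. For $\mathbf x,\mathbf y\in V(n,k)$ and $1\le i\le n$ put $v_i(\mathbf x,\mathbf y)=|\mathbf y\cap[i,n]|-|\mathbf x\cap[i,n]|$ and $|v|_i=|v_i|$. **The algebras.** Let $\mathcal B_0(n,k)$ be the path algebra over $\mathbb F_2[U_1,\dots,U_n]$ of the complete directed graph on $V(n,k)$ (one edge $f_{\mathbf x,\mathbf y}$ for each ordered pair $(\mathbf x,\mathbf y)$, loops included), with paths of length zero $\mathbf I_{\mathbf x}$, modulo the two-sided ideal generated by $f_{\mathbf x,\mathbf x}-\mathbf I_{\mathbf x}$ and $$f_{\mathbf x,\mathbf y}f_{\mathbf y,\mathbf z}-\prod_{i=1}^nU_i^{(|v|_i(\mathbf y,\mathbf z)-|v|_i(\mathbf x,\mathbf z)+|v|_i(\mathbf x,\mathbf y))/2}f_{\mathbf x,\mathbf z}.$$ In $\mathcal B_0(n,k)$ let $R_i=\sum f_{\mathbf x,(\mathbf x\setminus\{i-1\})\cup\{i\}}$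 over $\mathbf x$ with $\mathbf x\cap\{i-1,i\}=\{i-1\}$, $L_i=\sum f_{\mathbf x,(\mathbf x\setminus\{i\})\cup\{i-1\}}$ over $\mathbf x$ with $\mathbf x\cap\{i-1,i\}=\{i\}$, and $U_i=\sum_{\mathbf x}U_if_{\mathbf x,\mathbf x}$. Let $\mathcal B(n,k)$ be the quotient of $\mathcal B_0(n,k)$ by the two-sided ideal generated by $R_iR_{i+1}$, $L_{i+1}L_i$ ($1\le i\le n-1$) and $\mathbf I_{\mathbf x}U_i$ whenever $\mathbf x\cap\{i-1,i\}=\varnothing$. Let $\mathcal B(n,k,\mathcal S)$ be the tensor product of $\mathcal B(n,k)$ with the exterior algebra in variables $C_i$, $i\in\mathcal S$, with the differential $\partial$ satisfying the Leibniz rule, $\partial C_i=U_i$ and $\partial=0$ on $\mathcal B(n,k)$. Let $V_r$, $V_l$, $V'$ be the sets of $\mathbf x\in V(n,k)$ with $0\notin\mathbf x$, with $n\notin\mathbf x$, and with $0,n\notin\mathbf x$, respectively. For $W$ one of these, with $e_W=\sum_{\mathbf x\in W}\mathbf I_{\mathbf x}$, the truncation $e_W\,\mathcal B(n,k,\mathcal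 S)\,e_W$ is a dg algebra with unit $e_W$, denoted $\mathcal B_r(n,k,\mathcal S)$, $\mathcal B_l(n,k,\mathcal S)$, $\mathcal B'(n,k,\mathcal S)$, respectively. **The quivers.** Let $\Gamma=\Gamma(n,k,\mathcal S)$ be the quiver with vertex set $V(n,k)$ and arrows: $R_i:\mathbf x\to(\mathbf x\setminus\{i-1\})\cup\{i\}$ if $i-1\in\mathbf x$, $i\notin\mathbf x$; $L_i:\mathbf x\to(\mathbf x\setminus\{i\})\cup\{i-1\}$ if $i\in\mathbf x$, $i-1\notin\mathbf x$; loops $U_i$ ($1\le i\le n$) and $C_i$ ($i\in\mathcal S$) at every vertex. Let $\widetilde{\mathcal R}_{\mathcal S}$ be the set of elements of $\mathbf I_{\mathbf x}\mathrm{Path}_{\mathbb F_2}(\Gamma)\mathbf I_{\mathbf y}$, for all $\mathbf x,\mathbf y$, whose expression in labels is one of: $R_iU_j-U_jR_i$, $L_iU_j-U_jL_i$, $U_iU_j-U_jU_i$; $R_iL_i-U_i$, $L_iR_i-U_i$; $R_iR_j-R_jR_i$, $L_iL_j-L_jL_i$, $R_iL_j-L_jR_i$ with $|i-j|>1$; $R_iR_{i+1}$,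 $L_{i+1}L_i$; $U_i$ at a vertex $\mathbf x$ with $\mathbf x\cap\{i-1,i\}=\varnothing$; $C_i^2$; $C_iA+AC_i$ for any label $A$. For $W=V_r,V_l,V'$ let $\Gamma_W$ be the full subquiver of $\Gamma$ on $W$, and let $\mathcal R_W$ be the set of elements of $\widetilde{\mathcal R}_{\mathcal S}$ lying in $\mathrm{Path}_{\mathbb F_2}(\Gamma_W)\subseteq\mathrm{Path}_{\mathbb F_2}(\Gamma)$; for $W=V'$ and $k=n-1$, add to $\mathcal R_W$ the one further path $U_1\cdots U_n$ at the vertex $[1,n-1]$. Let $\partial$ be the differential on $\mathrm{Path}_{\mathbb F_2}(\Gamma_W)$ given by the Leibniz rule, $\partial C_i=U_i$ (loops at the same vertex) and $\partial=0$ on the other arrows. **The map $F$ and the gradings.** Let $F:\mathrm{Path}_{\mathbb F_2}(\Gamma)\to\mathcal B(n,k,\mathcal S)$ be the homomorphism with $F(\mathbf I_{\mathbf x})=\mathbf I_{\mathbf x}$ that sends an arrow $\mathbf x\to\mathbf y$ labelled $R_i$ or $L_i$ to $f_{\mathbf x,\mathbf y}$ and the loops $U_i$, $C_i$ at $\mathbf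 x$ to $U_i\mathbf I_{\mathbf x}$, $\mathbf I_{\mathbf x}C_i$. The unrefined Alexander degree $w^{\mathrm{un}}\in\mathbb Z^{2n}$ (with basis $\tau_1,\beta_1,\dots,\tau_n,\beta_n$) of an arrow is $\tau_i$, $\beta_i$, $\tau_i+\beta_i$, $\tau_i+\beta_i$ for the labels $R_i,L_i,U_i,C_i$, extended additively to paths; for a generator $C_{i_1}\cdots C_{i_l}U_1^{r_1}\cdots U_n^{r_n}f_{\mathbf x,\mathbf y}$ of $\mathcal B(n,k,\mathcal S)$ (with $i_1,\dots,i_l\in\mathcal S$ distinct) it is $\sum_i\big[(r_i+c_i+\max(v_i,0))\tau_i+(r_i+c_i+\max(-v_i,0))\beta_i\big]$ with $v_i=v_i(\mathbf x,\mathbf y)$ and $c_i=1$ if $i\in\{i_1,\dots,i_l\}$, $c_i=0$ otherwise. The refined Alexander degree $w\in(\tfrac12\mathbb Z)^n$ is the image of $w^{\mathrm{un}}$ under $\tau_i,\beta_i\mapsto\tfrac12e_i$; the single Alexander degree is $-\sum_{i\in\mathcal S}w_i+\sum_{i\notin\mathcal S}w_i$; the Maslov degree is the number of factors $C_i$ minus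 $2\sum_{i\in\mathcal S}w_i$. **Proposition.** For each $W=V_r,V_l,V'$, the restriction of $F$ to $\mathrm{Path}_{\mathbb F_2}(\Gamma_W)$ takes values in $e_W\mathcal B(n,k,\mathcal S)e_W$ and induces a ring isomorphism $$\mathrm{Path}_{\mathbb F_2}(\Gamma_W)/(\mathcal R_W)\;\xrightarrow{\ \cong\ }\;e_W\,\mathcal B(n,k,\mathcal S)\,e_W,$$ that is, $\mathrm{Quiv}(\Gamma_r,\widetilde{\mathcal R}_r)\cong\mathcal B_r(n,k,\mathcal S)$, $\mathrm{Quiv}(\Gamma_l,\widetilde{\mathcal R}_l)\cong\mathcal B_l(n,k,\mathcal S)$ and $\mathrm{Quiv}(\Gamma',\widetilde{\mathcal R}')\cong\mathcal B'(n,k,\mathcal S)$. It is an isomorphism of dg algebras: $\partial$ descends to the quotient, where it squares to zero and satisfies the Leibniz rule; the isomorphism intertwines the differentials; and it matches the homogeneous components for each of the unrefined, refined and single Alexander gradings taken together with the Maslov grading. -/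

import Mathlib

open scoped TensorProduct

set_option linter.unusedSectionVars false

noncomputable section

namespace KauffmanAlg

/-! ### Path algebras and quiver algebras with relations -/

section PathAlgebra

variable (𝕜 : Type) [CommRing 𝕜] (V : Type) [Quiver.{0} V]

/-- The path algebra of a quiver with finitely many vertices, as the direct sum over all pairs of
vertices `x`, `y` of the free `𝕜`-modules spanned by the paths from `x` to `y`. -/
def PathAlg : Type := ∀ x y : V, Quiver.Path x y →₀ 𝕜

instance : AddCommGroup (PathAlg 𝕜 V) :=
  inferInstanceAs (AddCommGroup (∀ x y : V, Quiver.Path x y →₀ 𝕜))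

instance : Module 𝕜 (PathAlg 𝕜 V) :=
  inferInstanceAs (Module 𝕜 (∀ x y : V, Quiver.Path x y →₀ 𝕜))

variable {V}

/-- Concatenation of paths, extended bilinearly. -/
def pcomp (x y z : V) :
    (Quiver.Path x y →₀ 𝕜) →ₗ[𝕜] (Quiver.Path y z →₀ 𝕜) →ₗ[𝕜] (Quiver.Path x z →₀ 𝕜) :=
  Finsupp.linearCombination 𝕜 (fun p => Finsupp.lmapDomain 𝕜 𝕜 (fun q => p.comp q))

lemma pcomp_single (x y z : V) (p : Quiver.Path x y) (q : Quiver.Path y z) (c d : 𝕜) :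
    pcomp 𝕜 x y z (Finsupp.single p c) (Finsupp.single q d) =
      Finsupp.single (p.comp q) (c * d) := by
  simp [pcomp, Finsupp.mapDomain_single]

lemma pcomp_assoc (w x y z : V) (a : Quiver.Path w x →₀ 𝕜) (b : Quiver.Path x y →₀ 𝕜)
    (c : Quiver.Path y z →₀ 𝕜) :
    pcomp 𝕜 w y z (pcomp 𝕜 w x y a b) c = pcomp 𝕜 w x z a (pcomp 𝕜 x y z b c) := by
  induction a using Finsupp.induction_linear with
  | zero => simp
  | add a a' ha ha' => simp [ha, ha']
  | single p r =>
    induction b using Finsupp.induction_linear with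
    | zero => simp
    | add b b' hb hb' => simp [hb, hb']
    | single q s =>
      induction c using Finsupp.induction_linear with
      | zero => simp
      | add c c' hc hc' => simp [hc, hc']
      | single t u => rw [pcomp_single, pcomp_single, pcomp_single, pcomp_single,
          Quiver.Path.comp_assoc, mul_assoc]

lemma nil_pcomp (x y : V) (a : Quiver.Path x y →₀ 𝕜) :
    pcomp 𝕜 x x y (Finsupp.single Quiver.Path.nil 1) a = a := by
  induction a using Finsupp.induction_linear with
  | zero => simp
  | add a a' ha ha' => simp [ha, ha']
  | single p r => simp [pcomp_single]

lemma pcomp_nil (x y : V) (a : Quiver.Path x y →₀ 𝕜) :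
    pcomp 𝕜 x y y a (Finsupp.single Quiver.Path.nil 1) = a := by
  induction a using Finsupp.induction_linear with
  | zero => simp
  | add a a' ha ha' => simp [ha, ha']
  | single p r => simp [pcomp_single]

variable [Fintype V] [DecidableEq V]

/-- The element of the path algebra with the single component `a` at `(x, y)`. -/
def PathAlg.single (x y : V) (a : Quiver.Path x y →₀ 𝕜) : PathAlg 𝕜 V :=
  Pi.single x (Pi.single y a)

/-- The path `p` as an element of the path algebra. -/
def PathAlg.path {x y : V} (p : Quiver.Path x y) : PathAlg 𝕜 V :=
  PathAlg.single 𝕜 x y (Finsupp.single p 1)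

/-- The distinguished idempotent `I_x`: the path of length zero at `x`. -/
def PathAlg.idem (x : V) : PathAlg 𝕜 V := PathAlg.path 𝕜 (Quiver.Path.nil : Quiver.Path x x)

instance : Mul (PathAlg 𝕜 V) := ⟨fun a b x z => ∑ y, pcomp 𝕜 x y z (a x y) (b y z)⟩

instance : One (PathAlg 𝕜 V) := ⟨∑ x, PathAlg.idem 𝕜 x⟩

variable {𝕜}

lemma PathAlg.ext' {a b : PathAlg 𝕜 V} (h : ∀ x y, a x y = b x y) : a = b :=
  funext fun x => funext fun y => h x y

lemma PathAlg.add_apply (a b : PathAlg 𝕜 V) (x z : V) : (a + b) x z = a x z + b x z := rfl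

lemma PathAlg.zero_apply (x z : V) : (0 : PathAlg 𝕜 V) x z = 0 := rfl

lemma PathAlg.smul_apply (c : 𝕜) (a : PathAlg 𝕜 V) (x z : V) : (c • a) x z = c • a x z := rfl

lemma PathAlg.mul_apply (a b : PathAlg 𝕜 V) (x z : V) :
    (a * b) x z = ∑ y, pcomp 𝕜 x y z (a x y) (b y z) := rfl

lemma PathAlg.sum_apply {ι : Type} (s : Finset ι) (f : ι → PathAlg 𝕜 V) (x z : V) :
    (∑ i ∈ s, f i) x z = ∑ i ∈ s, f i x z :=
  map_sum (AddMonoidHom.mk' (fun a : PathAlg 𝕜 V => a x z) fun _ _ => rfl) f s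

lemma PathAlg.one_apply_same (x : V) :
    (1 : PathAlg 𝕜 V) x x = Finsupp.single Quiver.Path.nil 1 := by
  have h : (1 : PathAlg 𝕜 V) = ∑ w, PathAlg.idem 𝕜 w := rfl
  rw [h, PathAlg.sum_apply, Finset.sum_eq_single x]
  · simp [PathAlg.idem, PathAlg.path, PathAlg.single]
  · intro w _ hw
    simp [PathAlg.idem, PathAlg.path, PathAlg.single, Pi.single_eq_of_ne hw.symm]
  · simp

lemma PathAlg.one_apply_ne {x y : V} (h : x ≠ y) : (1 : PathAlg 𝕜 V) x y = 0 := by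
  have h1 : (1 : PathAlg 𝕜 V) = ∑ w, PathAlg.idem 𝕜 w := rfl
  rw [h1, PathAlg.sum_apply]
  refine Finset.sum_eq_zero fun w _ => ?_
  by_cases hw : w = x
  · subst hw
    simp [PathAlg.idem, PathAlg.path, PathAlg.single, Pi.single_eq_of_ne h.symm]
  · simp [PathAlg.idem, PathAlg.path, PathAlg.single, Pi.single_eq_of_ne (Ne.symm hw)]

instance : Ring (PathAlg 𝕜 V) where
  __ := (inferInstance : AddCommGroup (PathAlg 𝕜 V))
  left_distrib a b c := PathAlg.ext' fun x y => by
    simp [PathAlg.mul_apply, PathAlg.add_apply, Finset.sum_add_distrib]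
  right_distrib a b c := PathAlg.ext' fun x y => by
    simp [PathAlg.mul_apply, PathAlg.add_apply, Finset.sum_add_distrib]
  zero_mul a := PathAlg.ext' fun x y => by simp [PathAlg.mul_apply, PathAlg.zero_apply]
  mul_zero a := PathAlg.ext' fun x y => by simp [PathAlg.mul_apply, PathAlg.zero_apply]
  mul_assoc a b c := PathAlg.ext' fun x y => by
    simp only [PathAlg.mul_apply, map_sum, LinearMap.sum_apply, pcomp_assoc]
    rw [Finset.sum_comm]
  one_mul a := PathAlg.ext' fun x y => by
    rw [PathAlg.mul_apply, Finset.sum_eq_single x]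
    · rw [PathAlg.one_apply_same, nil_pcomp]
    · intro w _ hw
      rw [PathAlg.one_apply_ne hw.symm]; simp
    · simp
  mul_one a := PathAlg.ext' fun x y => by
    rw [PathAlg.mul_apply, Finset.sum_eq_single y]
    · rw [PathAlg.one_apply_same, pcomp_nil]
    · intro w _ hw
      rw [PathAlg.one_apply_ne hw]; simp
    · simp

instance : Algebra 𝕜 (PathAlg 𝕜 V) :=
  Algebra.ofModule
    (fun c a b => PathAlg.ext' fun x y => by
      simp [PathAlg.mul_apply, PathAlg.smul_apply, Finset.smul_sum])
    (fun c a b => PathAlg.ext' fun x y => by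
      simp [PathAlg.mul_apply, PathAlg.smul_apply, Finset.smul_sum])

lemma PathAlg.single_mul_single (x y z : V) (a : Quiver.Path x y →₀ 𝕜)
    (b : Quiver.Path y z →₀ 𝕜) :
    PathAlg.single 𝕜 x y a * PathAlg.single 𝕜 y z b =
      PathAlg.single 𝕜 x z (pcomp 𝕜 x y z a b) := by
  refine PathAlg.ext' fun u w => ?_
  rw [PathAlg.mul_apply, Finset.sum_eq_single y]
  · by_cases hu : u = x
    · subst hu
      by_cases hw : w = z
      · subst hw; simp [PathAlg.single]
      · simp [PathAlg.single, Pi.single_eq_of_ne hw]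
    · simp [PathAlg.single, Pi.single_eq_of_ne hu]
  · intro v _ hv
    simp [PathAlg.single, Pi.single_eq_of_ne hv]
  · simp

lemma PathAlg.single_mul_single_ne (w x y z : V) (h : x ≠ y) (a : Quiver.Path w x →₀ 𝕜)
    (b : Quiver.Path y z →₀ 𝕜) :
    PathAlg.single 𝕜 w x a * PathAlg.single 𝕜 y z b = 0 := by
  refine PathAlg.ext' fun u v => ?_
  rw [PathAlg.mul_apply, PathAlg.zero_apply]
  refine Finset.sum_eq_zero fun t _ => ?_
  by_cases ht : t = y
  · subst ht
    have : PathAlg.single 𝕜 w x a u t = 0 := by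
      by_cases hu : u = w
      · subst hu; simp [PathAlg.single, Pi.single_eq_of_ne h.symm]
      · simp [PathAlg.single, Pi.single_eq_of_ne hu]
    simp [this]
  · simp [PathAlg.single, Pi.single_eq_of_ne ht]

lemma PathAlg.isIdempotentElem_sum_idem (W : Finset V) :
    IsIdempotentElem (∑ x ∈ W, PathAlg.idem 𝕜 x) := by
  rw [IsIdempotentElem, Finset.sum_mul]
  refine Finset.sum_congr rfl fun x hx => ?_
  rw [Finset.mul_sum, Finset.sum_eq_single x]
  · rw [PathAlg.idem, PathAlg.path, PathAlg.single_mul_single, nil_pcomp]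
  · intro y _ hy
    exact PathAlg.single_mul_single_ne _ _ _ _ hy.symm _ _
  · intro h; exact absurd hx h

end PathAlgebra

/-- The quotient of a ring by the two-sided ideal generated by `R`. For a set `R` of relations in
a path algebra this is the quiver algebra with relations. -/
abbrev Quiv {A : Type} [Ring A] (R : Set A) : Type := (TwoSidedIdeal.span R).ringCon.Quotient

/-- The quotient map. -/
def Quiv.mk {A : Type} [Ring A] (R : Set A) : A →+* Quiv R := (TwoSidedIdeal.span R).ringCon.mk'

/-! ### I-states and the algebra `B₀(n,k)` -/

/-- The I-states: `k`-element subsets of `[0,n]`. -/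
abbrev IState (n k : ℕ) : Type := {x : Finset (Fin (n + 1)) // x.card = k}

/-- The coefficient ring `𝔽₂[U_1,…,U_n]`. The `n` lines are indexed by `Fin n`; the element
`i : Fin n` stands for line number `i + 1`, which separates the regions `i.castSucc` and `i.succ`
in `[0,n] = Fin (n + 1)`. -/
abbrev Coeff (n : ℕ) : Type := MvPolynomial (Fin n) (ZMod 2)

variable {n k : ℕ}

/-- The minimal relative weight vector. -/
def relWeight (x y : IState n k) (i : Fin n) : ℤ :=
  ((y.1.filter (fun t => i.succ ≤ t)).card : ℤ) - ((x.1.filter (fun t => i.succ ≤ t)).card : ℤ)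

/-- The monomial `∏ U_i ^ ((|v|_i(y,z) - |v|_i(x,z) + |v|_i(x,y)) / 2)`; the numerator is always
a nonnegative even integer. -/
def prodMonomial (x y z : IState n k) : Coeff n :=
  ∏ i, MvPolynomial.X i ^
    ((|relWeight y z i| - |relWeight x z i| + |relWeight x y i|) / 2).toNat

variable (n k) in
/-- The vertices of the complete directed graph `K(n,k)`. -/
def KVert : Type := IState n k

instance : Fintype (KVert n k) := inferInstanceAs (Fintype (IState n k))
instance : DecidableEq (KVert n k) := inferInstanceAs (DecidableEq (IState n k))

/-- Exactly one edge for every ordered pair of vertices. -/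
instance : Quiver.{0} (KVert n k) := ⟨fun _ _ => Unit⟩

variable (n k) in
/-- The path algebra of `K(n,k)` over `𝔽₂[U_1,…,U_n]`. -/
abbrev PathK : Type := PathAlg (Coeff n) (KVert n k)

/-- The edge `f_{x,y}` of `K(n,k)`. -/
def kEdge (x y : KVert n k) : PathK n k :=
  PathAlg.path (Coeff n) (Quiver.Hom.toPath (show x ⟶ y from ()))

variable (n k) in
/-- The relations `f_{x,y} f_{y,z} = ∏ U_i^… f_{x,z}`, and `f_{x,x} = I_x`. -/
def relK : Set (PathK n k) :=
  {r | ∃ x y z : KVert n k,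
    r = kEdge x y * kEdge y z - prodMonomial (n := n) (k := k) x y z • kEdge x z} ∪
  {r | ∃ x : KVert n k, r = kEdge x x - PathAlg.idem (Coeff n) x}

variable (n k) in
/-- The algebra `B₀(n,k)`. -/
abbrev B0 : Type := Quiv (relK n k)

/-- The element `f_{x,y}` of `B₀(n,k)`. -/
def B0.f (x y : IState n k) : B0 n k := Quiv.mk (relK n k) (kEdge (n := n) (k := k) x y)

/-- The idempotent `I_x` of `B₀(n,k)`. -/
def B0.idem (x : IState n k) : B0 n k :=
  Quiv.mk (relK n k) (PathAlg.idem (V := KVert n k) (Coeff n) x)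

/-! ### The algebra `B(n,k)` -/

/-- `y` arises from `x` by moving a dot from region `i.castSucc` to the empty region `i.succ`. -/
def IsRStep (i : Fin n) (x y : IState n k) : Prop :=
  i.castSucc ∈ x.1 ∧ i.succ ∉ x.1 ∧ y.1 = insert i.succ (x.1.erase i.castSucc)

/-- `y` arises from `x` by moving a dot from region `i.succ` to the empty region `i.castSucc`. -/
def IsLStep (i : Fin n) (x y : IState n k) : Prop :=
  i.succ ∈ x.1 ∧ i.castSucc ∉ x.1 ∧ y.1 = insert i.castSucc (x.1.erase i.succ)

instance (i : Fin n) (x y : IState n k) : Decidable (IsRStep i x y) := by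
  unfold IsRStep; infer_instance

instance (i : Fin n) (x y : IState n k) : Decidable (IsLStep i x y) := by
  unfold IsLStep; infer_instance

variable (k) in
/-- The element `R_i` of `B₀(n,k)`. -/
def B0.R (i : Fin n) : B0 n k :=
  ∑ x : IState n k, ∑ y : IState n k, if IsRStep i x y then B0.f x y else 0

variable (k) in
/-- The element `L_i` of `B₀(n,k)`. -/
def B0.L (i : Fin n) : B0 n k :=
  ∑ x : IState n k, ∑ y : IState n k, if IsLStep i x y then B0.f x y else 0

variable (k) in
/-- The element `U_i` of `B₀(n,k)`. -/
def B0.U (i : Fin n) : B0 n k :=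
  ∑ x : IState n k, (MvPolynomial.X i : Coeff n) • B0.f x x

variable (n k) in
/-- The elements `R_i R_{i+1}`, `L_{i+1} L_i`, and `I_x U_i` for `x` disjoint from `{i-1,i}`. -/
def relB : Set (B0 n k) :=
  {r | ∃ i j : Fin n, (j : ℕ) = i + 1 ∧
    (r = B0.R k i * B0.R k j ∨ r = B0.L k j * B0.L k i)} ∪
  {r | ∃ (i : Fin n) (x : IState n k), i.castSucc ∉ x.1 ∧ i.succ ∉ x.1 ∧
    r = B0.idem x * B0.U k i}

variable (n k) in
/-- The algebra `B(n,k)`. -/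
abbrev B : Type := Quiv (relB n k)

/-- The class of `f_{x,y}` in `B(n,k)`. -/
def B.f (x y : IState n k) : B n k := Quiv.mk (relB n k) (B0.f x y)

/-- The idempotent `I_x` of `B(n,k)`. -/
def B.idem (x : IState n k) : B n k := Quiv.mk (relB n k) (B0.idem x)

/-! ### The dg algebra `B(n,k,S)` and its truncations -/

variable (S : Finset (Fin n))

/-- The exterior algebra over `𝔽₂[U_1,…,U_n]` in variables `C_i`, `i ∈ S`. -/
abbrev Ext : Type := ExteriorAlgebra (Coeff n) (S → Coeff n)

/-- The exterior variable `C_i`. -/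
def Ext.C (i : S) : Ext S := ExteriorAlgebra.ι (Coeff n) (Pi.single i 1)

variable (k) in
/-- The algebra `B(n,k,S)`: the tensor product of `B(n,k)` with the exterior algebra. (Tensoring
over `𝔽₂[U_1,…,U_n]` with the exterior algebra over `𝔽₂[U_1,…,U_n]` is the same as tensoring over
`𝔽₂` with the exterior algebra over `𝔽₂`.) -/
abbrev BS : Type := B n k ⊗[Coeff n] Ext S

variable (k) in
/-- The differential on `B(n,k,S)`: the derivation with `∂ C_i = U_i` that vanishes on `B(n,k)`,
namely `∂ (b ⊗ ω) = ∑ i ∈ S, U_i b ⊗ (C_i^* ⌟ ω)`. -/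
def BS.d : BS k S →ₗ[Coeff n] BS k S :=
  ∑ i : S, (MvPolynomial.X (i : Fin n) : Coeff n) •
    TensorProduct.map (LinearMap.id : B n k →ₗ[Coeff n] B n k)
      (CliffordAlgebra.contractLeft (Q := (0 : QuadraticForm (Coeff n) (S → Coeff n)))
        (LinearMap.proj (φ := fun _ : S => Coeff n) i))

/-- The idempotent `∑_{x ∈ W} I_x` of `B(n,k,S)`. -/
def BS.idemSum (W : Finset (IState n k)) : BS k S := (∑ x ∈ W, B.idem x) ⊗ₜ[Coeff n] (1 : Ext S)

lemma BS.isIdempotentElem_idemSum (W : Finset (IState n k)) :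
    IsIdempotentElem (BS.idemSum S W) := by
  have h := (PathAlg.isIdempotentElem_sum_idem (𝕜 := Coeff n) (V := KVert n k) W).map
    ((Quiv.mk (relB n k)).comp (Quiv.mk (relK n k)))
  have h2 : ((Quiv.mk (relB n k)).comp (Quiv.mk (relK n k)))
      (∑ x ∈ (show Finset (KVert n k) from W), PathAlg.idem (Coeff n) x) =
      ∑ x ∈ W, B.idem x := by
    rw [map_sum]; rfl
  rw [h2] at h
  rw [IsIdempotentElem, BS.idemSum, Algebra.TensorProduct.tmul_mul_tmul, h.eq, one_mul]

/-- The truncation `(∑_{x ∈ W} I_x) B(n,k,S) (∑_{x ∈ W} I_x)`, i.e. the algebra of the full dg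
subcategory on the objects `W`. -/
abbrev Trunc (W : Finset (IState n k)) : Type := (BS.isIdempotentElem_idemSum S W).Corner

variable {S} in
/-- An element of the truncation as an element of `B(n,k,S)`. -/
def Trunc.val {W : Finset (IState n k)} (t : Trunc S W) : BS k S := Subtype.val t

variable (n k) in
/-- The I-states not containing `0`. -/
def Vr : Finset (IState n k) := Finset.univ.filter (fun x => (0 : Fin (n + 1)) ∉ x.1)

variable (n k) in
/-- The I-states not containing `n`. -/
def Vl : Finset (IState n k) := Finset.univ.filter (fun x => Fin.last n ∉ x.1)

variable (n k) in
/-- The I-states containing neither `0` nor `n`. -/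
def Vrl : Finset (IState n k) :=
  Finset.univ.filter (fun x => (0 : Fin (n + 1)) ∉ x.1 ∧ Fin.last n ∉ x.1)

/-- `B_r(n,k,S)`. -/
abbrev Br (k : ℕ) (S : Finset (Fin n)) : Type := Trunc S (Vr n k)

/-- `B_l(n,k,S)`. -/
abbrev Bl (k : ℕ) (S : Finset (Fin n)) : Type := Trunc S (Vl n k)

/-- `B'(n,k,S)`. -/
abbrev Bprime (k : ℕ) (S : Finset (Fin n)) : Type := Trunc S (Vrl n k)

/-! ### The quiver `Γ(n,k,S)` and its full subquivers -/

variable (n) in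
/-- The labels `R_i`, `L_i`, `U_i`, `C_i` of arrows. -/
inductive Label : Type
  | R (i : Fin n) : Label
  | L (i : Fin n) : Label
  | U (i : Fin n) : Label
  | C (i : Fin n) : Label

/-- There is an arrow in `Γ(n,k,S)` from `x` to `y` with the given label. -/
def IsArrow (x y : IState n k) : Label n → Prop
  | Label.R i => IsRStep i x y
  | Label.L i => IsLStep i x y
  | Label.U _ => x = y
  | Label.C i => i ∈ S ∧ x = y

/-- The vertices of the full subquiver of `Γ(n,k,S)` on the vertex set `W`. The quiver `Γ(n,k,S)`
itself is the case `W = univ`. -/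
def GVert (_ : Finset (Fin n)) (W : Finset (IState n k)) : Type := {x : IState n k // x ∈ W}

variable {S} {W : Finset (IState n k)}

instance : Fintype (GVert S W) := inferInstanceAs (Fintype {x : IState n k // x ∈ W})
instance : DecidableEq (GVert S W) := inferInstanceAs (DecidableEq {x : IState n k // x ∈ W})

/-- The I-state underlying a vertex. -/
def GVert.state (x : GVert S W) : IState n k := x.1

instance : Quiver.{0} (GVert S W) := ⟨fun x y => {ℓ : Label n // IsArrow S x.state y.state ℓ}⟩

/-- The label of an arrow. -/
def arrowLabel {x y : GVert S W} (e : x ⟶ y) : Label n := e.1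

/-- The sequence of labels of a path. -/
def pathLabels {x : GVert S W} : {y : GVert S W} → Quiver.Path x y → List (Label n)
  | _, .nil => []
  | _, .cons p e => pathLabels p ++ [arrowLabel e]

variable (S W) in
/-- The path algebra over `𝔽₂` of the full subquiver on `W`. -/
abbrev PathG : Type := PathAlg (ZMod 2) (GVert S W)

variable (S k) in
/-- The path algebra of `Γ(n,k,S)`. -/
abbrev PathGamma : Type := PathG S (Finset.univ : Finset (IState n k))

/-- The noncommutative monomial `μ(γ)` of a path, extended linearly to `Hom` spaces. -/
def mu {x y : GVert S W} (a : Quiver.Path x y →₀ ZMod 2) : FreeAlgebra (ZMod 2) (Label n) :=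
  a.sum fun p c => c • ((pathLabels p).map (FreeAlgebra.ι (ZMod 2))).prod

/-- A label as a generator of the free algebra. -/
def lab (ℓ : Label n) : FreeAlgebra (ZMod 2) (Label n) := FreeAlgebra.ι (ZMod 2) ℓ

open Label in
/-- The noncommutative polynomials that are relations wherever they make sense: the `U` central,
loop, distant commutation, two-line pass, `C²` vanishing and `C` central relations. -/
inductive IsRelWord (S : Finset (Fin n)) : FreeAlgebra (ZMod 2) (Label n) → Prop
  | RU (i j : Fin n) : IsRelWord S (lab (R i) * lab (U j) - lab (U j) * lab (R i))
  | LU (i j : Fin n) : IsRelWord S (lab (L i) * lab (U j) - lab (U j) * lab (L i))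
  | UU (i j : Fin n) : IsRelWord S (lab (U i) * lab (U j) - lab (U j) * lab (U i))
  | RL (i : Fin n) : IsRelWord S (lab (R i) * lab (L i) - lab (U i))
  | LR (i : Fin n) : IsRelWord S (lab (L i) * lab (R i) - lab (U i))
  | distRR (i j : Fin n) (h : 1 < |(i : ℤ) - j|) :
      IsRelWord S (lab (R i) * lab (R j) - lab (R j) * lab (R i))
  | distLL (i j : Fin n) (h : 1 < |(i : ℤ) - j|) :
      IsRelWord S (lab (L i) * lab (L j) - lab (L j) * lab (L i))
  | distRL (i j : Fin n) (h : 1 < |(i : ℤ) - j|) :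
      IsRelWord S (lab (R i) * lab (L j) - lab (L j) * lab (R i))
  | twoR (i j : Fin n) (h : (j : ℕ) = i + 1) : IsRelWord S (lab (R i) * lab (R j))
  | twoL (i j : Fin n) (h : (j : ℕ) = i + 1) : IsRelWord S (lab (L j) * lab (L i))
  | CC (i : Fin n) (hi : i ∈ S) : IsRelWord S (lab (C i) * lab (C i))
  | CR (i j : Fin n) (hi : i ∈ S) : IsRelWord S (lab (C i) * lab (R j) + lab (R j) * lab (C i))
  | CL (i j : Fin n) (hi : i ∈ S) : IsRelWord S (lab (C i) * lab (L j) + lab (L j) * lab (C i))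
  | CU (i j : Fin n) (hi : i ∈ S) : IsRelWord S (lab (C i) * lab (U j) + lab (U j) * lab (C i))
  | CCcomm (i j : Fin n) (hi : i ∈ S) (hj : j ∈ S) :
      IsRelWord S (lab (C i) * lab (C j) + lab (C j) * lab (C i))

variable (S k) in
/-- The full relation set of `Γ(n,k,S)`, including the `U` vanishing relations. -/
def relGamma : Set (PathGamma k S) :=
  {r | ∃ (x y : GVert S (Finset.univ : Finset (IState n k))) (a : Quiver.Path x y →₀ ZMod 2),
    IsRelWord S (mu a) ∧ r = PathAlg.single (ZMod 2) x y a} ∪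
  {r | ∃ (x : GVert S (Finset.univ : Finset (IState n k))) (i : Fin n)
    (a : Quiver.Path x x →₀ ZMod 2), i.castSucc ∉ x.state.1 ∧ i.succ ∉ x.state.1 ∧
    mu a = lab (Label.U i) ∧ r = PathAlg.single (ZMod 2) x x a}

variable (S W) in
/-- The inclusion of the full subquiver on `W` into `Γ(n,k,S)`. -/
def inclQuiver : GVert S W ⥤q GVert S (Finset.univ : Finset (IState n k)) where
  obj x := ⟨x.1, Finset.mem_univ _⟩
  map e := e

variable (S W) in
/-- The induced (non-unital) inclusion of path algebras. -/
def incl (a : PathG S W) : PathGamma k S :=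
  ∑ x, ∑ y, PathAlg.single (ZMod 2) ((inclQuiver S W).obj x) ((inclQuiver S W).obj y)
    ((a x y).mapDomain (inclQuiver S W).mapPath)

variable (S W) in
/-- The relations of `Γ(n,k,S)` that lie in the path algebra of the full subquiver on `W`. -/
def relSub : Set (PathG S W) := {r | incl S W r ∈ relGamma k S}

variable (k S) in
/-- If `k = n - 1`, the additional relation `U_1 ⋯ U_n` at the vertex `[1,n-1]`; otherwise no
additional relation. -/
def relExtra : Set (PathG S (Vrl n k)) :=
  {r | k + 1 = n ∧ ∃ (x : GVert S (Vrl n k)) (p : Quiver.Path x x),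
    (∀ t : Fin (n + 1), t ∈ x.state.1 ↔ t ≠ 0 ∧ t ≠ Fin.last n) ∧
    pathLabels p = List.ofFn Label.U ∧ r = PathAlg.path (ZMod 2) p}

/-- `Quiv(Γ_r(n,k,S), R̃_r)`. -/
abbrev QuivR (k : ℕ) (S : Finset (Fin n)) : Type := Quiv (relSub S (Vr n k))

/-- `Quiv(Γ_l(n,k,S), R̃_l)`. -/
abbrev QuivL (k : ℕ) (S : Finset (Fin n)) : Type := Quiv (relSub S (Vl n k))

/-- `Quiv(Γ'(n,k,S), R̃')`. -/
abbrev QuivPrime (k : ℕ) (S : Finset (Fin n)) : Type := Quiv (relSub S (Vrl n k) ∪ relExtra k S)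

/-! ### The differential on path algebras -/

/-- The differential of an arrow: an arrow labelled `C_i` is sent to the loop labelled `U_i` at the
same vertex, all other arrows are sent to zero. -/
def arrowD {x y : GVert S W} : (x ⟶ y) → ((x ⟶ y) →₀ ZMod 2)
  | ⟨Label.C i, h⟩ => Finsupp.single ⟨Label.U i, h.2⟩ 1
  | _ => 0

/-- The differential of a path, by the Leibniz rule. -/
def pathD {x : GVert S W} : {y : GVert S W} → Quiver.Path x y → (Quiver.Path x y →₀ ZMod 2)
  | _, .nil => 0
  | _, .cons p e =>
      (pathD p).mapDomain (fun q => q.cons e) + (arrowD e).mapDomain (fun e' => p.cons e')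

variable (S W) in
/-- The differential on the path algebra. -/
def pathAlgD (a : PathG S W) : PathG S W := fun x y => (a x y).sum fun p c => c • pathD p

/-! ### The map `F` -/

/-- `F` on arrows of `Γ(n,k,S)`: arrows `x → y` labelled `R_i` or `L_i` go to `f_{x,y}`, the loop
`U_i` at `x` goes to `U_i I_x`, and the loop `C_i` at `x` goes to `I_x C_i`. -/
def arrowF {x y : GVert S W} : (x ⟶ y) → BS k S
  | ⟨Label.R _, _⟩ => B.f x.state y.state ⊗ₜ[Coeff n] (1 : Ext S)
  | ⟨Label.L _, _⟩ => B.f x.state y.state ⊗ₜ[Coeff n] (1 : Ext S)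
  | ⟨Label.U i, _⟩ => ((MvPolynomial.X i : Coeff n) • B.idem x.state) ⊗ₜ[Coeff n] (1 : Ext S)
  | ⟨Label.C i, h⟩ => B.idem x.state ⊗ₜ[Coeff n] Ext.C S ⟨i, h.1⟩

/-- `F` on paths, multiplicatively; the path of length zero at `x` goes to `I_x`. -/
def pathF {x : GVert S W} : {y : GVert S W} → Quiver.Path x y → BS k S
  | _, .nil => B.idem x.state ⊗ₜ[Coeff n] (1 : Ext S)
  | _, .cons p e => pathF p * arrowF e

variable (k S) in
/-- The map `F` from the path algebra of `Γ(n,k,S)` to `B(n,k,S)`. -/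
def F (a : PathGamma k S) : BS k S :=
  ∑ x, ∑ y, (a x y).sum fun p c => (MvPolynomial.C c : Coeff n) • pathF p

/-! ### Gradings -/

variable (n) in
/-- The unrefined Alexander multi-degree (the coefficients of `τ_i` and `β_i` for each `i`)
together with the number of factors `C_i`. -/
abbrev MultiDeg : Type := (Fin n → ℤ × ℤ) × ℤ

/-- The degree of an arrow with the given label. -/
def labelDeg : Label n → MultiDeg n
  | Label.R i => (Pi.single i (1, 0), 0)
  | Label.L i => (Pi.single i (0, 1), 0)
  | Label.U i => (Pi.single i (1, 1), 0)
  | Label.C i => (Pi.single i (1, 1), 1)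

/-- The degree of a path. -/
def pathDeg {x y : GVert S W} (p : Quiver.Path x y) : MultiDeg n :=
  ((pathLabels p).map labelDeg).sum

/-- The generator `C_{i_1} ⋯ C_{i_l} U_1^{r_1} ⋯ U_n^{r_n} f_{x,y}` of `B(n,k,S)`. -/
def gen (x y : IState n k) (r : Fin n → ℕ) (l : List S) : BS k S :=
  ((∏ i, (MvPolynomial.X i : Coeff n) ^ r i) • B.f x y) ⊗ₜ[Coeff n] (l.map (Ext.C S)).prod

/-- The degree of the generator `C_{i_1} ⋯ C_{i_l} U_1^{r_1} ⋯ U_n^{r_n} f_{x,y}`. Halving the sum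
of the coefficients of `τ_i` and `β_i` gives `r_i + |v_i(x,y)| / 2`, plus one for a factor `C_i`. -/
def genDeg (x y : IState n k) (r : Fin n → ℕ) (l : List S) : MultiDeg n :=
  (fun i => ((r i : ℤ) + max (relWeight x y i) 0 + (l.map Subtype.val).count i,
    (r i : ℤ) + max (-relWeight x y i) 0 + (l.map Subtype.val).count i), l.length)

/-- The refined Alexander multi-degree. -/
def refinedDeg (d : MultiDeg n) : Fin n → ℚ := fun i => (((d.1 i).1 + (d.1 i).2 : ℤ) : ℚ) / 2

variable (S) in
/-- The single Alexander degree. -/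
def alexDeg (d : MultiDeg n) : ℚ := -∑ i ∈ S, refinedDeg d i + ∑ i ∈ Sᶜ, refinedDeg d i

variable (S) in
/-- The Maslov degree: the number of factors `C_i` minus `2 ∑ i ∈ S, w_i`. -/
def maslovDeg (d : MultiDeg n) : ℤ := d.2 - ∑ i ∈ S, ((d.1 i).1 + (d.1 i).2)

/-- The homogeneous elements of degree `g` of a quotient of the path algebra: the `𝔽₂`-span of the
classes of paths of degree `g`. -/
def homogQuiv {G : Type} (D : MultiDeg n → G) (R : Set (PathG S W)) (g : G) :
    AddSubgroup (Quiv R) :=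
  AddSubgroup.closure {q | ∃ (x y : GVert S W) (p : Quiver.Path x y),
    D (pathDeg p) = g ∧ q = Quiv.mk R (PathAlg.path (ZMod 2) p)}

variable (k S) in
/-- The homogeneous elements of degree `g` of `B(n,k,S)`: the `𝔽₂`-span of the generators of
degree `g`. -/
def homogB {G : Type} (D : MultiDeg n → G) (g : G) : AddSubgroup (BS k S) :=
  AddSubgroup.closure {b | ∃ (x y : IState n k) (r : Fin n → ℕ) (l : List S),
    l.Nodup ∧ D (genDeg x y r l) = g ∧ b = gen x y r l}

/-- A ring isomorphism `e` from the quiver algebra to the truncation preserves and reflects the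
grading obtained from the multi-degree by applying `D`. -/
def RespectsGrading {R : Set (PathG S W)} (e : Quiv R ≃+* Trunc S W) {G : Type}
    (D : MultiDeg n → G) : Prop :=
  ∀ (g : G) (q : Quiv R), q ∈ homogQuiv D R g ↔ Trunc.val (e q) ∈ homogB k S D g

/-- The restriction of `F` to the path algebra of the full subquiver on `W` takes values in the
truncation of `B(n,k,S)` to `W` and induces an isomorphism of dg algebras `e` from the quotient by
the relations `R`. Here `d` is the differential that the path algebra induces on the quotient, and
the gradings are the unrefined, refined and single Alexander gradings, each taken together with
the Maslov grading. -/
def InducesDGIso (W : Finset (IState n k)) (R : Set (PathG S W)) : Prop :=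
  ∃ (e : Quiv R ≃+* Trunc S W) (d : Quiv R →+ Quiv R),
    (∀ a : PathG S W, Trunc.val (e (Quiv.mk R a)) = F k S (incl S W a)) ∧
    (∀ a : PathG S W, d (Quiv.mk R a) = Quiv.mk R (pathAlgD S W a)) ∧
    (∀ q, d (d q) = 0) ∧
    (∀ q q', d (q * q') = d q * q' + q * d q') ∧
    (∀ q, Trunc.val (e (d q)) = BS.d k S (Trunc.val (e q))) ∧
    RespectsGrading e (fun δ => (δ.1, maslovDeg S δ)) ∧
    RespectsGrading e (fun δ => (refinedDeg δ, maslovDeg S δ)) ∧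
    RespectsGrading e (fun δ => (alexDeg S δ, maslovDeg S δ))

end KauffmanAlg

end

/-!
The I-states are encoded by their height functions `ht x t = #{s ∈ x | t ≤ s}`. In these terms
`relWeight x y i` is the difference of the heights of `y` and `x` at line `i`, and the arrows `R_i`
and `L_i` raise and lower the height at line `i` by one. The sets `Vr`, `Vl`, `Vrl` are convex
for the order of height functions, which is what makes paths in the full subquivers behave as they
do in the whole quiver.

On both sides of the isomorphism every element is a combination of elements `U^r C^l` times a
"shortest" element from `x` to `y`.

* In `B(n,k,S)` the shortest element is `f_{x,y}`. The element `U^r f_{x,y}` vanishes if and only if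
  the exponent is bad (`Bad`), which means that some way of going from `x` to `y` with this number
  of crossings passes through one of the monomial relations (`ZeroRel`): `R_i R_{i+1}`,
  `L_{i+1} L_i`, or `U_i` at a vertex that does not meet `{i-1,i}`. That bad elements vanish is
  `umon_smul_f_eq_zero`. For the converse, the coefficients of the `f_{x,y}` are well defined modulo
  the monomial ideals spanned by the bad exponents (`coordB`), so that the remaining generators are
  linearly independent (`bad_of_sum_gen_eq_zero`).
* In the quiver algebra the shortest element is the class `geo` of a geodesic, a path that crosses no
  line in both directions. Geodesics exist within a convex set of I-states, and all geodesics between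
  two vertices have the same class, because their last steps are equal or complete to a commuting
  square (`IsGeodesic.cls_eq`). The elements `U_i` and `C_i` are central, crossing a line back and
  forth is multiplication by `U_i`, and the classes `geo` satisfy the same product formula as the
  `f_{x,y}` (`geo_mul_geo`). Hence every path has a normal form (`cls_eq_monSmul_geo`), and the
  normal forms that are bad within the convex set vanish (`monSmul_geo_eq_zero`).

The map `F` preserves degrees, so that the image of a path is a generator determined by its end
points, its exterior variables and its degree (`pathF_eq_gen`); in particular the binary relations
are respected for degree reasons alone. The remaining point is that a relation that holds in
`B(n,k)` already holds in the truncation: a bad exponent between two states of `W` must be bad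
within `W` (`Bad.to_Vr`, `Bad.to_Vl`, `Bad.to_Vrl`). The states of a monomial relation are pushed into
`W` by taking joins with a fixed state, which does not increase the number of crossings. If the push
destroys the relation, the crossings saved suffice to visit a state where `U_1` vanishes; this
fails only for `W = Vrl` and `k = n - 1`, and this failure is the additional relation
`U_1 ⋯ U_n`.

The differential of `B(n,k,S)` is a contraction, hence a derivation of square zero; it is carried
over to the quiver algebra by the isomorphism and agrees with the Leibniz rule on paths.
-/

noncomputable section

namespace KauffmanAlg

/-! ### Height functions of I-states -/

section Heights

variable {n k : ℕ}

/-- The height function of an I-state `x`: the number of elements of `x` that are at least `t`.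
It decreases from `k` at `0` to `0` at `n + 1`, with steps `0` and `1`. -/
def ht (x : IState n k) (t : ℕ) : ℤ := ((x.1.filter fun s => t ≤ s.val).card : ℤ)

lemma ht_zero (x : IState n k) : ht x 0 = k := by
  simp [ht, x.2]

lemma ht_of_gt (x : IState n k) {t : ℕ} (h : n < t) : ht x t = 0 := by
  unfold ht
  rw [Finset.filter_false_of_mem (fun s _ => by have := s.2; omega)]
  simp

lemma ht_sub_succ (x : IState n k) (s : Fin (n + 1)) :
    ht x s.val - ht x (s.val + 1) = if s ∈ x.1 then 1 else 0 := by
  unfold ht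
  split_ifs with h
  · have : x.1.filter (fun t => s.val ≤ t.val) =
        insert s (x.1.filter fun t => s.val + 1 ≤ t.val) := by
      ext t
      simp only [Finset.mem_filter, Finset.mem_insert, Fin.ext_iff]
      constructor
      · rintro ⟨h1, h2⟩
        by_cases h3 : t.val = s.val
        · exact Or.inl h3
        · exact Or.inr ⟨h1, by omega⟩
      · rintro (h3 | ⟨h1, h2⟩)
        · have : t = s := Fin.ext h3
          subst this
          exact ⟨h, le_rfl⟩
        · exact ⟨h1, by omega⟩
    rw [this, Finset.card_insert_of_notMem (by simp)]
    push_cast; ring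
  · have : x.1.filter (fun t => s.val ≤ t.val) = x.1.filter fun t => s.val + 1 ≤ t.val := by
      refine Finset.filter_congr fun t ht => ?_
      have : t.val ≠ s.val := fun h3 => h (Fin.ext h3 ▸ ht)
      omega
    rw [this]; ring

lemma mem_iff_ht (x : IState n k) (s : Fin (n + 1)) :
    s ∈ x.1 ↔ ht x s.val - ht x (s.val + 1) = 1 := by
  rw [ht_sub_succ]; split_ifs with h <;> simp [h]

lemma notMem_iff_ht (x : IState n k) (s : Fin (n + 1)) :
    s ∉ x.1 ↔ ht x s.val = ht x (s.val + 1) := by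
  have := ht_sub_succ x s
  split_ifs at this with h <;> simp only [h, not_true, not_false_iff, true_iff, false_iff] <;> omega

lemma ht_step (x : IState n k) (t : ℕ) : ht x (t + 1) ≤ ht x t ∧ ht x t ≤ ht x (t + 1) + 1 := by
  by_cases h : t < n + 1
  · have := ht_sub_succ x ⟨t, h⟩
    simp only at this
    split_ifs at this <;> omega
  · rw [ht_of_gt x (by omega), ht_of_gt x (by omega)]; omega

lemma ht_ge (x : IState n k) (t : ℕ) : (k : ℤ) - t ≤ ht x t := by
  induction t with
  | zero => simp [ht_zero]
  | succ t ih => have := ht_step x t; push_cast; omega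

lemma ht_le (x : IState n k) (t : ℕ) : ht x t ≤ k := by
  induction t with
  | zero => simp [ht_zero]
  | succ t ih => have := ht_step x t; omega

lemma ht_le_sub (x : IState n k) {t : ℕ} (h : t ≤ n + 1) : ht x t ≤ (n : ℤ) + 1 - t := by
  obtain ⟨d, hd⟩ := Nat.exists_eq_add_of_le h
  induction d generalizing t with
  | zero => rw [ht_of_gt x (by omega)]; omega
  | succ d ih => have := ht_step x t; have := ih (t := t + 1) (by omega) (by omega); omega

lemma ext_ht {x y : IState n k} (h : ∀ t, ht x t = ht y t) : x = y := by
  apply Subtype.ext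
  ext s
  rw [mem_iff_ht, mem_iff_ht, h, h]

/-- A state agrees with another as soon as their heights agree at the `n` lines. -/
lemma ext_ht' {x y : IState n k} (h : ∀ i : Fin n, ht x (i + 1) = ht y (i + 1)) : x = y := by
  refine ext_ht fun t => ?_
  rcases Nat.eq_zero_or_pos t with rfl | h0
  · rw [ht_zero, ht_zero]
  by_cases h1 : t ≤ n
  · have := h ⟨t - 1, by omega⟩
    simp only [Nat.sub_add_cancel h0] at this
    exact this
  · rw [ht_of_gt x (by omega), ht_of_gt y (by omega)]

/-- Every lattice path with steps `0` and `1` from height `k` to height `0` is the height function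
of an I-state. -/
lemma exists_ht (h : ℕ → ℤ) (h0 : h 0 = k) (h1 : ∀ t, n < t → h t = 0)
    (hs : ∀ t, h (t + 1) ≤ h t ∧ h t ≤ h (t + 1) + 1) : ∃ x : IState n k, ∀ t, ht x t = h t := by
  have key : ∀ t, (((Finset.univ : Finset (Fin (n + 1))).filter
      (fun s => t ≤ s.val ∧ h s.val - h (s.val + 1) = 1)).card : ℤ) = h t := by
    intro t
    by_cases ht' : n < t
    · rw [h1 t ht', Finset.filter_false_of_mem (fun s _ => by have := s.2; omega)]
      simp
    · obtain ⟨d, hd⟩ := Nat.exists_eq_add_of_le (show t ≤ n + 1 by omega)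
      clear ht'
      induction d generalizing t with
      | zero =>
        rw [h1 t (by omega), Finset.filter_false_of_mem (fun s _ => by have := s.2; omega)]
        simp
      | succ d ih =>
        have ih := ih (t + 1) (by omega)
        by_cases hd' : h t - h (t + 1) = 1
        · have : (Finset.univ : Finset (Fin (n + 1))).filter
              (fun s => t ≤ s.val ∧ h s.val - h (s.val + 1) = 1) =
              insert ⟨t, by omega⟩ ((Finset.univ : Finset (Fin (n + 1))).filter
              (fun s => t + 1 ≤ s.val ∧ h s.val - h (s.val + 1) = 1)) := by
            ext s
            simp only [Finset.mem_filter, Finset.mem_univ, true_and, Finset.mem_insert,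
              Fin.ext_iff]
            constructor
            · rintro ⟨a, b⟩
              by_cases hs : s.val = t
              · exact Or.inl hs
              · exact Or.inr ⟨by omega, b⟩
            · rintro (a | ⟨a, b⟩)
              · rw [a]; exact ⟨le_rfl, hd'⟩
              · exact ⟨by omega, b⟩
          rw [this, Finset.card_insert_of_notMem (by simp)]
          push_cast
          omega
        · have : (Finset.univ : Finset (Fin (n + 1))).filter
              (fun s => t ≤ s.val ∧ h s.val - h (s.val + 1) = 1) =
              ((Finset.univ : Finset (Fin (n + 1))).filter
              (fun s => t + 1 ≤ s.val ∧ h s.val - h (s.val + 1) = 1)) := by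
            refine Finset.filter_congr fun s _ => ?_
            constructor
            · rintro ⟨a, b⟩
              refine ⟨?_, b⟩
              by_contra hc
              exact hd' (by rw [show t = s.val by omega]; exact b)
            · rintro ⟨a, b⟩
              exact ⟨by omega, b⟩
          rw [this]
          have := hs t
          omega
  refine ⟨⟨Finset.univ.filter (fun s => h s.val - h (s.val + 1) = 1), ?_⟩, fun t => ?_⟩
  · have := key 0
    simp only [Nat.zero_le, true_and, h0] at this
    exact_mod_cast this
  · rw [← key t, ht, Finset.filter_filter]
    simp only [and_comm]

lemma relWeight_eq_ht (x y : IState n k) (i : Fin n) :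
    relWeight x y i = ht y (i + 1) - ht x (i + 1) := by
  simp only [relWeight, ht, Fin.le_def, Fin.val_succ]

/-- `y` arises from `x` by a step across line `i`: the height at this line changes by `σ`, which is
`1` for a step `R_i` and `-1` for a step `L_i`. -/
def IsStep (i : Fin n) (σ : ℤ) (x y : IState n k) : Prop :=
  ∀ t, ht y t = ht x t + if t = i.val + 1 then σ else 0

lemma isRStep_iff (i : Fin n) (x y : IState n k) : IsRStep i x y ↔ IsStep i 1 x y := by
  have hi := i.2
  constructor
  · rintro ⟨h1, h2, h3⟩ t
    have hne : i.castSucc ≠ i.succ := by simp [Fin.ext_iff]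
    by_cases ht' : t = i.val + 1
    · subst ht'
      rw [if_pos rfl]
      simp only [ht, h3]
      rw [Finset.filter_insert, if_pos (by simp), Finset.card_insert_of_notMem (by simp [h2]),
        Finset.filter_erase, Finset.erase_eq_of_notMem (by simp)]
      push_cast; ring
    · rw [if_neg ht', add_zero]
      simp only [ht, h3]
      by_cases hlt : t ≤ i.val
      · rw [Finset.filter_insert, if_pos (by simp; omega),
          Finset.card_insert_of_notMem (by simp [h2]), Finset.filter_erase,
          Finset.card_erase_of_mem (by simp [h1, hlt])]
        have : 0 < (x.1.filter fun s => t ≤ s.val).card :=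
          Finset.card_pos.2 ⟨i.castSucc, by simp [h1, hlt]⟩
        omega
      · rw [Finset.filter_insert, if_neg (by simp; omega), Finset.filter_erase,
          Finset.erase_eq_of_notMem (by simp; omega)]
  · intro h
    have e1 := h i.val
    have e2 := h (i.val + 1)
    have e3 := h (i.val + 1 + 1)
    simp only [if_true] at e2
    rw [if_neg (by omega)] at e1 e3
    have s1 := ht_step x i.val
    have s2 := ht_step y (i.val + 1)
    have s3 := ht_step y i.val
    have s4 := ht_step x (i.val + 1)
    refine ⟨?_, ?_, ?_⟩
    · rw [mem_iff_ht]; simp only [Fin.val_castSucc]; omega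
    · rw [notMem_iff_ht]; simp only [Fin.val_succ]; omega
    · ext s
      simp only [Finset.mem_insert, Finset.mem_erase, mem_iff_ht, Fin.ext_iff, Fin.val_succ,
        Fin.val_castSucc, ne_eq]
      have e4 := h s.val
      have e5 := h (s.val + 1)
      by_cases c1 : s.val = i.val
      · rw [c1] at *; simp; omega
      by_cases c2 : s.val = i.val + 1
      · rw [c2] at *; simp; omega
      rw [if_neg c2] at e4
      rw [if_neg (by omega)] at e5
      simp only [c1, c2, false_or, not_false_iff, true_and]
      omega

lemma isLStep_iff_isRStep (i : Fin n) (x y : IState n k) : IsLStep i x y ↔ IsRStep i y x := by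
  have hne : i.castSucc ≠ i.succ := by simp [Fin.ext_iff]
  constructor
  · rintro ⟨h1, h2, h3⟩
    refine ⟨by simp [h3], by simp [h3, hne.symm], ?_⟩
    rw [h3, Finset.erase_insert (by simp [h2]), Finset.insert_erase h1]
  · rintro ⟨h1, h2, h3⟩
    refine ⟨by simp [h3], by simp [h3, hne], ?_⟩
    rw [h3, Finset.erase_insert (by simp [h2]), Finset.insert_erase h1]

lemma IsStep.symm {i : Fin n} {σ : ℤ} {x y : IState n k} (h : IsStep i σ x y) :
    IsStep i (-σ) y x := fun t => by
  rw [h t]; split_ifs <;> ring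

lemma isLStep_iff (i : Fin n) (x y : IState n k) : IsLStep i x y ↔ IsStep i (-1) x y := by
  rw [isLStep_iff_isRStep, isRStep_iff]
  exact ⟨fun h => h.symm, fun h => by simpa using h.symm⟩

lemma IsStep.target_unique {i : Fin n} {σ : ℤ} {x y z : IState n k} (h : IsStep i σ x y)
    (h' : IsStep i σ x z) : y = z := ext_ht fun t => by rw [h, h']

lemma IsStep.source_unique {i : Fin n} {σ : ℤ} {x y z : IState n k} (h : IsStep i σ x z)
    (h' : IsStep i σ y z) : x = y := ext_ht fun t => by have := h t; have := h' t; omega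

lemma IsStep.relWeight_eq {i : Fin n} {σ : ℤ} {x y : IState n k} (h : IsStep i σ x y) (j : Fin n) :
    relWeight x y j = if j = i then σ else 0 := by
  rw [relWeight_eq_ht, h]
  simp [Fin.ext_iff]

lemma relWeight_self (x : IState n k) (i : Fin n) : relWeight x x i = 0 := by
  simp [relWeight]

lemma relWeight_add (x y z : IState n k) (i : Fin n) :
    relWeight x y i + relWeight y z i = relWeight x z i := by
  simp [relWeight]

lemma relWeight_neg (x y : IState n k) (i : Fin n) : -relWeight x y i = relWeight y x i := by
  simp [relWeight]

/-- If two different steps on the lines `i` and `j` both lead to `y`, both moving away from `x`,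
then the lines are not adjacent. -/
lemma IsStep.distant {x y y₁ y₂ : IState n k} {i j : Fin n} {σ τ : ℤ}
    (hσ : σ = 1 ∨ σ = -1) (hτ : τ = 1 ∨ τ = -1) (h₁ : IsStep i σ y₁ y) (h₂ : IsStep j τ y₂ y)
    (hi : 0 < σ * relWeight x y i) (hj : 0 < τ * relWeight x y j) (hij : i ≠ j) :
    1 < |(i : ℤ) - j| := by
  wlog hlt : i < j generalizing i j σ τ y₁ y₂
  · rw [abs_sub_comm]
    exact this hτ hσ h₂ h₁ hj hi hij.symm (lt_of_le_of_ne (not_lt.1 hlt) hij.symm)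
  rw [Fin.lt_def] at hlt
  by_contra hc
  have hji : j.val = i.val + 1 := by
    rw [abs_sub_comm, abs_of_nonneg (by omega)] at hc; omega
  rw [relWeight_eq_ht] at hi hj
  rw [hji] at hj
  have a1 := h₁ (i.val + 1)
  have a2 := h₁ (i.val + 1 + 1)
  have b1 := h₂ (i.val + 1)
  have b2 := h₂ (i.val + 1 + 1)
  rw [hji] at b1 b2
  simp only [if_true] at a1 b2
  rw [if_neg (by omega)] at a2 b1
  have c1 := ht_step x (i.val + 1)
  have c2 := ht_step y (i.val + 1)
  have c3 := ht_step y₁ (i.val + 1)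
  have c4 := ht_step y₂ (i.val + 1)
  rcases hσ with rfl | rfl <;> rcases hτ with rfl | rfl <;> omega

/-- Steps on distant lines can be performed in either order. -/
lemma IsStep.exists_square {y y₁ y₂ : IState n k} {i j : Fin n} {σ τ : ℤ}
    (h₁ : IsStep i σ y₁ y) (h₂ : IsStep j τ y₂ y) (hij : 1 < |(i : ℤ) - j|) :
    ∃ z : IState n k, IsStep j τ z y₁ ∧ IsStep i σ z y₂ := by
  have hij' : i.val + 1 < j.val ∨ j.val + 1 < i.val := by
    rcases lt_abs.1 hij with h | h <;> omega
  have hi := i.2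
  have hj := j.2
  obtain ⟨z, hz⟩ := exists_ht (n := n) (k := k)
    (fun t => ht y₁ t - if t = j.val + 1 then τ else 0)
    (by simp [ht_zero]) (fun t ht' => by rw [ht_of_gt y₁ ht', if_neg (by omega)]; rfl)
    (fun t => by
      have a1 := h₁ t
      have a2 := h₁ (t + 1)
      have b1 := h₂ t
      have b2 := h₂ (t + 1)
      have c3 := ht_step y₁ t
      have c4 := ht_step y₂ t
      have c5 := ht_step y t
      split_ifs at a1 a2 b1 b2 ⊢ <;> omega)
  refine ⟨z, fun t => by rw [hz]; ring, fun t => ?_⟩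
  have a1 := h₁ t
  have b1 := h₂ t
  rw [hz]
  omega

/-- A state different from `x` can be reached by a last step that moves away from `x`. -/
lemma exists_step_away {x y : IState n k} (hxy : x ≠ y) :
    ∃ (i : Fin n) (σ : ℤ) (y₁ : IState n k), (σ = 1 ∨ σ = -1) ∧ IsStep i σ y₁ y ∧
      0 < σ * relWeight x y i := by
  have hne : ∃ t, ht x t ≠ ht y t := by
    by_contra! hc
    exact hxy (ext_ht hc)
  -- It suffices to find a place where the lattice path `y` has a corner on the far side of `x`.
  have main : ∀ (t : ℕ) (σ : ℤ), (σ = 1 ∨ σ = -1) → 0 < σ * (ht y t - ht x t) →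
      (∀ s, s + 1 = t → ht y s - ht y t = if σ = 1 then 0 else 1) →
      (ht y t - ht y (t + 1) = if σ = 1 then 1 else 0) →
      ∃ (i : Fin n) (σ : ℤ) (y₁ : IState n k), (σ = 1 ∨ σ = -1) ∧ IsStep i σ y₁ y ∧
      0 < σ * relWeight x y i := by
    intro t σ hσ hpos hl hr
    have ht0 : t ≠ 0 := by
      rintro rfl; simp [ht_zero] at hpos
    have htn : t ≤ n := by
      by_contra hc
      rw [ht_of_gt x (by omega), ht_of_gt y (by omega)] at hpos
      simp at hpos
    obtain ⟨s, rfl⟩ := Nat.exists_eq_succ_of_ne_zero ht0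
    obtain ⟨z, hz⟩ := exists_ht (n := n) (k := k)
      (fun t => ht y t - if t = s + 1 then σ else 0)
      (by simp [ht_zero]) (fun t ht' => by rw [ht_of_gt y ht', if_neg (by omega)]; rfl)
      (fun t => by
        have hl := hl s rfl
        have c := ht_step y t
        by_cases c1 : t = s
        · subst c1
          rw [if_pos rfl, if_neg (by omega)]
          rcases hσ with rfl | rfl <;> simp at hl <;> omega
        · by_cases c2 : t = s + 1
          · subst c2
            rw [if_neg (by omega), if_pos rfl]
            rcases hσ with rfl | rfl <;> simp at hr <;> omega
          · rw [if_neg (by omega), if_neg (by omega)]; omega)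
    refine ⟨⟨s, by omega⟩, σ, z, hσ, fun t => by rw [hz]; simp, ?_⟩
    rw [relWeight_eq_ht]; exact hpos
  classical
  obtain ⟨t, ht'⟩ := hne
  rcases lt_or_gt_of_ne ht' with hlt | hgt
  · have hex : ∃ t, ht x t < ht y t ∧ ht y t - ht y (t + 1) = 1 := by
      by_contra! hc
      have : ∀ d, ht x (t + d) < ht y (t + d) := by
        intro d
        induction d with
        | zero => exact hlt
        | succ d ih =>
          have := hc _ ih
          have := ht_step x (t + d)
          have := ht_step y (t + d)
          rw [← add_assoc]
          omega
      have := this (n + 1)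
      rw [ht_of_gt x (by omega), ht_of_gt y (by omega)] at this
      omega
    obtain ⟨h1, h2⟩ := Nat.find_spec hex
    refine main (Nat.find hex) 1 (Or.inl rfl) (by omega) ?_ (by simpa using h2)
    intro s hs
    have h3 := Nat.find_min hex (show s < Nat.find hex by omega)
    rw [← hs] at h1 h2 ⊢
    have := ht_step x s
    have := ht_step y s
    simp only [if_true]
    by_contra hc
    exact h3 ⟨by omega, by omega⟩
  · have hex : ∃ t, ht y t < ht x t ∧ ∀ s, s + 1 = t → ht y s - ht y t = 1 := by
      have hex' : ∃ t, ht y t < ht x t := ⟨t, hgt⟩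
      refine ⟨Nat.find hex', Nat.find_spec hex', fun s hs => ?_⟩
      have h3 := Nat.find_min hex' (show s < Nat.find hex' by omega)
      have h1 := Nat.find_spec hex'
      rw [← hs] at h1 ⊢
      have := ht_step x s
      have := ht_step y s
      omega
    obtain ⟨t, h1, h2⟩ := hex
    by_contra hc
    have : ∀ d, ht y (t + d) < ht x (t + d) ∧
        ∀ s, s + 1 = t + d → ht y s - ht y (t + d) = 1 := by
      intro d
      induction d with
      | zero => exact ⟨h1, h2⟩
      | succ d ih =>
        have h4 : ht y (t + d) - ht y (t + d + 1) = 1 := by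
          by_contra h5
          have := ht_step y (t + d)
          refine hc (main (t + d) (-1) (Or.inr rfl) (by omega) (by simpa using ih.2) ?_)
          simp; omega
        have := ht_step x (t + d)
        rw [← add_assoc]
        refine ⟨by omega, fun s hs => ?_⟩
        rw [show s = t + d by omega]; exact h4
    have := (this (n + 1)).1
    rw [ht_of_gt x (by omega), ht_of_gt y (by omega)] at this
    omega

/-- A set of states is convex if it contains every state whose height function lies between those
of two of its members. -/
def IsConvex (W : Finset (IState n k)) : Prop :=
  ∀ ⦃x y z : IState n k⦄, x ∈ W → y ∈ W →
    (∀ t, min (ht x t) (ht y t) ≤ ht z t ∧ ht z t ≤ max (ht x t) (ht y t)) → z ∈ W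

lemma mem_Vr_iff (x : IState n k) : x ∈ Vr n k ↔ ht x 1 = k := by
  have := notMem_iff_ht x 0
  rw [Fin.val_zero, ht_zero] at this
  simp only [Vr, Finset.mem_filter, Finset.mem_univ, true_and, this, zero_add]
  exact eq_comm

lemma mem_Vl_iff (x : IState n k) : x ∈ Vl n k ↔ ht x n = 0 := by
  have := notMem_iff_ht x (Fin.last n)
  rw [Fin.val_last, ht_of_gt x (Nat.lt_succ_self n)] at this
  simp only [Vl, Finset.mem_filter, Finset.mem_univ, true_and, this]

lemma mem_Vrl_iff (x : IState n k) : x ∈ Vrl n k ↔ ht x 1 = k ∧ ht x n = 0 := by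
  rw [← mem_Vr_iff, ← mem_Vl_iff]
  simp [Vr, Vl, Vrl]

lemma isConvex_Vr : IsConvex (Vr n k) := by
  intro x y z hx hy h
  rw [mem_Vr_iff] at *
  have := h 1
  rw [hx, hy] at this
  simp only [min_self, max_self] at this
  omega

lemma isConvex_Vl : IsConvex (Vl n k) := by
  intro x y z hx hy h
  rw [mem_Vl_iff] at *
  have := h n
  rw [hx, hy] at this
  simp only [min_self, max_self] at this
  omega

lemma isConvex_Vrl : IsConvex (Vrl n k) := by
  intro x y z hx hy h
  rw [mem_Vrl_iff] at *
  have h1 := h 1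
  have h2 := h n
  rw [hx.1, hy.1] at h1
  rw [hx.2, hy.2] at h2
  simp only [min_self, max_self] at h1 h2
  omega

/-- The source of a step towards `y` that moves away from `x` lies between `x` and `y`. -/
lemma IsConvex.mem_of_step {W : Finset (IState n k)} (hW : IsConvex W) {x y y₁ : IState n k}
    (hx : x ∈ W) (hy : y ∈ W) {i : Fin n} {σ : ℤ} (hσ : σ = 1 ∨ σ = -1) (h : IsStep i σ y₁ y)
    (hi : 0 < σ * relWeight x y i) : y₁ ∈ W := by
  refine hW hx hy fun t => ?_
  have := h t
  rw [relWeight_eq_ht] at hi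
  by_cases ht' : t = i.val + 1
  · subst ht'
    simp only [if_true] at this
    rcases hσ with rfl | rfl <;> constructor <;> omega
  · rw [if_neg ht'] at this
    omega

end Heights

/-! ### Monomial relations and convex sets of I-states -/

section Vanishing

variable {n k : ℕ}

/-- The monomial relations: the edge from `a` to `b` is zero as soon as the lines are crossed as
often as prescribed by the last argument (where a factor `U_i` counts as two crossings). -/
inductive ZeroRel : IState n k → IState n k → (Fin n → ℤ) → Prop
  | U (i : Fin n) (a : IState n k) (h₁ : i.castSucc ∉ a.1) (h₂ : i.succ ∉ a.1) :
      ZeroRel a a (fun l => if l = i then 2 else 0)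
  | R (i j : Fin n) (a c b : IState n k) (hij : j.val = i.val + 1) (h₁ : IsStep i 1 a c)
      (h₂ : IsStep j 1 c b) : ZeroRel a b (fun l => if l = i ∨ l = j then 1 else 0)
  | L (i j : Fin n) (a c b : IState n k) (hij : j.val = i.val + 1) (h₁ : IsStep j (-1) a c)
      (h₂ : IsStep i (-1) c b) : ZeroRel a b (fun l => if l = i ∨ l = j then 1 else 0)

lemma ZeroRel.symm {a b : IState n k} {m : Fin n → ℤ} (h : ZeroRel a b m) : ZeroRel b a m := by
  cases h with
  | U i _ h₁ h₂ => exact .U i a h₁ h₂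
  | R i j _ c _ hij h₁ h₂ => exact .L i j b c a hij h₂.symm h₁.symm
  | L i j _ c _ hij h₁ h₂ =>
    exact .R i j b c a hij (by simpa using h₂.symm) (by simpa using h₁.symm)

/-- Crossing the lines `m` times on the way from `x` to `y` factors through a monomial relation
between two states that satisfy `P`. -/
def Bad (P : IState n k → Prop) (x y : IState n k) (m : Fin n → ℤ) : Prop :=
  ∃ (a b : IState n k) (m₀ : Fin n → ℤ), P a ∧ P b ∧ ZeroRel a b m₀ ∧
    ∀ i, |relWeight x a i| + m₀ i + |relWeight b y i| ≤ m i

lemma Bad.symm {P : IState n k → Prop} {x y : IState n k} {m : Fin n → ℤ} (h : Bad P x y m) :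
    Bad P y x m := by
  obtain ⟨a, b, m₀, ha, hb, hab, hm⟩ := h
  refine ⟨b, a, m₀, hb, ha, hab.symm, fun i => ?_⟩
  have := hm i
  rw [← relWeight_neg, abs_neg, ← relWeight_neg x a, abs_neg]
  omega

lemma Bad.mono {P Q : IState n k → Prop} {x y : IState n k} {m : Fin n → ℤ} (h : Bad P x y m)
    (hPQ : ∀ z, P z → Q z) : Bad Q x y m := by
  obtain ⟨a, b, m₀, ha, hb, hab, hm⟩ := h
  exact ⟨a, b, m₀, hPQ a ha, hPQ b hb, hab, hm⟩

lemma Bad.le {P : IState n k → Prop} {x y : IState n k} {m m' : Fin n → ℤ} (h : Bad P x y m)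
    (hm' : ∀ i, m i ≤ m' i) : Bad P x y m' := by
  obtain ⟨a, b, m₀, ha, hb, hab, hm⟩ := h
  exact ⟨a, b, m₀, ha, hb, hab, fun i => (hm i).trans (hm' i)⟩

/-- Composing with an edge from `w` to `x` preserves badness. -/
lemma Bad.comp_left {P : IState n k → Prop} {x y : IState n k} {m : Fin n → ℤ} (h : Bad P x y m)
    (w : IState n k) : Bad P w y (fun i => |relWeight w x i| + m i) := by
  obtain ⟨a, b, m₀, ha, hb, hab, hm⟩ := h
  refine ⟨a, b, m₀, ha, hb, hab, fun i => ?_⟩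
  have h1 := hm i
  have h2 := abs_add_le (relWeight w x i) (relWeight x a i)
  rw [relWeight_add] at h2
  show _ ≤ |relWeight w x i| + m i
  omega

lemma Bad.comp_right {P : IState n k → Prop} {x y : IState n k} {m : Fin n → ℤ}
    (h : Bad P x y m) (z : IState n k) : Bad P x z (fun i => m i + |relWeight y z i|) := by
  refine ((h.symm.comp_left z).symm).le fun i => ?_
  rw [← relWeight_neg, abs_neg, add_comm]

lemma abs_add_add_abs_le_iff {p c q m : ℤ} : |p| + c + |q| ≤ m ↔
    (p + c + q ≤ m ∧ -p + c + q ≤ m) ∧ p + c - q ≤ m ∧ -p + c - q ≤ m := by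
  rcases abs_cases p with h | h <;> rcases abs_cases q with h' | h' <;> omega

/-- The comparison of crossing numbers at line `l + 1` when `a` and `b` are replaced by `[2,p+1]`, in
case that they fail to lie above `[1,p]` at this line. The numbers `x`, `y`, `a`, `b`, `z` are the
heights of the states, and `u` is the number of crossings prescribed by the relation. The saved
crossings pay for the factor `U_1` at the new state. -/
lemma crossings_le {x y a b u m p l z : ℤ} (h : |a - x| + u + |y - b| ≤ m)
    (hs : u - a - b = 2 - 2 * (p - l)) (hx : p - l ≤ x) (hx' : x ≤ p)
    (hy : p - l ≤ y) (hy' : y ≤ p) (hz : z = if l = 0 then p else p + 1 - l) :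
    |z - x| + (if l = 0 then 2 else 0) + |y - z| ≤ m := by
  rw [abs_add_add_abs_le_iff] at h ⊢
  split_ifs at hz ⊢ <;> omega

/-- Raising `a` and `b` to at least `q ≤ x, y` does not increase the crossing number. -/
lemma crossings_join_le {x y a b u m q : ℤ} (h : |a - x| + u + |y - b| ≤ m) (hx : q ≤ x)
    (hy : q ≤ y) : |max a q - x| + u + |y - max b q| ≤ m := by
  rw [abs_add_add_abs_le_iff] at h ⊢
  rcases max_cases a q with h' | h' <;> rcases max_cases b q with h'' | h'' <;> omega

/-- The join of the state `a` with a state of the form `[p - k, p - 1]`, in the lattice of height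
functions. -/
lemma exists_join (a : IState n k) (p : ℤ) (hp : k ≤ p) (hpn : p ≤ n + 1) :
    ∃ z : IState n k, ∀ t, ht z t = max (ht a t) (min k (p - t)) := by
  refine exists_ht _ ?_ ?_ ?_
  · rw [ht_zero]; omega
  · intro t h
    rw [ht_of_gt a h]; omega
  · intro t
    have := ht_step a t
    push_cast
    omega

/-- The join of the state `a` with `[1,k]`. -/
lemma exists_join_one (a : IState n k) (hk : (k : ℤ) ≤ n) :
    ∃ z : IState n k, ∀ t : ℕ, ht z (t + 1) = max (ht a (t + 1)) (k - t) := by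
  obtain ⟨z, hz⟩ := exists_join a (k + 1) (by omega) (by omega)
  refine ⟨z, fun t => ?_⟩
  rw [hz, min_eq_right (by push_cast; omega)]
  push_cast
  congr 1
  ring

/-- The join of the state `a` with `[2,k+1]`. -/
lemma exists_join_two (a : IState n k) (hk : (k : ℤ) + 1 ≤ n) :
    ∃ z : IState n k,
      ∀ t : ℕ, ht z (t + 1) = max (ht a (t + 1)) (if (t : ℤ) = 0 then (k : ℤ) else k + 1 - t) := by
  obtain ⟨z, hz⟩ := exists_join a (k + 2) (by omega) (by omega)
  refine ⟨z, fun t => ?_⟩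
  rw [hz]
  congr 1
  push_cast
  split_ifs <;> omega

lemma le_ht_succ (x : IState n k) (hx : ht x 1 = k) (d : ℕ) : (k : ℤ) - d ≤ ht x (d + 1) := by
  induction d with
  | zero => simp [hx]
  | succ d ih => have := ht_step x (d + 1); push_cast; omega

lemma ht_le_add (x : IState n k) (s d : ℕ) : ht x s ≤ ht x (s + d) + d := by
  induction d with
  | zero => simp
  | succ d ih => have := ht_step x (s + d); rw [← add_assoc]; push_cast; omega

lemma card_le_of_ht (x : IState n k) (hx : ht x 1 = k) (hn : ht x n = 0) :
    (k : ℤ) ≤ n - 1 ∨ k = 0 := by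
  by_cases h : n = 0
  · have := ht_le_sub x (t := 1) (by omega)
    push_cast at this
    omega
  · have := le_ht_succ x hx (n - 1)
    rw [Nat.sub_add_cancel (by omega)] at this
    omega

/-- The case of a relation `U_i` of `Bad.clip`. -/
lemma Bad.clip_U (β : Prop) {x y b : IState n k} {m : Fin n → ℤ}
    (hx : ht x 1 = k ∧ (β → ht x n = 0)) (hy : ht y 1 = k ∧ (β → ht y n = 0))
    (ha : β → ht b n = 0) {i : Fin n} (h1 : i.castSucc ∉ b.1) (h2 : i.succ ∉ b.1)
    (hm : ∀ l, |relWeight x b l| + (if l = i then 2 else 0) + |relWeight b y l| ≤ m l) :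
    Bad (fun z => ht z 1 = k ∧ (β → ht z n = 0)) x y m ∨ (β ∧ k + 1 = n ∧ ∀ i, 2 ≤ m i) := by
  have hkn : (k : ℤ) ≤ n := by
    have := ht_le_sub x (t := 1) (by omega)
    push_cast at this
    omega
  have hkβ : β → (k : ℤ) ≤ n - 1 ∨ k = 0 := fun hb => card_le_of_ht x hx.1 (hx.2 hb)
  have hxl := le_ht_succ x hx.1
  have hyl := le_ht_succ y hy.1
  obtain ⟨a', ha'⟩ := exists_join_one b hkn
  have hi := i.2
  rw [notMem_iff_ht] at h1 h2
  simp only [Fin.val_castSucc, Fin.val_succ] at h1 h2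
  by_cases hc : (k : ℤ) + 1 - i ≤ ht b i ∨ i.val = 0
  · -- The join with `[1,k]` leaves `b` unchanged near line `i`.
    left
    have h1' : ht a' 1 = k := by
      rw [ha' 0, Nat.cast_zero, sub_zero]; exact max_eq_right (ht_le b _)
    have hn' : β → ht a' n = 0 := by
      intro hβ
      rcases Nat.eq_zero_or_pos n with h0 | h0
      · exact absurd hi (by omega)
      · have h3 := ha' (n - 1)
        rw [Nat.sub_add_cancel h0, ha hβ] at h3
        rw [h3]
        exact max_eq_left (by have := hkβ hβ; omega)
    have hf : ht a' i = ht a' (i + 1) ∧ ht a' (i + 1) = ht a' (i + 1 + 1) := by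
      have h3 : (k : ℤ) - (i + 1 : ℕ) ≤ ht b (i + 1 + 1) ∧ (k : ℤ) - i ≤ ht b (i + 1) := by
        have : i.val = 0 → ht b i = k := fun h => by rw [h, ht_zero]
        push_cast
        omega
      rw [ha', ha', max_eq_left h3.1, max_eq_left h3.2]
      refine ⟨?_, h2⟩
      rcases Nat.eq_zero_or_pos i.val with h0 | h0
      · rw [← h1, h0, ht_zero, ht_zero]
      · have h4 := ha' (i - 1)
        rw [Nat.sub_add_cancel h0] at h4
        rw [h4, ← h1]
        exact max_eq_left (by omega)
    refine ⟨a', a', _, ⟨?_, fun hβ => ?_⟩, ⟨?_, fun hβ => ?_⟩, .U i a' ?_ ?_, fun l => ?_⟩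
    · exact h1'
    · exact hn' hβ
    · exact h1'
    · exact hn' hβ
    · rw [notMem_iff_ht, Fin.val_castSucc]; exact hf.1
    · rw [notMem_iff_ht, Fin.val_succ]; exact hf.2
    · have e1 := hm l
      rw [relWeight_eq_ht, relWeight_eq_ht] at e1 ⊢
      rw [ha']
      exact crossings_join_le e1 (hxl l) (hyl l)
  · -- The state `b` contains all regions to the left of the line, and the join with `[2,k+1]`
    -- takes the place of the join with `[1,k]`.
    push Not at hc
    have hb' : ∀ t : ℕ, t ≤ i → ht b t = k - t := by
      intro t ht'
      obtain ⟨d, hd⟩ := Nat.exists_eq_add_of_le ht'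
      have := ht_le_add b t d
      rw [← hd] at this
      have := ht_ge b t
      omega
    have hbi := hb' i le_rfl
    have hbn := ht_le_sub b (t := i + 1 + 1) (by omega)
    push_cast at hbn
    have hkn' : (k : ℤ) + 1 ≤ n := by omega
    by_cases hβ : β ∧ k + 1 = n
    · right
      refine ⟨hβ.1, hβ.2, fun l => ?_⟩
      have hn := ha hβ.1
      have hin : i.val + 1 = n := by
        by_contra hc'
        have := ht_le_add b (i + 1 + 1) (n - (i + 1 + 1))
        rw [Nat.add_sub_cancel' (by omega)] at this
        omega
      have e1 := hm l
      have e2 := hxl l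
      have e3 := hyl l
      have hl := l.2
      rw [relWeight_eq_ht, relWeight_eq_ht] at e1
      simp only [abs_add_add_abs_le_iff] at *
      by_cases hli : l = i
      · rw [if_pos hli] at e1; omega
      · rw [if_neg hli] at e1
        have hli' : l.val ≠ i.val := fun h => hli (Fin.ext h)
        have := hb' (l + 1) (by omega)
        push_cast at *
        omega
    · left
      obtain ⟨z, hz⟩ := exists_join_two b hkn'
      have hz1 : ht z 1 = k := by
        have h3 := hz 0
        rw [if_pos (by simp), max_eq_right (ht_le b _)] at h3
        exact h3
      have hz2 : ht z 2 = k := by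
        have h3 := hz 1
        rw [if_neg (by simp)] at h3
        refine h3.trans ((max_eq_right ?_).trans ?_)
        · simpa using ht_le b 2
        · simp
      have hzβ : β → ht z n = 0 := by
        intro hb
        have h3 := hz (n - 1)
        have h4 : k + 1 ≠ n := fun h => hβ ⟨hb, h⟩
        rw [Nat.sub_add_cancel (by omega), ha hb] at h3
        rw [h3]
        refine max_eq_left ?_
        split_ifs <;> omega
      refine ⟨z, z, _, ⟨hz1, hzβ⟩, ⟨hz1, hzβ⟩, .U ⟨0, by omega⟩ z ?_ ?_, fun l => ?_⟩
      · rw [notMem_iff_ht]; simp [ht_zero, hz1]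
      · rw [notMem_iff_ht]; simp [hz1, hz2]
      · have e1 := hm l
        rw [relWeight_eq_ht, relWeight_eq_ht] at e1 ⊢
        have hl0 : (if l = (⟨0, by omega⟩ : Fin n) then (2 : ℤ) else 0) =
            if (l.val : ℤ) = 0 then 2 else 0 := by simp [Fin.ext_iff]
        have hli : (if l = i then (2 : ℤ) else 0) = if l.val = i.val then 2 else 0 := by
          simp [Fin.ext_iff]
        rw [hl0]
        rw [hli] at e1
        by_cases h : l.val ≤ i.val
        · have h3 : ht b (l + 1) =
              k - l - 1 + if l.val = i.val then 1 else 0 := by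
            split_ifs with h'
            · rw [h', ← h1, hbi]; ring
            · rw [hb' (l + 1) (by omega)]; push_cast; ring
          refine crossings_le e1 ?_ (hxl l) (ht_le x _) (hyl l) (ht_le y _) ?_
          · rw [h3]; split_ifs <;> ring
          · rw [hz]
            refine max_eq_right ?_
            split_ifs
            · exact ht_le b _
            · rw [h3]; split_ifs <;> linarith
        · have h3 := ht_le_add b (i + 1 + 1) (l - (i + 1))
          rw [show i.val + 1 + 1 + (l - (i + 1)) = l + 1 by omega] at h3
          have e11 : ht z (l + 1) = ht b (l + 1) := by
            rw [hz, if_neg (by omega)]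
            exact max_eq_left (by omega)
          rw [if_neg (by omega)] at e1 ⊢
          rw [e11]; exact e1

/-- The heights around a pair of steps `R_i R_{i+1}`. -/
lemma ht_of_two_steps {a b c : IState n k} {i j : Fin n} (hij : j.val = i.val + 1)
    (h1 : IsStep i 1 a c) (h2 : IsStep j 1 c b) :
    (∀ t, ht b t = ht a t + if t = i.val + 1 ∨ t = i.val + 1 + 1 then 1 else 0) ∧
      ht a i = ht a (i + 1) + 1 ∧ ht a (i + 1) = ht a (i + 1 + 1) ∧
      ht a (i + 1 + 1) = ht a (i + 1 + 1 + 1) := by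
  have hab : ∀ t, ht b t = ht a t + if t = i.val + 1 ∨ t = i.val + 1 + 1 then 1 else 0 := by
    intro t
    rw [h2 t, h1 t, hij]
    split_ifs <;> omega
  have a0 : ht a i = ht a (i + 1) + 1 := by
    have q1 := h1 i; have q2 := h1 (i + 1); have q3 := ht_step c i; have q4 := ht_step a i
    split_ifs at q1 q2 <;> omega
  have a1 : ht a (i + 1) = ht a (i + 1 + 1) := by
    have q1 := h1 (i + 1); have q2 := h1 (i + 1 + 1); have q3 := ht_step c (i + 1)
    have q4 := ht_step a (i + 1)
    split_ifs at q1 q2 <;> omega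
  have a2 : ht a (i + 1 + 1) = ht a (i + 1 + 1 + 1) := by
    have q1 := hab (i + 1 + 1); have q2 := hab (i + 1 + 1 + 1); have q3 := ht_step b (i + 1 + 1)
    have q4 := ht_step a (i + 1 + 1)
    split_ifs at q1 q2 <;> omega
  exact ⟨hab, a0, a1, a2⟩

/-- The case of a relation `R_i R_{i+1}` of `Bad.clip` that is compatible with the retraction. -/
lemma Bad.clip_R_join (β : Prop) {x y a b c : IState n k} {m : Fin n → ℤ}
    (hx : ht x 1 = k ∧ (β → ht x n = 0)) (hy : ht y 1 = k ∧ (β → ht y n = 0))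
    (ha : β → ht a n = 0) (hb : β → ht b n = 0) {i j : Fin n} (hij : j.val = i.val + 1)
    (h1 : IsStep i 1 a c) (h2 : IsStep j 1 c b)
    (hc : (k : ℤ) - i ≤ ht a (i + 1))
    (hm : ∀ l, |relWeight x a l| + (if l = i ∨ l = j then 1 else 0) + |relWeight b y l| ≤ m l) :
    Bad (fun z => ht z 1 = k ∧ (β → ht z n = 0)) x y m := by
  have hkn : (k : ℤ) ≤ n := by
    have := ht_le_sub x (t := 1) (by omega)
    push_cast at this
    omega
  have hkβ : β → (k : ℤ) ≤ n - 1 ∨ k = 0 := fun hb => card_le_of_ht x hx.1 (hx.2 hb)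
  have hxl := le_ht_succ x hx.1
  have hyl := le_ht_succ y hy.1
  have hi := i.2
  have hj := j.2
  obtain ⟨hab, a0, a1, a2⟩ := ht_of_two_steps hij h1 h2
  have hm' : ∀ l : Fin n, |ht a (l + 1) - ht x (l + 1)| +
      (if l.val = i.val ∨ l.val = i.val + 1 then 1 else 0) +
      |ht y (l + 1) - ht b (l + 1)| ≤ m l := by
    intro l
    have := hm l
    rw [relWeight_eq_ht, relWeight_eq_ht] at this
    simpa only [Fin.ext_iff, hij] using this
  obtain ⟨b', hb'⟩ := exists_join_one b hkn
  obtain ⟨c', hc'⟩ := exists_join_one c hkn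
  obtain ⟨a', ha'⟩ := exists_join_one a hkn
  have hside : ∀ u : IState n k, (β → ht u n = 0) → ∀ u' : IState n k,
      (∀ t : ℕ, ht u' (t + 1) = max (ht u (t + 1)) (k - t)) →
      ht u' 1 = k ∧ (β → ht u' n = 0) := by
    intro u hu u' hu'
    refine ⟨?_, fun hβ => ?_⟩
    · rw [hu' 0, Nat.cast_zero, sub_zero]; exact max_eq_right (ht_le u _)
    · have h3 := hu' (n - 1)
      rw [Nat.sub_add_cancel (by omega), hu hβ] at h3
      rw [h3]
      exact max_eq_left (by have := hkβ hβ; omega)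
  -- Near the two lines the join changes nothing.
  have hnear : ∀ t : ℕ, t = i.val ∨ t = i.val + 1 → (k : ℤ) - t ≤ ht a (t + 1) := by
    rintro t (rfl | rfl) <;> push_cast <;> omega
  refine ⟨a', b', _, hside a ha a' ha', hside b hb b' hb',
    .R i j a' c' b' hij ?_ ?_, fun l => ?_⟩
  · rintro (_ | t)
    · simp [ht_zero]
    rw [ha', hc', h1]
    split_ifs with hti
    · have := hnear t (Or.inl (by omega))
      rw [max_eq_left this, max_eq_left (by omega)]
    · rw [add_zero, add_zero]
  · rintro (_ | t)
    · simp [ht_zero]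
    rw [hc', hb', h2]
    split_ifs with hti
    · have h3 := hnear t (Or.inr (by omega))
      have h4 := h1 (t + 1)
      rw [if_neg (by omega), add_zero] at h4
      rw [h4, max_eq_left h3, max_eq_left (by omega)]
    · rw [add_zero, add_zero]
  · rw [relWeight_eq_ht, relWeight_eq_ht, ha', hb']
    simp only [Fin.ext_iff, hij]
    exact crossings_join_le (hm' l) (hxl l) (hyl l)

/-- The case of a relation `R_i R_{i+1}` of `Bad.clip` that is destroyed by the retraction. -/
lemma Bad.clip_R_corner (β : Prop) {x y a b c : IState n k} {m : Fin n → ℤ}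
    (hx : ht x 1 = k ∧ (β → ht x n = 0)) (hy : ht y 1 = k ∧ (β → ht y n = 0))
    (hb : β → ht b n = 0) {i j : Fin n} (hij : j.val = i.val + 1)
    (h1 : IsStep i 1 a c) (h2 : IsStep j 1 c b)
    (hc : ht a (i + 1) < (k : ℤ) - i)
    (hm : ∀ l, |relWeight x a l| + (if l = i ∨ l = j then 1 else 0) + |relWeight b y l| ≤ m l) :
    Bad (fun z => ht z 1 = k ∧ (β → ht z n = 0)) x y m := by
  have hkn : (k : ℤ) ≤ n := by
    have := ht_le_sub x (t := 1) (by omega)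
    push_cast at this
    omega
  have hkβ : β → (k : ℤ) ≤ n - 1 ∨ k = 0 := fun hb => card_le_of_ht x hx.1 (hx.2 hb)
  have hxl := le_ht_succ x hx.1
  have hyl := le_ht_succ y hy.1
  have hi := i.2
  have hj := j.2
  obtain ⟨hab, a0, a1, a2⟩ := ht_of_two_steps hij h1 h2
  have hm' : ∀ l : Fin n, |ht a (l + 1) - ht x (l + 1)| +
      (if l.val = i.val ∨ l.val = i.val + 1 then 1 else 0) +
      |ht y (l + 1) - ht b (l + 1)| ≤ m l := by
    intro l
    have := hm l
    rw [relWeight_eq_ht, relWeight_eq_ht] at this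
    simpa only [Fin.ext_iff, hij] using this
  have g0 := ht_ge a (i + 1)
  have g1 : ∀ t : ℕ, t ≤ i + 1 → ht a t = k - t := by
    intro t ht'
    have := ht_le_add a t (i + 1 - t)
    rw [Nat.add_sub_cancel' ht'] at this
    have := ht_ge a t
    push_cast at *
    omega
  have g2 : ∀ t : ℕ, i + 1 + 1 ≤ t → (k : ℤ) + 2 - t ≤ ht b t := by
    intro t ht'
    by_cases hti : t = i + 1 + 1
    · subst hti
      rw [hab]
      simp
      push_cast at g0
      omega
    · have := ht_le_add a (i + 1 + 1 + 1) (t - (i + 1 + 1 + 1))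
      rw [Nat.add_sub_cancel' (by omega)] at this
      rw [hab, if_neg (by omega)]
      push_cast at *
      omega
  have hle := ht_le_sub a (t := i + 1 + 1 + 1) (by omega)
  obtain ⟨z, hz⟩ := exists_join_two b (by push_cast at *; omega)
  have hz1 : ht z 1 = k := by
    have h3 := hz 0
    rw [if_pos (by simp), max_eq_right (ht_le b _)] at h3
    exact h3
  have hz2 : ht z 2 = k := by
    have h3 := hz 1
    rw [if_neg (by simp)] at h3
    refine h3.trans ((max_eq_right ?_).trans ?_)
    · simpa using ht_le b 2
    · simp
  have hzβ : β → ht z n = 0 := by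
    intro hβ
    have h3 := hz (n - 1)
    rw [Nat.sub_add_cancel (by omega), if_neg (by omega), hb hβ] at h3
    rw [h3]
    refine max_eq_left ?_
    have h4 := g2 n (by omega)
    rw [hb hβ] at h4
    omega
  refine ⟨z, z, _, ⟨hz1, hzβ⟩, ⟨hz1, hzβ⟩, .U ⟨0, by omega⟩ z ?_ ?_, fun l => ?_⟩
  · rw [notMem_iff_ht]; simp [ht_zero, hz1]
  · rw [notMem_iff_ht]; simp [hz1, hz2]
  · have e1 := hm' l
    have e9 := hab (l + 1)
    rw [relWeight_eq_ht, relWeight_eq_ht]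
    have hl0 : (if l = (⟨0, by omega⟩ : Fin n) then (2 : ℤ) else 0) =
        if (l.val : ℤ) = 0 then 2 else 0 := by simp [Fin.ext_iff]
    rw [hl0]
    by_cases h : l.val ≤ i.val
    · have h6 := g1 (l + 1) (by omega)
      have h7 : (if l.val = i.val ∨ l.val = i.val + 1 then (1 : ℤ) else 0) =
          if l.val + 1 = i.val + 1 ∨ l.val + 1 = i.val + 1 + 1 then 1 else 0 := by
        simp only [Nat.add_right_cancel_iff]
      have h8 : (if l.val + 1 = i.val + 1 ∨ l.val + 1 = i.val + 1 + 1 then (1 : ℤ) else 0) ≤ 1 := by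
        split_ifs <;> simp
      rw [← h7] at e9 h8
      push_cast at h6
      refine crossings_le e1 (by rw [e9, h6]; ring) (hxl l) (ht_le x _) (hyl l) (ht_le y _) ?_
      rw [hz]
      refine max_eq_right ?_
      split_ifs
      · exact ht_le b _
      · rw [e9, h6]; linarith
    · have e15 : ht z (l + 1) = ht b (l + 1) := by
        rw [hz, if_neg (by omega)]
        refine max_eq_left ?_
        have h3 := g2 (l + 1) (by omega)
        push_cast at h3
        linarith
      rw [e15, if_neg (by omega)]
      have h3 : l.val ≠ i.val := fun h' => h h'.le
      rcases em (l.val = i.val + 1) with h4 | h4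
      · rw [if_pos (Or.inr (congrArg Nat.succ h4))] at e9
        rw [if_pos (Or.inr h4)] at e1
        rw [e9] at e1 ⊢
        have h5 := abs_add_le (ht a (l + 1) - ht x (l + 1)) 1
        rw [abs_one, sub_add_eq_add_sub] at h5
        rw [add_zero]
        exact (add_le_add_left h5 _).trans e1
      · rw [if_neg (not_or.2 ⟨fun h' => h3 (Nat.succ.inj h'), fun h' => h4 (Nat.succ.inj h')⟩),
          add_zero] at e9
        rw [if_neg (not_or.2 ⟨h3, h4⟩)] at e1
        rw [e9] at e1 ⊢
        exact e1

/-- Every crossing pattern that factors through a monomial relation between arbitrary states also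
factors through one between states without `0`, when it joins two such states. Here `β` records
whether all states are moreover required not to contain `n`; in this case there is one exception.

The retraction onto the states without `0` is the join with `[1,k]`. It does not increase the
distance to `x` and `y`. When it destroys the relation, the crossings that it saves suffice to go
to a state without `0` and `1`, where `U_1` vanishes. -/
lemma Bad.clip (β : Prop) {x y : IState n k} {m : Fin n → ℤ}
    (hx : ht x 1 = k ∧ (β → ht x n = 0)) (hy : ht y 1 = k ∧ (β → ht y n = 0))
    (h : Bad (fun z => β → ht z n = 0) x y m) :
    Bad (fun z => ht z 1 = k ∧ (β → ht z n = 0)) x y m ∨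
      (β ∧ k + 1 = n ∧ ∀ i, 2 ≤ m i) := by
  have key : ∀ {x y a b c : IState n k} {i j : Fin n}, (ht x 1 = k ∧ (β → ht x n = 0)) →
      (ht y 1 = k ∧ (β → ht y n = 0)) → (β → ht a n = 0) → (β → ht b n = 0) →
      j.val = i.val + 1 → IsStep i 1 a c → IsStep j 1 c b →
      (∀ l, |relWeight x a l| + (if l = i ∨ l = j then 1 else 0) + |relWeight b y l| ≤ m l) →
      Bad (fun z => ht z 1 = k ∧ (β → ht z n = 0)) x y m := by
    intro x y a b c i j hx hy ha hb hij h₁ h₂ hm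
    by_cases hc : (k : ℤ) - i ≤ ht a (i + 1)
    · exact Bad.clip_R_join β hx hy ha hb hij h₁ h₂ hc hm
    · exact Bad.clip_R_corner β hx hy hb hij h₁ h₂ (not_le.1 hc) hm
  obtain ⟨a, b, m₀, ha, hb, hab, hm⟩ := h
  cases hab with
  | U i _ h₁ h₂ => exact Bad.clip_U β hx hy ha h₁ h₂ hm
  | R i j _ c _ hij h₁ h₂ => exact Or.inl (key hx hy ha hb hij h₁ h₂ hm)
  | L i j _ c _ hij h₁ h₂ =>
    refine Or.inl (key hy hx hb ha hij (by simpa using h₂.symm)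
      (by simpa using h₁.symm) fun l => ?_).symm
    have : |relWeight x a l| + (if l = i ∨ l = j then 1 else 0) + |relWeight b y l| ≤ m l := hm l
    rw [← relWeight_neg, abs_neg, ← relWeight_neg x a, abs_neg]
    omega

/-- The reflection `t ↦ n - t` of an I-state. -/
lemma exists_reflect (x : IState n k) :
    ∃ z : IState n k, ∀ t, ht z t = k - ht x (n + 1 - t) := by
  refine exists_ht _ ?_ (fun t h => ?_) (fun t => ?_)
  · rw [ht_of_gt x (by omega), sub_zero]
  · rw [Nat.sub_eq_zero_of_le h, ht_zero, sub_self]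
  · by_cases h : t ≤ n
    · have := ht_step x (n + 1 - (t + 1))
      rw [show n + 1 - (t + 1) + 1 = n + 1 - t by omega] at this
      omega
    · rw [Nat.sub_eq_zero_of_le (by omega : n + 1 ≤ t), Nat.sub_eq_zero_of_le (by omega)]
      omega

/-- The reflection `t ↦ n - t` of an I-state. -/
def reflect (x : IState n k) : IState n k := (exists_reflect x).choose

lemma ht_reflect (x : IState n k) (t : ℕ) : ht (reflect x) t = k - ht x (n + 1 - t) :=
  (exists_reflect x).choose_spec t

lemma reflect_reflect (x : IState n k) : reflect (reflect x) = x :=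
  ext_ht' fun i => by
    rw [ht_reflect, ht_reflect, Nat.sub_sub_self (by omega)]
    ring

lemma relWeight_reflect (x y : IState n k) (i : Fin n) :
    relWeight (reflect x) (reflect y) i = -relWeight x y i.rev := by
  rw [relWeight_eq_ht, relWeight_eq_ht, ht_reflect, ht_reflect, Fin.val_rev]
  rw [show n - (i.val + 1) + 1 = n + 1 - (i.val + 1) by omega]
  ring

lemma IsStep.reflect {i : Fin n} {σ : ℤ} {x y : IState n k} (h : IsStep i σ x y) :
    IsStep i.rev (-σ) (reflect x) (reflect y) := fun t => by
  have := h (n + 1 - t)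
  have hi := i.2
  rw [ht_reflect, ht_reflect, this, Fin.val_rev]
  by_cases ht' : t = n - (i.val + 1) + 1
  · rw [if_pos ht', if_pos (by omega)]; ring
  · rw [if_neg ht', if_neg (by omega)]; ring

lemma notMem_reflect {x : IState n k} {s : Fin (n + 1)} (h : s ∉ x.1) :
    s.rev ∉ (reflect x).1 := by
  rw [notMem_iff_ht] at h ⊢
  rw [ht_reflect, ht_reflect, Fin.val_rev]
  have hs := s.2
  rw [show n + 1 - (n + 1 - (s.val + 1)) = s.val + 1 by omega,
    show n + 1 - (n + 1 - (s.val + 1) + 1) = s.val by omega, h]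

lemma ZeroRel.reflect {a b : IState n k} {m : Fin n → ℤ} (h : ZeroRel a b m) :
    ZeroRel (reflect a) (reflect b) (fun i => m i.rev) := by
  cases h with
  | U i _ h₁ h₂ =>
    have := ZeroRel.U i.rev (KauffmanAlg.reflect a)
      (by rw [← Fin.rev_succ]; exact notMem_reflect h₂)
      (by rw [← Fin.rev_castSucc]; exact notMem_reflect h₁)
    simpa only [Fin.rev_eq_iff] using this
  | R i j _ c _ hij h₁ h₂ =>
    have := ZeroRel.L j.rev i.rev _ _ _ (by simp only [Fin.val_rev]; omega) h₁.reflect h₂.reflect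
    simpa only [Fin.rev_eq_iff, or_comm] using this
  | L i j _ c _ hij h₁ h₂ =>
    have := ZeroRel.R j.rev i.rev _ _ _ (by simp only [Fin.val_rev]; omega)
      (by simpa using h₁.reflect) (by simpa using h₂.reflect)
    simpa only [Fin.rev_eq_iff, or_comm] using this

lemma Bad.reflect {P Q : IState n k → Prop} {x y : IState n k} {m : Fin n → ℤ}
    (h : Bad P x y m) (hPQ : ∀ z, P z → Q (reflect z)) :
    Bad Q (reflect x) (reflect y) (fun i => m i.rev) := by
  obtain ⟨a, b, m₀, ha, hb, hab, hm⟩ := h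
  refine ⟨_, _, _, hPQ _ ha, hPQ _ hb, hab.reflect, fun i => ?_⟩
  rw [relWeight_reflect, relWeight_reflect, abs_neg, abs_neg]
  exact hm i.rev

lemma ht_reflect_one (x : IState n k) : ht (reflect x) 1 = k ↔ ht x n = 0 := by
  rw [ht_reflect, Nat.add_sub_cancel]; omega

/-- The reflection of `Bad.clip`. -/
lemma Bad.clip_last {x y : IState n k} {m : Fin n → ℤ} (hx : ht x n = 0) (hy : ht y n = 0)
    (h : Bad (fun _ => True) x y m) : Bad (fun z => ht z n = 0) x y m := by
  have h1 := (h.reflect (Q := fun z => False → ht z n = 0) (fun _ _ h => h.elim)).clip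
    (β := False) ⟨(ht_reflect_one x).2 hx, False.elim⟩ ⟨(ht_reflect_one y).2 hy, False.elim⟩
  have h2 := (h1.resolve_right fun h => h.1).reflect (Q := fun z => ht z n = 0) (fun z hz => by
    rw [← ht_reflect_one, reflect_reflect]; exact hz.1)
  simpa only [reflect_reflect, Fin.rev_rev] using h2

lemma Bad.to_Vr {x y : IState n k} {m : Fin n → ℤ} (hx : x ∈ Vr n k) (hy : y ∈ Vr n k)
    (h : Bad (fun _ => True) x y m) : Bad (· ∈ Vr n k) x y m := by
  rw [mem_Vr_iff] at hx hy
  have := (h.mono (Q := fun z => False → ht z n = 0) (fun _ _ h => h.elim)).clip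
    (β := False) ⟨hx, False.elim⟩ ⟨hy, False.elim⟩
  exact (this.resolve_right fun h => h.1).mono fun z hz => (mem_Vr_iff z).2 hz.1

lemma Bad.to_Vl {x y : IState n k} {m : Fin n → ℤ} (hx : x ∈ Vl n k) (hy : y ∈ Vl n k)
    (h : Bad (fun _ => True) x y m) : Bad (· ∈ Vl n k) x y m := by
  rw [mem_Vl_iff] at hx hy
  exact (h.clip_last hx hy).mono fun z hz => (mem_Vl_iff z).2 hz

lemma Bad.to_Vrl {x y : IState n k} {m : Fin n → ℤ} (hx : x ∈ Vrl n k) (hy : y ∈ Vrl n k)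
    (h : Bad (fun _ => True) x y m) :
    Bad (· ∈ Vrl n k) x y m ∨ (k + 1 = n ∧ ∀ i, 2 ≤ m i) := by
  rw [mem_Vrl_iff] at hx hy
  have := ((h.clip_last hx.2 hy.2).mono (Q := fun z => True → ht z n = 0) (fun _ h _ => h)).clip
    (β := True) ⟨hx.1, fun _ => hx.2⟩ ⟨hy.1, fun _ => hy.2⟩
  exact this.imp (fun h => h.mono fun z hz => (mem_Vrl_iff z).2 ⟨hz.1, hz.2 trivial⟩) fun h => h.2

/-- For `k = n - 1`, the only state with neither `0` nor `n` satisfies the relation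
`U_1 ⋯ U_n = 0`, by a detour through the state `[2,n]`. -/
lemma bad_of_mem_Vrl {x : IState n k} (hx : x ∈ Vrl n k) (hk : k + 1 = n) :
    Bad (fun _ => True) x x (fun _ => 2) := by
  rw [mem_Vrl_iff] at hx
  obtain ⟨z, hz⟩ := exists_join_two x (by omega)
  have hz1 : ht z 1 = k := by
    have h3 := hz 0
    rw [if_pos (by simp), max_eq_right (ht_le x _)] at h3
    exact h3
  have hz2 : ht z 2 = k := by
    have h3 := hz 1
    rw [if_neg (by simp)] at h3
    refine h3.trans ((max_eq_right ?_).trans ?_)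
    · simpa using ht_le x 2
    · simp
  refine ⟨z, z, _, trivial, trivial, .U ⟨0, by omega⟩ z ?_ ?_, fun l => ?_⟩
  · rw [notMem_iff_ht]; simp [ht_zero, hz1]
  · rw [notMem_iff_ht]; simp [hz1, hz2]
  · rw [← relWeight_neg, abs_neg, ← relWeight_neg, relWeight_eq_ht, hz]
    have h1 := le_ht_succ x hx.1 l
    have h2 : ht x (l + 1) ≤ k - l := by
      have h3 := ht_le_add x (l + 1) (n - (l + 1))
      rw [Nat.add_sub_cancel' (by omega), hx.2] at h3
      omega
    have h3 : ht x (l + 1) = k - l := le_antisymm h2 h1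
    rw [h3]
    by_cases hl : (l.val : ℤ) = 0
    · have : l = (⟨0, by omega⟩ : Fin n) := Fin.ext (by simpa using hl)
      rw [if_pos hl, if_pos this, hl]; simp
    · have : l ≠ (⟨0, by omega⟩ : Fin n) := fun h => hl (by simp [h])
      rw [if_neg hl, if_neg this, max_eq_right (by linarith)]
      rw [show -((k : ℤ) + 1 - l - (k - l)) = -1 by ring]; simp

end Vanishing

/-! ### Quotients by relations -/

section Quotients

variable {𝕜 : Type} [CommRing 𝕜] {A : Type} [Ring A]

lemma Quiv.mk_surjective (R : Set A) : Function.Surjective (Quiv.mk R) :=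
  (TwoSidedIdeal.span R).ringCon.mk'_surjective

lemma Quiv.mk_eq_zero_iff (R : Set A) (a : A) :
    Quiv.mk R a = 0 ↔ a ∈ TwoSidedIdeal.span R := by
  rw [TwoSidedIdeal.mem_iff, ← map_zero (Quiv.mk R)]
  exact RingCon.eq _

lemma Quiv.mk_eq_zero {R : Set A} {a : A} (h : a ∈ R) : Quiv.mk R a = 0 :=
  (Quiv.mk_eq_zero_iff R a).2 (TwoSidedIdeal.subset_span h)

lemma Quiv.mk_smul [Algebra 𝕜 A] (R : Set A) (c : 𝕜) (a : A) :
    Quiv.mk R (c • a) = c • Quiv.mk R a := rfl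

/-- A ring homomorphism that kills the relations descends to the quotient. -/
def Quiv.lift {R : Set A} {A' : Type} [Ring A'] (f : A →+* A') (hf : ∀ r ∈ R, f r = 0) :
    Quiv R →+* A' :=
  (TwoSidedIdeal.span R).ringCon.lift f fun a b hab => by
    have h : a - b ∈ TwoSidedIdeal.span R := (TwoSidedIdeal.rel_iff _ _ _).1 hab
    have h2 : TwoSidedIdeal.span R ≤ TwoSidedIdeal.ker f :=
      TwoSidedIdeal.span_le.2 fun r hr => (TwoSidedIdeal.mem_ker f).2 (hf r hr)
    have h3 := (TwoSidedIdeal.mem_ker f).1 (h2 h)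
    rwa [map_sub, sub_eq_zero] at h3

/-- A linear map that kills the ideal generated by the relations descends to the quotient. -/
def Quiv.liftLinear [Algebra 𝕜 A] {N : Type} [AddCommGroup N] [Module 𝕜 N] {R : Set A}
    (g : A →ₗ[𝕜] N) (hg : ∀ a ∈ TwoSidedIdeal.span R, g a = 0) : Quiv R →ₗ[𝕜] N where
  toFun q := Quotient.liftOn q g fun a b hab => by
    have h : a - b ∈ TwoSidedIdeal.span R := (TwoSidedIdeal.rel_iff _ _ _).1 hab
    have := hg _ h
    rwa [map_sub, sub_eq_zero] at this
  map_add' q q' := by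
    obtain ⟨a, rfl⟩ := Quiv.mk_surjective R q
    obtain ⟨b, rfl⟩ := Quiv.mk_surjective R q'
    exact map_add g a b
  map_smul' c q := by
    obtain ⟨a, rfl⟩ := Quiv.mk_surjective R q
    exact map_smul g c a

end Quotients

/-! ### Maps on path algebras -/

section PathAlgebra

variable {𝕜 : Type} [CommRing 𝕜] {V : Type} [Quiver.{0} V] [Fintype V] [DecidableEq V]

lemma PathAlg.single_apply_same (x y : V) (a : Quiver.Path x y →₀ 𝕜) :
    PathAlg.single 𝕜 x y a x y = a := by simp [PathAlg.single]

lemma PathAlg.single_apply_ne {x y u v : V} (h : ¬(x = u ∧ y = v)) (a : Quiver.Path x y →₀ 𝕜) :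
    PathAlg.single 𝕜 x y a u v = 0 := by
  by_cases hu : x = u
  · subst hu
    have hv : v ≠ y := fun hv => h ⟨rfl, hv.symm⟩
    simp [PathAlg.single, Pi.single_eq_of_ne hv]
  · simp [PathAlg.single, Pi.single_eq_of_ne (Ne.symm hu)]

lemma PathAlg.sum_single (a : PathAlg 𝕜 V) : ∑ x, ∑ y, PathAlg.single 𝕜 x y (a x y) = a := by
  refine PathAlg.ext' fun u v => ?_
  rw [PathAlg.sum_apply, Finset.sum_eq_single u, PathAlg.sum_apply, Finset.sum_eq_single v]
  · simp [PathAlg.single]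
  · intro y _ hy; simp [PathAlg.single, Pi.single_eq_of_ne hy.symm]
  · simp
  · intro x _ hx
    rw [PathAlg.sum_apply]
    exact Finset.sum_eq_zero fun y _ => by simp [PathAlg.single, Pi.single_eq_of_ne hx.symm]
  · simp

lemma PathAlg.single_add (x y : V) (a b : Quiver.Path x y →₀ 𝕜) :
    PathAlg.single 𝕜 x y (a + b) = PathAlg.single 𝕜 x y a + PathAlg.single 𝕜 x y b := by
  simp only [PathAlg.single, Pi.single_add]
  rfl

lemma PathAlg.single_zero (x y : V) : PathAlg.single 𝕜 x y 0 = 0 := by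
  simp only [PathAlg.single, Pi.single_zero]
  rfl

lemma PathAlg.single_smul (c : 𝕜) (x y : V) (a : Quiver.Path x y →₀ 𝕜) :
    PathAlg.single 𝕜 x y (c • a) = c • PathAlg.single 𝕜 x y a := by
  simp only [PathAlg.single, Pi.single_smul]
  rfl

lemma PathAlg.single_finsupp_single (x y : V) (p : Quiver.Path x y) (c : 𝕜) :
    PathAlg.single 𝕜 x y (Finsupp.single p c) = c • PathAlg.path 𝕜 p := by
  rw [PathAlg.path, ← PathAlg.single_smul, Finsupp.smul_single, smul_eq_mul, mul_one]

/-- The path algebra is spanned by the paths. -/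
@[elab_as_elim]
lemma PathAlg.induction {P : PathAlg 𝕜 V → Prop} (a : PathAlg 𝕜 V) (zero : P 0)
    (add : ∀ a b, P a → P b → P (a + b))
    (path : ∀ (x y : V) (p : Quiver.Path x y) (c : 𝕜), P (c • PathAlg.path 𝕜 p)) : P a := by
  have hsum : ∀ {ι : Type} (s : Finset ι) (f : ι → PathAlg 𝕜 V), (∀ i ∈ s, P (f i)) →
      P (∑ i ∈ s, f i) := fun s f h => Finset.sum_induction f P add zero h
  rw [← PathAlg.sum_single a]
  refine hsum _ _ fun x _ => hsum _ _ fun y _ => ?_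
  generalize a x y = b
  induction b using Finsupp.induction_linear with
  | zero => rw [PathAlg.single_zero]; exact zero
  | add b b' hb hb' => rw [PathAlg.single_add]; exact add _ _ hb hb'
  | single p c => rw [PathAlg.single_finsupp_single]; exact path x y p c

lemma PathAlg.path_mul_path {x y z : V} (p : Quiver.Path x y) (q : Quiver.Path y z) :
    PathAlg.path 𝕜 p * PathAlg.path 𝕜 q = PathAlg.path 𝕜 (p.comp q) := by
  rw [PathAlg.path, PathAlg.path, PathAlg.single_mul_single, pcomp_single, mul_one]; rfl

lemma PathAlg.path_mul_path_ne {w x y z : V} (h : x ≠ y) (p : Quiver.Path w x)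
    (q : Quiver.Path y z) : PathAlg.path 𝕜 p * PathAlg.path 𝕜 q = 0 :=
  PathAlg.single_mul_single_ne _ _ _ _ h _ _

variable {R A : Type} [CommRing R] [Ring A] [Algebra R A] (ρ : 𝕜 →+* R)
  (φ : ∀ x y : V, Quiver.Path x y → A)

/-- The extension of a function on paths to the path algebra, semilinear with respect to a
homomorphism `ρ` of coefficient rings. -/
def pathLift : PathAlg 𝕜 V →+ A where
  toFun a := ∑ x, ∑ y, (a x y).sum fun p c => ρ c • φ x y p
  map_zero' := by simp [PathAlg.zero_apply]
  map_add' a b := by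
    simp only [PathAlg.add_apply, ← Finset.sum_add_distrib]
    refine Finset.sum_congr rfl fun x _ => Finset.sum_congr rfl fun y _ => ?_
    exact Finsupp.sum_add_index' (by simp) (by simp [add_smul])

lemma pathLift_single (x y : V) (a : Quiver.Path x y →₀ 𝕜) :
    pathLift ρ φ (PathAlg.single 𝕜 x y a) = a.sum fun p c => ρ c • φ x y p := by
  show ∑ u, ∑ v, _ = _
  rw [Finset.sum_eq_single x, Finset.sum_eq_single y]
  · simp [PathAlg.single]
  · intro v _ hv; simp [PathAlg.single, Pi.single_eq_of_ne hv]
  · simp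
  · intro u _ hu
    exact Finset.sum_eq_zero fun v _ => by simp [PathAlg.single, Pi.single_eq_of_ne hu]
  · simp

lemma pathLift_smul_path {x y : V} (p : Quiver.Path x y) (c : 𝕜) :
    pathLift ρ φ (c • PathAlg.path 𝕜 p) = ρ c • φ x y p := by
  rw [← PathAlg.single_finsupp_single, pathLift_single, Finsupp.sum_single_index (by simp)]

lemma pathLift_path {x y : V} (p : Quiver.Path x y) :
    pathLift ρ φ (PathAlg.path 𝕜 p) = φ x y p := by
  have := pathLift_smul_path ρ φ p 1
  rwa [one_smul, map_one, one_smul] at this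

lemma pathLift_mul
    (hcomp : ∀ (x y z : V) (p : Quiver.Path x y) (q : Quiver.Path y z),
      φ x z (p.comp q) = φ x y p * φ y z q)
    (hzero : ∀ (w x y z : V) (p : Quiver.Path w x) (q : Quiver.Path y z), x ≠ y →
      φ w x p * φ y z q = 0) (a b : PathAlg 𝕜 V) :
    pathLift ρ φ (a * b) = pathLift ρ φ a * pathLift ρ φ b := by
  induction a using PathAlg.induction with
  | zero => simp
  | add a a' ha ha' => rw [add_mul, map_add, map_add, add_mul, ha, ha']
  | path w x p c =>
    induction b using PathAlg.induction with
    | zero => simp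
    | add b b' hb hb' => rw [mul_add, map_add, map_add, mul_add, hb, hb']
    | path y z q d =>
      rw [smul_mul_smul_comm, pathLift_smul_path, pathLift_smul_path, smul_mul_smul_comm]
      by_cases h : x = y
      · subst h
        rw [PathAlg.path_mul_path, pathLift_smul_path, hcomp, map_mul]
      · rw [PathAlg.path_mul_path_ne h, hzero _ _ _ _ _ _ h, smul_zero, smul_zero, map_zero]

end PathAlgebra

/-! ### Coordinates on the algebra `B(n,k)` -/

section Coordinates

variable {n k : ℕ}

/-- The exponents of the monomial in the product formula for `f_{x,y} f_{y,z}`. -/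
def expo (x y z : IState n k) (i : Fin n) : ℕ :=
  ((|relWeight y z i| - |relWeight x z i| + |relWeight x y i|) / 2).toNat

lemma two_mul_expo (x y z : IState n k) (i : Fin n) :
    2 * (expo x y z i : ℤ) = |relWeight y z i| - |relWeight x z i| + |relWeight x y i| := by
  have h := relWeight_add x y z i
  have h2 := abs_add_le (relWeight x y i) (relWeight y z i)
  rw [h] at h2
  unfold expo
  rw [Int.toNat_of_nonneg (by omega)]
  rcases abs_cases (relWeight x y i) with h3 | h3 <;>
  rcases abs_cases (relWeight y z i) with h4 | h4 <;>
  rcases abs_cases (relWeight x z i) with h5 | h5 <;> omega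

/-- The monomial `U_1 ^ r_1 ⋯ U_n ^ r_n`. -/
def umon (r : Fin n → ℕ) : Coeff n := ∏ i, (MvPolynomial.X i : Coeff n) ^ r i

lemma umon_add (r s : Fin n → ℕ) : umon (r + s) = umon r * umon s := by
  simp [umon, pow_add, Finset.prod_mul_distrib]

lemma umon_zero : umon (0 : Fin n → ℕ) = 1 := by simp [umon]

lemma umon_single (i : Fin n) : umon (Pi.single i 1) = (MvPolynomial.X i : Coeff n) := by
  rw [umon, Finset.prod_eq_single i]
  · simp
  · intro j _ hj; simp [Pi.single_eq_of_ne hj]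
  · simp

lemma umon_eq_monomial (r : Fin n → ℕ) :
    umon r = MvPolynomial.monomial (Finsupp.equivFunOnFinite.symm r) 1 := by
  rw [MvPolynomial.monomial_eq, map_one, one_mul, Finsupp.prod_fintype _ _ (by simp)]
  rfl

lemma prodMonomial_eq (x y z : IState n k) : prodMonomial x y z = umon (expo x y z) := rfl

lemma expo_cocycle (w x y z : IState n k) :
    expo w x y + expo w y z = expo x y z + expo w x z := by
  funext i
  have h1 := two_mul_expo w x y i
  have h2 := two_mul_expo w y z i
  have h3 := two_mul_expo x y z i
  have h4 := two_mul_expo w x z i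
  simp only [Pi.add_apply]
  omega

lemma expo_self_right (x y : IState n k) : expo x y y = 0 := by
  funext i
  have := two_mul_expo x y y i
  simp only [relWeight_self, abs_zero, Pi.zero_apply] at *
  omega

lemma expo_self_left (x y : IState n k) : expo x x y = 0 := by
  funext i
  have := two_mul_expo x x y i
  simp only [relWeight_self, abs_zero, Pi.zero_apply] at *
  omega

/-- The exponents of `expo`, for vertices of `K(n,k)`. -/
def kExpo (x y z : KVert n k) : Fin n → ℕ := expo (n := n) (k := k) x y z

/-- The coefficient of `f_{x,y}` in the product of the edges of a path from `x` to `y`. -/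
def kWeight {x : KVert n k} : {y : KVert n k} → Quiver.Path x y → Coeff n
  | _, .nil => 1
  | z, .cons (b := y) p _ => kWeight p * umon (kExpo x y z)

lemma kWeight_comp {x y z : KVert n k} (p : Quiver.Path x y) (q : Quiver.Path y z) :
    kWeight (p.comp q) = umon (kExpo x y z) * kWeight p * kWeight q := by
  induction q with
  | nil =>
    have h : kExpo x y y = 0 := expo_self_right _ _
    rw [h, umon_zero, one_mul, Quiver.Path.comp_nil, kWeight, mul_one]
  | @cons z w q e ih =>
    rw [Quiver.Path.comp_cons, kWeight, kWeight, ih]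
    have h : kExpo x y z + kExpo x z w = kExpo y z w + kExpo x y w := expo_cocycle _ _ _ _
    have := congrArg umon h
    rw [umon_add, umon_add] at this
    linear_combination (kWeight p * kWeight q) * this

/-- The coefficient of `f_{x,y}` of an element of the path algebra of `K(n,k)`, after applying the
product formula. -/
def coordK (x y : KVert n k) : PathK n k →ₗ[Coeff n] Coeff n where
  toFun a := Finsupp.linearCombination (Coeff n)
    (fun p : Quiver.Path x y => kWeight p) (a x y)
  map_add' a b := map_add _ _ _
  map_smul' c a := by rw [PathAlg.smul_apply, map_smul, RingHom.id_apply]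

lemma coordK_apply (x y : KVert n k) (a : PathK n k) : coordK x y a =
    Finsupp.linearCombination (Coeff n) (fun p : Quiver.Path x y => kWeight p) (a x y) := rfl

lemma coordK_mul (x z : KVert n k) (a b : PathK n k) :
    coordK x z (a * b) = ∑ y, umon (kExpo x y z) * (coordK x y a * coordK y z b) := by
  have h : ∀ y : KVert n k, ∀ (a : Quiver.Path x y →₀ Coeff n)
      (b : Quiver.Path y z →₀ Coeff n),
      Finsupp.linearCombination (Coeff n) (fun p => kWeight p) (pcomp (Coeff n) _ _ _ a b) =
      umon (kExpo x y z) *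
        (Finsupp.linearCombination (Coeff n) (fun p => kWeight p) a *
        Finsupp.linearCombination (Coeff n) (fun p => kWeight p) b) := by
    intro y a b
    induction a using Finsupp.induction_linear with
    | zero => simp
    | add a a' ha ha' => simp only [map_add, LinearMap.add_apply, ha, ha']; ring
    | single p c =>
      induction b using Finsupp.induction_linear with
      | zero => simp
      | add b b' hb hb' => simp only [map_add, hb, hb']; ring
      | single q d =>
        rw [pcomp_single]
        simp only [Finsupp.linearCombination_single, kWeight_comp, smul_eq_mul]
        ring
  simp only [coordK_apply, PathAlg.mul_apply, map_sum]
  exact Finset.sum_congr rfl fun y _ => h y _ _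

open Classical in
lemma coordK_path {x y : KVert n k} (p : Quiver.Path x y) (u v : KVert n k) :
    coordK u v (PathAlg.path (Coeff n) p) =
      if x = u ∧ y = v then kWeight p else 0 := by
  rw [coordK_apply, PathAlg.path]
  split_ifs with h
  · obtain ⟨rfl, rfl⟩ := h
    rw [PathAlg.single_apply_same, Finsupp.linearCombination_single, one_smul]
  · rw [PathAlg.single_apply_ne h, map_zero]

lemma coordK_edge (x y u v : KVert n k) :
    coordK u v (kEdge x y) = if x = u ∧ y = v then 1 else 0 := by
  rw [kEdge, coordK_path]
  have : kWeight (Quiver.Hom.toPath (show x ⟶ y from ())) = 1 := by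
    have h : kExpo x x y = 0 := expo_self_left _ _
    rw [Quiver.Hom.toPath, kWeight, kWeight, one_mul, h, umon_zero]
  rw [this]

lemma coordK_idem (x u v : KVert n k) :
    coordK u v (PathAlg.idem (Coeff n) x) = if x = u ∧ x = v then 1 else 0 := by
  rw [PathAlg.idem, coordK_path, kWeight]

/-- Coordinate functions that satisfy a product formula like that of `B₀(n,k)`, together with
ideals that are compatible with this formula, define a two-sided ideal. -/
def coordIdeal {ι 𝕜 A : Type} [Fintype ι] [CommRing 𝕜] [Ring A] [Algebra 𝕜 A]
    (M : ι → ι → ι → 𝕜) (c : ι → ι → A →ₗ[𝕜] 𝕜)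
    (hc : ∀ x z a b, c x z (a * b) = ∑ y, M x y z * (c x y a * c y z b))
    (J : ι → ι → Ideal 𝕜) (hl : ∀ x y z, ∀ b ∈ J y z, M x y z * b ∈ J x z)
    (hr : ∀ x y z, ∀ b ∈ J x y, M x y z * b ∈ J x z) : TwoSidedIdeal A :=
  TwoSidedIdeal.mk' {a | ∀ x y, c x y a ∈ J x y}
    (fun x y => by simp)
    (fun ha hb x y => by rw [map_add]; exact (J x y).add_mem (ha x y) (hb x y))
    (fun ha x y => by rw [map_neg]; exact (J x y).neg_mem (ha x y))
    (fun {a b} hb x z => by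
      rw [hc]
      refine (J x z).sum_mem fun y _ => ?_
      rw [mul_left_comm]
      exact (J x z).mul_mem_left _ (hl x y z _ (hb y z)))
    (fun {a b} ha x z => by
      rw [hc]
      refine (J x z).sum_mem fun y _ => ?_
      rw [← mul_assoc]
      exact (J x z).mul_mem_right _ (hr x y z _ (ha x y)))

lemma mem_coordIdeal {ι 𝕜 A : Type} [Fintype ι] [CommRing 𝕜] [Ring A] [Algebra 𝕜 A]
    {M : ι → ι → ι → 𝕜} {c : ι → ι → A →ₗ[𝕜] 𝕜}
    {hc : ∀ x z a b, c x z (a * b) = ∑ y, M x y z * (c x y a * c y z b)}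
    {J : ι → ι → Ideal 𝕜} {hl : ∀ x y z, ∀ b ∈ J y z, M x y z * b ∈ J x z}
    {hr : ∀ x y z, ∀ b ∈ J x y, M x y z * b ∈ J x z} {a : A} :
    a ∈ coordIdeal M c hc J hl hr ↔ ∀ x y, c x y a ∈ J x y :=
  TwoSidedIdeal.mem_mk' _ _ _ _ _ _ _

lemma coordK_eq_zero_of_mem_span (x y : KVert n k) (a : PathK n k)
    (ha : a ∈ TwoSidedIdeal.span (relK n k)) : coordK x y a = 0 := by
  have hle : TwoSidedIdeal.span (relK n k) ≤
      coordIdeal (fun x y z : KVert n k => umon (kExpo x y z)) coordK coordK_mul (fun _ _ => ⊥)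
        (fun _ _ _ b hb => by rw [Ideal.mem_bot] at hb ⊢; rw [hb, mul_zero])
        (fun _ _ _ b hb => by rw [Ideal.mem_bot] at hb ⊢; rw [hb, mul_zero]) := by
    refine TwoSidedIdeal.span_le.2 fun r hr => ?_
    rw [SetLike.mem_coe, mem_coordIdeal]
    intro u v
    rw [Ideal.mem_bot]
    show coordK u v r = 0
    rcases hr with ⟨x, y, z, rfl⟩ | ⟨x, rfl⟩
    · have h0 : prodMonomial (n := n) (k := k) x y z = umon (kExpo x y z) := rfl
      rw [h0, map_sub, map_smul, coordK_mul, coordK_edge, smul_eq_mul]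
      simp only [coordK_edge]
      rw [Finset.sum_eq_single y]
      · by_cases h : x = u ∧ z = v
        · obtain ⟨rfl, rfl⟩ := h
          simp
        · rw [if_neg h, mul_zero, sub_zero]
          by_cases h1 : x = u
          · rw [if_neg (fun h2 : y = y ∧ z = v => h ⟨h1, h2.2⟩)]; simp
          · rw [if_neg (fun h2 : x = u ∧ y = y => h1 h2.1)]; simp
      · intro w _ hw
        rw [if_neg (fun h2 : x = u ∧ y = w => hw h2.2.symm)]; simp
      · simp
    · rw [map_sub, coordK_edge, coordK_idem, sub_self]
  exact (mem_coordIdeal.1 (hle ha)) x y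

/-- The coefficient of `f_{x,y}` of an element of `B₀(n,k)`. -/
def coord0 (x y : IState n k) : B0 n k →ₗ[Coeff n] Coeff n :=
  Quiv.liftLinear (coordK (n := n) (k := k) x y) (coordK_eq_zero_of_mem_span x y)

lemma coord0_mul (x z : IState n k) (a b : B0 n k) :
    coord0 x z (a * b) = ∑ y, prodMonomial x y z * (coord0 x y a * coord0 y z b) := by
  obtain ⟨a, rfl⟩ := Quiv.mk_surjective _ a
  obtain ⟨b, rfl⟩ := Quiv.mk_surjective _ b
  exact coordK_mul (n := n) (k := k) x z a b

lemma coord0_f (x y u v : IState n k) :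
    coord0 u v (B0.f x y) = if x = u ∧ y = v then 1 else 0 :=
  coordK_edge (n := n) (k := k) x y u v

lemma coord0_idem (x u v : IState n k) :
    coord0 u v (B0.idem x) = if x = u ∧ x = v then 1 else 0 :=
  coordK_idem (n := n) (k := k) x u v

lemma coord0_R (i : Fin n) (u v : IState n k) :
    coord0 u v (B0.R k i) = if IsRStep i u v then 1 else 0 := by
  rw [B0.R, map_sum, Finset.sum_eq_single u, map_sum, Finset.sum_eq_single v]
  · split_ifs <;> simp [coord0_f]
  · intro y _ hy; split_ifs <;> simp [coord0_f, hy]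
  · simp
  · intro x _ hx
    rw [map_sum]
    exact Finset.sum_eq_zero fun y _ => by split_ifs <;> simp [coord0_f, hx]
  · simp

lemma coord0_L (i : Fin n) (u v : IState n k) :
    coord0 u v (B0.L k i) = if IsLStep i u v then 1 else 0 := by
  rw [B0.L, map_sum, Finset.sum_eq_single u, map_sum, Finset.sum_eq_single v]
  · split_ifs <;> simp [coord0_f]
  · intro y _ hy; split_ifs <;> simp [coord0_f, hy]
  · simp
  · intro x _ hx
    rw [map_sum]
    exact Finset.sum_eq_zero fun y _ => by split_ifs <;> simp [coord0_f, hx]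
  · simp

lemma coord0_U (i : Fin n) (u v : IState n k) :
    coord0 u v (B0.U k i) = if u = v then MvPolynomial.X i else 0 := by
  rw [B0.U, map_sum, Finset.sum_eq_single u]
  · rw [map_smul, coord0_f]
    split_ifs <;> simp_all
  · intro x _ hx
    rw [map_smul, coord0_f, if_neg (fun h => hx h.1), smul_zero]
  · simp

/-- The ideal of those coefficients that annihilate `f_{x,y}` in `B(n,k)`. It is generated by
monomials. -/
def badIdeal (x y : IState n k) : Ideal (Coeff n) :=
  Ideal.span ((fun s => MvPolynomial.monomial s (1 : ZMod 2)) ''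
    {s : Fin n →₀ ℕ | Bad (fun _ => True) x y (fun i => |relWeight x y i| + 2 * s i)})

lemma umon_mem_badIdeal {x y : IState n k} {r : Fin n → ℕ} :
    umon r ∈ badIdeal x y ↔
      Bad (fun _ => True) x y (fun i => |relWeight x y i| + 2 * r i) := by
  rw [umon_eq_monomial, badIdeal]
  constructor
  · intro h
    rw [MvPolynomial.mem_ideal_span_monomial_image] at h
    obtain ⟨s, hs, hle⟩ := h (Finsupp.equivFunOnFinite.symm r) (by simp)
    refine Bad.le hs fun i => ?_
    have := hle i
    simp only [Finsupp.equivFunOnFinite_symm_apply_apply] at this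
    omega
  · intro h
    exact Ideal.subset_span ⟨_, by simpa using h, rfl⟩

lemma badIdeal_left (x y z : IState n k) (b : Coeff n) (hb : b ∈ badIdeal y z) :
    prodMonomial x y z * b ∈ badIdeal x z := by
  have : badIdeal y z ≤ Submodule.comap (LinearMap.mulLeft (Coeff n) (prodMonomial x y z)) (badIdeal x z) :=
    by
    refine Ideal.span_le.2 ?_
    rintro _ ⟨s, hs, rfl⟩
    show prodMonomial x y z * MvPolynomial.monomial s 1 ∈ badIdeal x z
    have h1 : MvPolynomial.monomial s (1 : ZMod 2) = umon s := by
      rw [umon_eq_monomial]; simp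
    rw [h1, prodMonomial_eq, ← umon_add, umon_mem_badIdeal]
    refine (Bad.comp_left hs x).le fun i => ?_
    have := two_mul_expo x y z i
    simp only [Pi.add_apply]
    push_cast
    linarith
  exact this hb

lemma badIdeal_right (x y z : IState n k) (b : Coeff n) (hb : b ∈ badIdeal x y) :
    prodMonomial x y z * b ∈ badIdeal x z := by
  have : badIdeal x y ≤ Submodule.comap (LinearMap.mulLeft (Coeff n) (prodMonomial x y z)) (badIdeal x z) :=
    by
    refine Ideal.span_le.2 ?_
    rintro _ ⟨s, hs, rfl⟩
    show prodMonomial x y z * MvPolynomial.monomial s 1 ∈ badIdeal x z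
    have h1 : MvPolynomial.monomial s (1 : ZMod 2) = umon s := by
      rw [umon_eq_monomial]; simp
    rw [h1, prodMonomial_eq, ← umon_add, umon_mem_badIdeal]
    refine (Bad.comp_right hs z).le fun i => ?_
    have := two_mul_expo x y z i
    simp only [Pi.add_apply]
    push_cast
    linarith
  exact this hb

lemma ZeroRel.bad {a b : IState n k} {m : Fin n → ℤ} (h : ZeroRel a b m) :
    Bad (fun _ => True) a b m :=
  ⟨a, b, m, trivial, trivial, h, fun i => by simp [relWeight_self]⟩

lemma coord0_mem_badIdeal (b : B0 n k) (hb : b ∈ TwoSidedIdeal.span (relB n k))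
    (x y : IState n k) : coord0 x y b ∈ badIdeal x y := by
  have hle : TwoSidedIdeal.span (relB n k) ≤
      coordIdeal prodMonomial coord0 coord0_mul badIdeal badIdeal_left
        badIdeal_right := by
    refine TwoSidedIdeal.span_le.2 fun r hr => ?_
    rw [SetLike.mem_coe, mem_coordIdeal]
    intro u v
    show coord0 u v r ∈ badIdeal u v
    rcases hr with ⟨i, j, hij, rfl | rfl⟩ | ⟨i, x, h1, h2, rfl⟩
    · rw [coord0_mul]
      refine Ideal.sum_mem _ fun y _ => ?_
      rw [coord0_R, coord0_R]
      split_ifs with h1 h2 <;> try simp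
      rw [isRStep_iff] at h1 h2
      rw [prodMonomial_eq, umon_mem_badIdeal]
      refine (ZeroRel.R i j u y v hij h1 h2).bad.le fun l => ?_
      have := two_mul_expo u y v l
      rw [h1.relWeight_eq, h2.relWeight_eq] at this
      have hne : i ≠ j := fun h => by rw [h] at hij; omega
      by_cases hi : l = i
      · subst hi; simp [hne] at this ⊢; omega
      · by_cases hj : l = j
        · subst hj; simp [hne.symm] at this ⊢; omega
        · simp [hi, hj] at this ⊢; omega
    · rw [coord0_mul]
      refine Ideal.sum_mem _ fun y _ => ?_
      rw [coord0_L, coord0_L]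
      split_ifs with h1 h2 <;> try simp
      rw [isLStep_iff] at h1 h2
      rw [prodMonomial_eq, umon_mem_badIdeal]
      refine (ZeroRel.L i j u y v hij h1 h2).bad.le fun l => ?_
      have := two_mul_expo u y v l
      rw [h1.relWeight_eq, h2.relWeight_eq] at this
      have hne : i ≠ j := fun h => by rw [h] at hij; omega
      by_cases hi : l = i
      · subst hi; simp [hne] at this ⊢; omega
      · by_cases hj : l = j
        · subst hj; simp [hne.symm] at this ⊢; omega
        · simp [hi, hj] at this ⊢; omega
    · rw [coord0_mul]
      refine Ideal.sum_mem _ fun y _ => ?_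
      rw [coord0_idem, coord0_U]
      split_ifs with h3 h4 <;> try simp
      obtain ⟨rfl, rfl⟩ := h3
      subst h4
      rw [prodMonomial_eq, expo_self_right, umon_zero, one_mul, ← umon_single, umon_mem_badIdeal]
      refine (ZeroRel.U i x h1 h2).bad.le fun l => ?_
      rw [relWeight_self]
      by_cases hi : l = i
      · subst hi; simp
      · simp [hi]
  exact (mem_coordIdeal.1 (hle hb)) x y

/-- The coefficient of `f_{x,y}` of an element of `B(n,k)`. -/
def coordB (x y : IState n k) : B n k →ₗ[Coeff n] (Coeff n ⧸ badIdeal x y) :=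
  Quiv.liftLinear ((Submodule.mkQ (badIdeal x y)).comp (coord0 x y)) fun b hb =>
    (Submodule.Quotient.mk_eq_zero _).2 (coord0_mem_badIdeal b hb x y)

lemma coordB_f (x y u v : IState n k) :
    coordB u v (B.f x y) = Submodule.Quotient.mk (if x = u ∧ y = v then 1 else 0) := by
  rw [← coord0_f]; rfl

end Coordinates

/-! ### Products in `B(n,k)` -/

section BAlgebra

variable {n k : ℕ}

lemma Quiv.mk_mul_mk_of_mem {𝕜 A : Type} [CommRing 𝕜] [Ring A] [Algebra 𝕜 A] {R : Set A}
    {a b d : A} {c : 𝕜} (h : a * b - c • d ∈ R) :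
    Quiv.mk R a * Quiv.mk R b = c • Quiv.mk R d := by
  have h2 := Quiv.mk_eq_zero h
  rw [map_sub, map_mul, Quiv.mk_smul] at h2
  exact sub_eq_zero.1 h2

lemma mk_kEdge_mul (x y z : KVert n k) :
    Quiv.mk (relK n k) (kEdge x y) * Quiv.mk (relK n k) (kEdge y z) =
      prodMonomial (n := n) (k := k) x y z • Quiv.mk (relK n k) (kEdge x z) := by
  apply Quiv.mk_mul_mk_of_mem
  exact Or.inl ⟨x, y, z, rfl⟩

lemma B0.f_mul (x y z : IState n k) : B0.f x y * B0.f y z = umon (expo x y z) • B0.f x z := by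
  rw [← prodMonomial_eq]
  exact mk_kEdge_mul (n := n) (k := k) x y z

lemma kEdge_mul_ne {w x y z : KVert n k} (h : x ≠ y) : kEdge w x * kEdge y z = 0 :=
  PathAlg.path_mul_path_ne h _ _

lemma B0.f_mul_ne {w x y z : IState n k} (h : x ≠ y) : B0.f w x * B0.f y z = 0 := by
  have h3 := congrArg (Quiv.mk (relK n k)) (kEdge_mul_ne (n := n) (k := k) (w := w) (z := z) h)
  rw [map_mul, map_zero] at h3
  exact h3

lemma B0.f_self (x : IState n k) : B0.f x x = B0.idem x := by
  have h := Quiv.mk_eq_zero (R := relK n k) (Or.inr ⟨x, rfl⟩)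
  rw [map_sub, sub_eq_zero] at h
  exact h

lemma B.f_mul (x y z : IState n k) : B.f x y * B.f y z = umon (expo x y z) • B.f x z := by
  rw [B.f, B.f, ← map_mul, B0.f_mul]; rfl

lemma B.f_mul_ne {w x y z : IState n k} (h : x ≠ y) : B.f w x * B.f y z = 0 := by
  rw [B.f, B.f, ← map_mul, B0.f_mul_ne h, map_zero]

lemma B.f_self (x : IState n k) : B.f x x = B.idem x := by
  rw [B.f, B0.f_self]; rfl

/-- A product in which no cancellation of crossings occurs. -/
lemma B.f_mul_of_expo {x y z : IState n k} (h : expo x y z = 0) :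
    B.f x y * B.f y z = B.f x z := by
  rw [B.f_mul, h, umon_zero, one_smul]

lemma B.f_mul_mk_R {i : Fin n} {a c : IState n k} (x : IState n k) (h : IsStep i 1 a c) :
    B.f x a * Quiv.mk (relB n k) (B0.R k i) = B.f x a * B.f a c := by
  rw [B.f, B.f, ← map_mul, ← map_mul]
  congr 1
  rw [B0.R, Finset.mul_sum, Finset.sum_eq_single a, Finset.mul_sum, Finset.sum_eq_single c]
  · rw [if_pos ((isRStep_iff _ _ _).2 h)]
  · intro y _ hy
    rw [if_neg (fun h' => hy (((isRStep_iff _ _ _).1 h').target_unique h)), mul_zero]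
  · simp
  · intro y _ hy
    rw [Finset.mul_sum]
    refine Finset.sum_eq_zero fun z _ => ?_
    split_ifs
    · exact B0.f_mul_ne hy.symm
    · exact mul_zero _
  · simp

lemma B.f_mul_mk_L {i : Fin n} {a c : IState n k} (x : IState n k) (h : IsStep i (-1) a c) :
    B.f x a * Quiv.mk (relB n k) (B0.L k i) = B.f x a * B.f a c := by
  rw [B.f, B.f, ← map_mul, ← map_mul]
  congr 1
  rw [B0.L, Finset.mul_sum, Finset.sum_eq_single a, Finset.mul_sum, Finset.sum_eq_single c]
  · rw [if_pos ((isLStep_iff _ _ _).2 h)]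
  · intro y _ hy
    rw [if_neg (fun h' => hy (((isLStep_iff _ _ _).1 h').target_unique h)), mul_zero]
  · simp
  · intro y _ hy
    rw [Finset.mul_sum]
    refine Finset.sum_eq_zero fun z _ => ?_
    split_ifs
    · exact B0.f_mul_ne hy.symm
    · exact mul_zero _
  · simp

lemma expo_two_steps {i j : Fin n} {σ τ : ℤ} {a b c : IState n k} (hij : i ≠ j)
    (h₁ : IsStep i σ a c) (h₂ : IsStep j τ c b) : expo a c b = 0 := by
  funext l
  have h := two_mul_expo a c b l
  rw [← relWeight_add a c b l, h₁.relWeight_eq, h₂.relWeight_eq] at h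
  by_cases hi : l = i
  · subst hi; simp [hij] at h ⊢; omega
  · simp [hi] at h ⊢; omega

/-- The monomial relations hold in `B(n,k)`. -/
lemma ZeroRel.smul_f_eq_zero {a b : IState n k} {m : Fin n → ℤ} (h : ZeroRel a b m) :
    ∃ r : Fin n → ℕ, (∀ i, m i = |relWeight a b i| + 2 * r i) ∧ umon r • B.f a b = 0 := by
  cases h with
  | U i _ h₁ h₂ =>
    refine ⟨Pi.single i 1, fun l => ?_, ?_⟩
    · rw [relWeight_self]
      by_cases hl : l = i
      · subst hl; simp
      · simp [hl]
    · rw [umon_single]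
      have h3 := Quiv.mk_eq_zero (R := relB n k) (Or.inr ⟨i, a, h₁, h₂, rfl⟩)
      rw [← h3]
      have h4 : B0.idem a * B0.U k i = (MvPolynomial.X i : Coeff n) • B0.f a a := by
        rw [B0.U, ← B0.f_self, Finset.mul_sum, Finset.sum_eq_single a]
        · rw [mul_smul_comm, B0.f_mul, expo_self_left, umon_zero, one_smul]
        · intro y _ hy
          rw [mul_smul_comm, B0.f_mul_ne hy.symm, smul_zero]
        · simp
      rw [h4]; rfl
  | R i j _ c _ hij h₁ h₂ =>
    have hne : i ≠ j := fun h => by rw [h] at hij; omega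
    refine ⟨0, fun l => ?_, ?_⟩
    · rw [← relWeight_add a c b l, h₁.relWeight_eq, h₂.relWeight_eq]
      by_cases hi : l = i
      · subst hi; simp [hne]
      · by_cases hj : l = j <;> simp [hi, hj, hne.symm]
    · rw [umon_zero, one_smul, ← B.f_mul_of_expo (expo_two_steps hne h₁ h₂)]
      have h3 := Quiv.mk_eq_zero (R := relB n k) (Or.inl ⟨i, j, hij, Or.inl rfl⟩)
      have h4 := congrArg (B.f a a * ·) h3
      simp only [map_mul, mul_zero] at h4
      rw [← mul_assoc, B.f_mul_mk_R a h₁, B.f_mul_of_expo (expo_self_left a c),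
        B.f_mul_mk_R a h₂] at h4
      exact h4
  | L i j _ c _ hij h₁ h₂ =>
    have hne : j ≠ i := fun h => by rw [h] at hij; omega
    refine ⟨0, fun l => ?_, ?_⟩
    · rw [← relWeight_add a c b l, h₁.relWeight_eq, h₂.relWeight_eq]
      by_cases hi : l = j
      · subst hi; simp [hne]
      · by_cases hj : l = i <;> simp [hi, hj, hne.symm]
    · rw [umon_zero, one_smul, ← B.f_mul_of_expo (expo_two_steps hne h₁ h₂)]
      have h3 := Quiv.mk_eq_zero (R := relB n k) (Or.inl ⟨i, j, hij, Or.inr rfl⟩)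
      have h4 := congrArg (B.f a a * ·) h3
      simp only [map_mul, mul_zero] at h4
      rw [← mul_assoc, B.f_mul_mk_L a h₁, B.f_mul_of_expo (expo_self_left a c),
        B.f_mul_mk_L a h₂] at h4
      exact h4

lemma umon_smul_eq_zero_of_le {x y : IState n k} {r s : Fin n → ℕ}
    (h : umon r • B.f x y = 0) (hrs : ∀ i, r i ≤ s i) : umon s • B.f x y = 0 := by
  have : s = (s - r) + r := by
    funext i
    have := hrs i
    simp only [Pi.add_apply, Pi.sub_apply]
    omega
  rw [this, umon_add, mul_smul, h, smul_zero]

/-- The elements `U^r f_{x,y}` with a bad exponent vanish in `B(n,k)`. -/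
lemma umon_smul_f_eq_zero {x y : IState n k} {r : Fin n → ℕ}
    (h : Bad (fun _ => True) x y (fun i => |relWeight x y i| + 2 * r i)) :
    umon r • B.f x y = 0 := by
  obtain ⟨a, b, m, -, -, hab, hm⟩ := h
  obtain ⟨r₀, hr₀, h0⟩ := hab.smul_f_eq_zero
  have h1 : B.f x a * (umon r₀ • B.f a b) * B.f b y =
      umon (r₀ + expo x a b + expo x b y) • B.f x y := by
    rw [mul_smul_comm, B.f_mul, smul_mul_assoc, smul_mul_assoc, B.f_mul, umon_add, umon_add,
      mul_smul, mul_smul]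
  rw [h0, mul_zero, zero_mul] at h1
  refine umon_smul_eq_zero_of_le h1.symm fun i => ?_
  have h2 : _ ≤ |relWeight x y i| + 2 * (r i : ℤ) := hm i
  have h3 := hr₀ i
  have h4 := two_mul_expo x a b i
  have h5 := two_mul_expo x b y i
  simp only [Pi.add_apply]
  omega

end BAlgebra

/-! ### The exterior algebra -/

section Exterior

variable {n k : ℕ} (S : Finset (Fin n))

lemma coeff_two_eq_zero : (2 : Coeff n) = 0 := by
  have : (2 : Coeff n) = MvPolynomial.C (2 : ZMod 2) := (map_ofNat _ 2).symm
  rw [this, show (2 : ZMod 2) = 0 from rfl, map_zero]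

variable (n) in
lemma add_self_eq_zero' {N : Type} [AddCommGroup N] [Module (Coeff n) N] (x : N) :
    x + x = 0 := by
  rw [← two_smul (Coeff n) x, coeff_two_eq_zero, zero_smul]

variable (n) in
lemma neg_eq_self' {N : Type} [AddCommGroup N] [Module (Coeff n) N] (x : N) : -x = x :=
  neg_eq_of_add_eq_zero_left (add_self_eq_zero' n x)

lemma Ext.C_mul_self (i : S) : Ext.C S i * Ext.C S i = 0 :=
  ExteriorAlgebra.ι_sq_zero _

lemma Ext.C_comm (i j : S) : Ext.C S i * Ext.C S j = Ext.C S j * Ext.C S i := by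
  have h : Ext.C S i * Ext.C S j + Ext.C S j * Ext.C S i = 0 := ExteriorAlgebra.ι_add_mul_swap _ _
  rw [← add_self_eq_zero' n (Ext.C S j * Ext.C S i)] at h
  exact add_right_cancel h

/-- The product of the exterior variables in a list. -/
def cprod (l : List S) : Ext S := (l.map (Ext.C S)).prod

variable {S}

lemma cprod_append (l l' : List S) : cprod S (l ++ l') = cprod S l * cprod S l' := by
  simp [cprod]

lemma cprod_cons (i : S) (l : List S) : cprod S (i :: l) = Ext.C S i * cprod S l := by
  simp [cprod]

lemma cprod_perm {l l' : List S} (h : l.Perm l') : cprod S l = cprod S l' := by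
  refine (h.map _).prod_eq' ?_
  rw [List.pairwise_map]
  exact List.pairwise_of_forall fun i j => Ext.C_comm S i j

lemma cprod_eq_zero {l : List S} (h : ¬l.Nodup) : cprod S l = 0 := by
  rw [List.nodup_iff_count_le_one] at h
  push Not at h
  obtain ⟨i, hi⟩ := h
  have h1 : i ∈ l := List.count_pos_iff.1 (by omega)
  have h2 : i ∈ l.erase i := List.count_pos_iff.1 (by rw [List.count_erase_self]; omega)
  rw [cprod_perm ((List.perm_cons_erase h1).trans ((List.perm_cons_erase h2).cons i)),
    cprod_cons, cprod_cons, ← mul_assoc, Ext.C_mul_self, zero_mul]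

variable (S) in
/-- The basis of the exterior algebra consisting of the products of distinct variables. -/
def extBasis : Module.Basis (Finset S) (Coeff n) (Ext S) :=
  (Pi.basisFun (Coeff n) S).ExteriorAlgebra

lemma extBasis_toFinset {l : List S} (hl : l.Nodup) : extBasis S l.toFinset = cprod S l := by
  have h : extBasis S l.toFinset =
      cprod S (List.ofFn (l.toFinset.orderEmbOfFin rfl)) := by
    refine (ExteriorAlgebra.basis_apply_ofCard _ rfl).trans
      ((ExteriorAlgebra.ιMulti_apply _).trans ?_)
    rw [cprod, List.map_ofFn]
    congr 2
    funext i
    simp only [Function.comp, Pi.basisFun_apply, Ext.C]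
    rfl
  rw [h]
  refine cprod_perm (List.perm_of_nodup_nodup_toFinset_eq ?_ hl ?_)
  · rw [List.nodup_ofFn]
    exact (l.toFinset.orderEmbOfFin rfl).injective
  · ext i
    have h2 := Set.ext_iff.1 (l.toFinset.range_orderEmbOfFin rfl) i
    rw [List.mem_toFinset, List.mem_ofFn']
    exact h2

open Classical in
lemma extBasis_coord_cprod {l : List S} (hl : l.Nodup) (ε : Finset S) :
    (extBasis S).coord ε (cprod S l) = if l.toFinset = ε then 1 else 0 := by
  rw [← extBasis_toFinset hl, Module.Basis.coord_apply, Module.Basis.repr_self,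
    Finsupp.single_apply]

end Exterior

/-! ### The generators of `B(n,k,S)` -/

section Generators

variable {n k : ℕ} {S : Finset (Fin n)}

lemma gen_eq (x y : IState n k) (r : Fin n → ℕ) (l : List S) :
    gen x y r l = (umon r • B.f x y) ⊗ₜ[Coeff n] cprod S l := rfl

lemma gen_eq_smul (x y : IState n k) (r : Fin n → ℕ) (l : List S) :
    gen x y r l = umon r • (B.f x y ⊗ₜ[Coeff n] cprod S l) := by
  rw [gen_eq, TensorProduct.smul_tmul']

lemma gen_mul (x y z : IState n k) (r s : Fin n → ℕ) (l l' : List S) :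
    gen x y r l * gen y z s l' = gen x z (r + s + expo x y z) (l ++ l') := by
  rw [gen_eq_smul, gen_eq_smul, gen_eq_smul, smul_mul_smul_comm,
    Algebra.TensorProduct.tmul_mul_tmul, B.f_mul, cprod_append, ← TensorProduct.smul_tmul',
    smul_smul, umon_add, umon_add]

lemma gen_mul_ne {w x y z : IState n k} (h : x ≠ y) (r s : Fin n → ℕ) (l l' : List S) :
    gen w x r l * gen y z s l' = 0 := by
  rw [gen_eq_smul, gen_eq_smul, smul_mul_smul_comm, Algebra.TensorProduct.tmul_mul_tmul,
    B.f_mul_ne h, TensorProduct.zero_tmul, smul_zero]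

lemma gen_perm (x y : IState n k) (r : Fin n → ℕ) {l l' : List S} (h : l.Perm l') :
    gen x y r l = gen x y r l' := by
  rw [gen_eq, gen_eq, cprod_perm h]

lemma gen_eq_zero_of_not_nodup (x y : IState n k) (r : Fin n → ℕ) {l : List S}
    (h : ¬l.Nodup) : gen x y r l = 0 := by
  rw [gen_eq, cprod_eq_zero h, TensorProduct.tmul_zero]

lemma gen_eq_zero_of_bad {x y : IState n k} {r : Fin n → ℕ} (l : List S)
    (h : Bad (fun _ => True) x y (fun i => |relWeight x y i| + 2 * r i)) :
    gen x y r l = 0 := by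
  rw [gen_eq, umon_smul_f_eq_zero h, TensorProduct.zero_tmul]

/-- The coefficient of `f_{x,y}` times the product of the exterior variables in `ε`. -/
def coordBS (x y : IState n k) (ε : Finset S) : BS k S →ₗ[Coeff n] (Coeff n ⧸ badIdeal x y) :=
  TensorProduct.lift (LinearMap.mk₂ (Coeff n)
    (fun (b : B n k) (ω : Ext S) => (extBasis S).coord ε ω • coordB x y b)
    (fun b b' ω => by rw [map_add, smul_add]) (fun c b ω => by rw [map_smul, smul_comm])
    (fun b ω ω' => by rw [map_add, add_smul])
    (fun c b ω => by rw [map_smul, smul_eq_mul, mul_smul]))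

lemma coordBS_tmul (x y : IState n k) (ε : Finset S) (b : B n k) (ω : Ext S) :
    coordBS x y ε (b ⊗ₜ[Coeff n] ω) = (extBasis S).coord ε ω • coordB x y b := rfl

open Classical in
lemma coordBS_gen (x y u v : IState n k) (r : Fin n → ℕ) {l : List S} (hl : l.Nodup)
    (ε : Finset S) : coordBS u v ε (gen x y r l) =
      Submodule.Quotient.mk (if (x = u ∧ y = v) ∧ l.toFinset = ε then umon r else 0) := by
  rw [gen_eq, coordBS_tmul, map_smul, coordB_f, extBasis_coord_cprod hl,
    ← Submodule.Quotient.mk_smul, ← Submodule.Quotient.mk_smul]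
  congr 1
  by_cases h1 : x = u ∧ y = v <;> by_cases h2 : l.toFinset = ε <;> simp [h1, h2]

/-- The generators with distinct exterior variables and coefficients that are not bad are linearly
independent over `𝔽₂`. -/
lemma bad_of_sum_gen_eq_zero {I : Type} (st : I → IState n k × IState n k)
    (r : I → Fin n → ℕ) (l : I → List S) (hl : ∀ i, (l i).Nodup)
    (hinj : ∀ i j, st i = st j → r i = r j → (l i).toFinset = (l j).toFinset → i = j)
    (c : I →₀ ZMod 2)
    (h : (c.sum fun i a => (MvPolynomial.C a : Coeff n) •
      gen (st i).1 (st i).2 (r i) (l i)) = 0) (i : I) (hi : i ∈ c.support) :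
    Bad (fun _ => True) (st i).1 (st i).2
      (fun j => |relWeight (st i).1 (st i).2 j| + 2 * r i j) := by
  classical
  have h1 := congrArg (coordBS (st i).1 (st i).2 (l i).toFinset) h
  rw [map_zero, Finsupp.sum, map_sum] at h1
  simp only [map_smul, coordBS_gen _ _ _ _ _ (hl _), ← Submodule.Quotient.mk_smul] at h1
  have h2 : (∑ j ∈ c.support, (Submodule.mkQ (badIdeal (st i).1 (st i).2))
      ((MvPolynomial.C (c j) : Coeff n) • if ((st j).1 = (st i).1 ∧ (st j).2 = (st i).2) ∧
        (l j).toFinset = (l i).toFinset then umon (r j) else 0)) = 0 := h1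
  rw [← map_sum, Submodule.mkQ_apply, Submodule.Quotient.mk_eq_zero] at h2
  -- The coefficient of `U ^ r i` in this polynomial is the coefficient of `i` in `c`.
  have h3 := MvPolynomial.mem_ideal_span_monomial_image.1 h2
    (Finsupp.equivFunOnFinite.symm (r i)) ?_
  · obtain ⟨s, hs, hle⟩ := h3
    refine Bad.le hs fun j => ?_
    have := hle j
    simp only [Finsupp.equivFunOnFinite_symm_apply_apply] at this
    omega
  · rw [MvPolynomial.mem_support_iff, MvPolynomial.coeff_sum, Finset.sum_eq_single i]
    · rw [if_pos ⟨⟨rfl, rfl⟩, rfl⟩, umon_eq_monomial, smul_eq_mul, MvPolynomial.coeff_C_mul,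
        MvPolynomial.coeff_monomial, if_pos rfl, mul_one]
      exact Finsupp.mem_support_iff.1 hi
    · intro j _ hj
      split_ifs with h4
      · rw [umon_eq_monomial, smul_eq_mul, MvPolynomial.coeff_C_mul,
          MvPolynomial.coeff_monomial, if_neg, mul_zero]
        intro h5
        exact hj (hinj j i (Prod.ext h4.1.1 h4.1.2)
          (Finsupp.equivFunOnFinite.symm.injective h5) h4.2)
      · simp
    · intro h4; exact absurd hi h4

lemma B.mk_mk_path {x y : KVert n k} (p : Quiver.Path x y) :
    Quiv.mk (relB n k) (Quiv.mk (relK n k) (PathAlg.path (Coeff n) p)) =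
      kWeight p • B.f x y := by
  induction p with
  | nil => rw [kWeight, one_smul]; exact (B.f_self (n := n) (k := k) x).symm
  | @cons y z p e ih =>
    have h : PathAlg.path (Coeff n) (p.cons e) = PathAlg.path (Coeff n) p * kEdge y z :=
      (PathAlg.path_mul_path p (Quiver.Hom.toPath e)).symm
    rw [h, map_mul, map_mul, ih, kWeight, smul_mul_assoc, mul_smul]
    congr 1
    exact B.f_mul (n := n) (k := k) x y z

/-- Every element of `B(n,k)` is a linear combination of the elements `f_{x,y}`. -/
@[elab_as_elim]
lemma B.induction {P : B n k → Prop} (b : B n k) (zero : P 0)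
    (add : ∀ a b, P a → P b → P (a + b)) 
    (smul_f : ∀ (c : Coeff n) (x y : IState n k), P (c • B.f x y)) : P b := by
  obtain ⟨b, rfl⟩ := Quiv.mk_surjective _ b
  obtain ⟨b, rfl⟩ := Quiv.mk_surjective _ b
  induction b using PathAlg.induction with
  | zero => rw [map_zero, map_zero]; exact zero
  | add a b ha hb => rw [map_add, map_add]; exact add _ _ ha hb
  | path x y p c =>
    rw [Quiv.mk_smul, Quiv.mk_smul, B.mk_mk_path, smul_smul]
    exact smul_f _ _ _

/-- Every element of `B(n,k,S)` is a sum of generators. -/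
lemma BS.mem_closure_gen (t : BS k S) :
    t ∈ AddSubgroup.closure {b | ∃ (x y : IState n k) (r : Fin n → ℕ) (l : List S),
      l.Nodup ∧ b = gen x y r l} := by
  induction t using TensorProduct.induction_on with
  | zero => exact zero_mem _
  | add a b ha hb => exact add_mem ha hb
  | tmul b ω =>
    induction b using B.induction with
    | zero => rw [TensorProduct.zero_tmul]; exact zero_mem _
    | add a b ha hb => rw [TensorProduct.add_tmul]; exact add_mem ha hb
    | smul_f c x y =>
      have hω : ω ∈ Submodule.span (Coeff n) (Set.range (extBasis S)) := by
        rw [(extBasis S).span_eq]; exact Submodule.mem_top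
      induction hω using Submodule.span_induction generalizing c with
      | zero => rw [TensorProduct.tmul_zero]; exact zero_mem _
      | add a b _ _ ha hb => rw [TensorProduct.tmul_add]; exact add_mem (ha c) (hb c)
      | smul d a _ ha => rw [← TensorProduct.smul_tmul, smul_smul]; exact ha _
      | mem _ hε =>
        obtain ⟨ε, rfl⟩ := hε
        induction c using MvPolynomial.induction_on' with
        | add p q hp hq => rw [add_smul, TensorProduct.add_tmul]; exact add_mem hp hq
        | monomial u a =>
          have ha : a = 0 ∨ a = 1 := by revert a; decide
          rcases ha with rfl | rfl
          · rw [map_zero, zero_smul, TensorProduct.zero_tmul]; exact zero_mem _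
          · refine AddSubgroup.subset_closure ⟨x, y, u, ε.toList, ε.nodup_toList, ?_⟩
            rw [gen_eq, ← extBasis_toFinset ε.nodup_toList, Finset.toList_toFinset,
              umon_eq_monomial]
            simp

end Generators

/-! ### Degrees of paths and the map `F` -/

section Degrees

variable {n k : ℕ} {S : Finset (Fin n)} {W : Finset (IState n k)}

lemma genDeg_mul (x y z : IState n k) (r s : Fin n → ℕ) (l l' : List S) :
    genDeg x z (r + s + expo x y z) (l ++ l') = genDeg x y r l + genDeg y z s l' := by
  refine Prod.ext (funext fun i => ?_) (by simp [genDeg])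
  have h := two_mul_expo x y z i
  have h2 := relWeight_add x y z i
  simp only [abs_eq_max_neg] at h
  refine Prod.ext ?_ ?_ <;>
  · simp only [genDeg, Pi.add_apply, List.map_append, List.count_append, Prod.fst_add,
      Prod.snd_add]
    push_cast
    omega

lemma genDeg_inj {x y : IState n k} {r s : Fin n → ℕ} {l l' : List S} (h : l.Perm l')
    (hd : genDeg x y r l = genDeg x y s l') : r = s := by
  funext i
  have h1 := congrArg (fun d : MultiDeg n => (d.1 i).1) hd
  have h2 := (h.map Subtype.val).count_eq i
  simp only [genDeg] at h1
  omega

/-- The exterior variable carried by an arrow, as a list with at most one element. -/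
def arrowC {x y : GVert S W} : (x ⟶ y) → List S
  | ⟨Label.C i, h⟩ => [⟨i, h.1⟩]
  | _ => []

/-- The exterior variables along a path. -/
def pathC {x : GVert S W} : {y : GVert S W} → Quiver.Path x y → List S
  | _, .nil => []
  | _, .cons p e => pathC p ++ arrowC e

/-- The exponents of the monomial carried by an arrow: a loop `U_i` carries `U_i`. -/
def labelExp : Label n → Fin n → ℕ
  | Label.U i => Pi.single i 1
  | _ => 0

lemma isStep_of_isRStep {i : Fin n} {x y : IState n k} (h : IsRStep i x y) : IsStep i 1 x y :=
  (isRStep_iff _ _ _).1 h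

lemma isStep_of_isLStep {i : Fin n} {x y : IState n k} (h : IsLStep i x y) :
    IsStep i (-1) x y :=
  (isLStep_iff _ _ _).1 h

lemma genDeg_arrow {x y : GVert S W} (e : x ⟶ y) :
    genDeg x.state y.state (labelExp (arrowLabel e)) (arrowC e) = labelDeg (arrowLabel e) := by
  obtain ⟨ℓ, h⟩ := e
  cases ℓ with
  | R i =>
    have h' := isStep_of_isRStep h
    refine Prod.ext (funext fun j => ?_) rfl
    simp only [genDeg, arrowC, arrowLabel, labelExp, labelDeg, h'.relWeight_eq]
    by_cases hj : j = i
    · subst hj; simp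
    · simp [hj]
  | L i =>
    have h' := isStep_of_isLStep h
    refine Prod.ext (funext fun j => ?_) rfl
    simp only [genDeg, arrowC, arrowLabel, labelExp, labelDeg, h'.relWeight_eq]
    by_cases hj : j = i
    · subst hj; simp
    · simp [hj]
  | U i =>
    have h' : x.state = y.state := h
    refine Prod.ext (funext fun j => ?_) rfl
    simp only [genDeg, arrowC, arrowLabel, labelExp, labelDeg, h', relWeight_self]
    by_cases hj : j = i
    · subst hj; simp
    · simp [hj]
  | C i =>
    have h' : x.state = y.state := h.2
    refine Prod.ext (funext fun j => ?_) rfl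
    simp only [genDeg, arrowC, arrowLabel, labelExp, labelDeg, h', relWeight_self]
    by_cases hj : j = i
    · subst hj; simp
    · simp [hj, Ne.symm hj]

lemma genDeg_zero (x : IState n k) : genDeg x x 0 ([] : List S) = 0 := by
  refine Prod.ext (funext fun j => ?_) rfl
  simp [genDeg, relWeight_self]

lemma pathDeg_nil (x : GVert S W) : pathDeg (Quiver.Path.nil : Quiver.Path x x) = 0 := by
  simp [pathDeg, pathLabels]

lemma pathDeg_cons {x y z : GVert S W} (p : Quiver.Path x y) (e : y ⟶ z) :
    pathDeg (p.cons e) = pathDeg p + labelDeg (arrowLabel e) := by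
  simp [pathDeg, pathLabels]

/-- The exponents of the monomial in the image of a path under `F`. -/
def pathExp {x : GVert S W} : {y : GVert S W} → Quiver.Path x y → Fin n → ℕ
  | _, .nil => 0
  | z, .cons (b := y) p e =>
    pathExp p + labelExp (arrowLabel e) + expo x.state y.state z.state

lemma genDeg_pathExp {x y : GVert S W} (p : Quiver.Path x y) :
    genDeg x.state y.state (pathExp p) (pathC p) = pathDeg p := by
  induction p with
  | nil => rw [pathExp, pathC, genDeg_zero, pathDeg_nil]
  | cons p e ih => rw [pathExp, pathC, genDeg_mul, ih, genDeg_arrow, pathDeg_cons]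

lemma pathExp_eq {x y : GVert S W} {p : Quiver.Path x y} {r : Fin n → ℕ} {l : List S}
    (hl : l.Perm (pathC p)) (h : genDeg x.state y.state r l = pathDeg p) : pathExp p = r :=
  genDeg_inj hl.symm ((genDeg_pathExp p).trans h.symm)

lemma arrowF_eq_gen {x y : GVert S W} (e : x ⟶ y) :
    arrowF e = gen x.state y.state (labelExp (arrowLabel e)) (arrowC e) := by
  obtain ⟨ℓ, h⟩ := e
  cases ℓ with
  | R i =>
    rw [gen_eq]
    simp only [arrowC, arrowF, arrowLabel, labelExp, cprod, umon_zero, one_smul, List.map_nil,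
      List.prod_nil]
  | L i =>
    rw [gen_eq]
    simp only [arrowC, arrowF, arrowLabel, labelExp, cprod, umon_zero, one_smul, List.map_nil,
      List.prod_nil]
  | U i =>
    have h' : x.state = y.state := h
    rw [gen_eq]
    simp only [arrowC, arrowF, arrowLabel, labelExp, cprod, umon_single, ← h', B.f_self,
      List.map_nil, List.prod_nil]
  | C i =>
    have h' : x.state = y.state := h.2
    rw [gen_eq]
    simp only [arrowC, arrowF, arrowLabel, labelExp, cprod, umon_zero, one_smul, ← h', B.f_self,
      List.map_cons, List.map_nil, List.prod_cons, List.prod_nil, mul_one]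

/-- `F` sends a path to a generator. The exponents are determined by the degree of the path, since
`F` preserves degrees. -/
lemma pathF_eq_gen {x y : GVert S W} (p : Quiver.Path x y) :
    pathF p = gen x.state y.state (pathExp p) (pathC p) := by
  induction p with
  | nil =>
    rw [pathF, pathExp, pathC, gen_eq, umon_zero, one_smul, B.f_self, cprod, List.map_nil,
      List.prod_nil]
  | cons p e ih => rw [pathF, pathExp, pathC, ih, arrowF_eq_gen, gen_mul]

lemma pathF_eq_of_pathDeg_eq {x y : GVert S W} {p q : Quiver.Path x y}
    (hd : pathDeg p = pathDeg q) (hC : (pathC p).Perm (pathC q)) : pathF p = pathF q := by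
  rw [pathF_eq_gen, pathF_eq_gen, gen_perm _ _ _ hC,
    pathExp_eq hC.symm ((genDeg_pathExp q).trans hd.symm)]

lemma pathLabels_comp {x y z : GVert S W} (p : Quiver.Path x y) (q : Quiver.Path y z) :
    pathLabels (p.comp q) = pathLabels p ++ pathLabels q := by
  induction q with
  | nil => simp [pathLabels]
  | cons q e ih => rw [Quiver.Path.comp_cons, pathLabels, pathLabels, ih, List.append_assoc]

lemma pathF_comp {x y z : GVert S W} (p : Quiver.Path x y) (q : Quiver.Path y z) :
    pathF (p.comp q) = pathF p * pathF q := by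
  induction q with
  | nil =>
    have h : pathF (Quiver.Path.nil : Quiver.Path y y) = gen y.state y.state 0 [] :=
      pathF_eq_gen _
    rw [Quiver.Path.comp_nil, h, pathF_eq_gen p, gen_mul, expo_self_right, add_zero, add_zero,
      List.append_nil]
  | cons q e ih => rw [Quiver.Path.comp_cons, pathF, pathF, ih, mul_assoc]

lemma GVert.state_injective : Function.Injective (GVert.state : GVert S W → IState n k) :=
  Subtype.val_injective

lemma pathF_mul_ne {w x y z : GVert S W} (h : x ≠ y) (p : Quiver.Path w x)
    (q : Quiver.Path y z) : pathF p * pathF q = 0 := by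
  rw [pathF_eq_gen, pathF_eq_gen, gen_mul_ne (fun h' => h (GVert.state_injective h'))]

end Degrees

/-! ### Words of labels -/

section Words

variable {n k : ℕ} {S : Finset (Fin n)} {W : Finset (IState n k)}

/-- The labels `C_i` in a list of labels. -/
def cLabels (w : List (Label n)) : List (Fin n) :=
  w.flatMap fun
    | Label.C i => [i]
    | _ => []

lemma map_val_pathC {x y : GVert S W} (p : Quiver.Path x y) :
    (pathC p).map Subtype.val = cLabels (pathLabels p) := by
  induction p with
  | nil => rfl
  | cons p e ih =>
    rw [pathC, pathLabels, List.map_append, ih, cLabels, cLabels, List.flatMap_append]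
    congr 1
    obtain ⟨ℓ, h⟩ := e
    cases ℓ <;> rfl

lemma pathC_perm {x y u v : GVert S W} {p : Quiver.Path x y} {q : Quiver.Path u v}
    (h : (cLabels (pathLabels p)).Perm (cLabels (pathLabels q))) :
    (pathC p).Perm (pathC q) := by
  rw [← map_val_pathC, ← map_val_pathC] at h
  exact (List.map_perm_map_iff Subtype.val_injective).1 h

/-- The source and the label of an arrow determine its target. -/
lemma IsArrow.target_unique {x y z : IState n k} {ℓ : Label n} (h : IsArrow S x y ℓ)
    (h' : IsArrow S x z ℓ) : y = z := by
  cases ℓ with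
  | R i => exact (isStep_of_isRStep h).target_unique (isStep_of_isRStep h')
  | L i => exact (isStep_of_isLStep h).target_unique (isStep_of_isLStep h')
  | U i => exact Eq.trans (Eq.symm h) h'
  | C i => exact Eq.trans (Eq.symm h.2) h'.2

lemma eq_of_pathLabels_eq {x y y' : GVert S W} (p : Quiver.Path x y) (q : Quiver.Path x y')
    (h : pathLabels p = pathLabels q) : ∃ hy : y = y', hy ▸ p = q := by
  induction p generalizing y' with
  | nil =>
    cases q with
    | nil => exact ⟨rfl, rfl⟩
    | cons q e => simp [pathLabels] at h
  | cons p e ih =>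
    cases q with
    | nil => simp [pathLabels] at h
    | cons q e' =>
      rw [pathLabels, pathLabels] at h
      obtain ⟨h1, h2⟩ := List.append_inj' h rfl
      obtain ⟨rfl, rfl⟩ := ih q h1
      obtain ⟨ℓ, he⟩ := e
      obtain ⟨ℓ', he'⟩ := e'
      have h3 : ℓ = ℓ' := by simpa [arrowLabel] using h2
      subst h3
      obtain rfl := GVert.state_injective (he.target_unique he')
      exact ⟨rfl, rfl⟩

lemma pathLabels_injective (x y : GVert S W) :
    Function.Injective (pathLabels : Quiver.Path x y → List (Label n)) := fun p q h => by
  obtain ⟨_, h2⟩ := eq_of_pathLabels_eq p q h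
  exact h2

/-- The noncommutative monomial with the given labels. -/
def word (w : List (Label n)) : FreeAlgebra (ZMod 2) (Label n) :=
  (w.map (FreeAlgebra.ι (ZMod 2))).prod

/-- The coefficients of a noncommutative polynomial. -/
def wordCoeff : FreeAlgebra (ZMod 2) (Label n) →ₗ[ZMod 2] (List (Label n) →₀ ZMod 2) :=
  Finsupp.lmapDomain _ _ FreeMonoid.toList ∘ₗ
  (MonoidAlgebra.coeffLinearEquiv (ZMod 2)).toLinearMap ∘ₗ
  (FreeAlgebra.equivMonoidAlgebraFreeMonoid
    (R := ZMod 2) (X := Label n)).toLinearEquiv.toLinearMap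

lemma wordCoeff_word (w : List (Label n)) : wordCoeff (word w) = Finsupp.single w 1 := by
  have h : FreeAlgebra.equivMonoidAlgebraFreeMonoid (word w) =
      MonoidAlgebra.of (ZMod 2) (FreeMonoid (Label n)) (FreeMonoid.ofList w) := by
    induction w with
    | nil => simp [word]; rfl
    | cons ℓ w ih =>
      rw [FreeMonoid.ofList_cons, map_mul, ← ih, word, List.map_cons, List.prod_cons, map_mul]
      simp [FreeAlgebra.equivMonoidAlgebraFreeMonoid, word]
  simp [wordCoeff, h]

lemma wordCoeff_mu {x y : GVert S W} (a : Quiver.Path x y →₀ ZMod 2) :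
    wordCoeff (mu a) = a.mapDomain pathLabels := by
  rw [mu, Finsupp.sum, map_sum, Finsupp.mapDomain, Finsupp.sum]
  refine Finset.sum_congr rfl fun p _ => ?_
  have h := wordCoeff_word (pathLabels p)
  rw [word] at h
  rw [map_smul, h, Finsupp.smul_single, smul_eq_mul, mul_one]

lemma exists_of_mu_eq_word {x y : GVert S W} {a : Quiver.Path x y →₀ ZMod 2}
    {w : List (Label n)} (h : mu a = word w) :
    ∃ p : Quiver.Path x y, pathLabels p = w ∧ a = Finsupp.single p 1 := by
  have h1 := congrArg wordCoeff h
  rw [wordCoeff_mu, wordCoeff_word] at h1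
  have hw : w ∈ Set.range (pathLabels : Quiver.Path x y → List (Label n)) := by
    by_contra hw
    have h2 := Finsupp.mapDomain_of_notMem_range a w hw
    rw [h1, Finsupp.single_eq_same] at h2
    exact one_ne_zero h2
  obtain ⟨p, rfl⟩ := hw
  refine ⟨p, rfl, Finsupp.mapDomain_injective (pathLabels_injective x y) ?_⟩
  rw [h1, Finsupp.mapDomain_single]

lemma exists_of_mu_eq_word_add {x y : GVert S W} {a : Quiver.Path x y →₀ ZMod 2}
    {w w' : List (Label n)} (h : mu a = word w + word w') :
    a = 0 ∨ ∃ p q : Quiver.Path x y, pathLabels p = w ∧ pathLabels q = w' ∧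
      a = Finsupp.single p 1 + Finsupp.single q 1 := by
  have h1 := congrArg wordCoeff h
  rw [map_add, wordCoeff_mu, wordCoeff_word, wordCoeff_word] at h1
  by_cases hww : w = w'
  · left
    subst hww
    have h2 : (1 : ZMod 2) + 1 = 0 := rfl
    rw [← Finsupp.single_add, h2, Finsupp.single_zero] at h1
    exact Finsupp.mapDomain_injective (pathLabels_injective x y)
      (h1.trans Finsupp.mapDomain_zero.symm)
  · right
    have hw : w ∈ Set.range (pathLabels : Quiver.Path x y → List (Label n)) := by
      by_contra hw
      have h2 := Finsupp.mapDomain_of_notMem_range a w hw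
      rw [h1, Finsupp.add_apply, Finsupp.single_eq_same, Finsupp.single_eq_of_ne hww,
        add_zero] at h2
      exact one_ne_zero h2
    have hw' : w' ∈ Set.range (pathLabels : Quiver.Path x y → List (Label n)) := by
      by_contra hw
      have h2 := Finsupp.mapDomain_of_notMem_range a w' hw
      rw [h1, Finsupp.add_apply, Finsupp.single_eq_same, Finsupp.single_eq_of_ne (Ne.symm hww),
        zero_add] at h2
      exact one_ne_zero h2
    obtain ⟨p, rfl⟩ := hw
    obtain ⟨q, rfl⟩ := hw'
    refine ⟨p, q, rfl, rfl, Finsupp.mapDomain_injective (pathLabels_injective x y) ?_⟩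
    rw [h1, Finsupp.mapDomain_add, Finsupp.mapDomain_single, Finsupp.mapDomain_single]

lemma freeAlgebra_sub_eq_add (a b : FreeAlgebra (ZMod 2) (Label n)) : a - b = a + b := by
  have h2 : (2 : ZMod 2) = 0 := rfl
  have h : b + b = 0 := by rw [← two_smul (ZMod 2) b, h2, zero_smul]
  rw [sub_eq_add_neg, neg_eq_of_add_eq_zero_left h]

open Label in
/-- A relation word is either a sum of two monomials of the same degree with the same exterior
variables, or one of the monomials `R_i R_{i+1}`, `L_{i+1} L_i`, `C_i ^ 2`. -/
lemma IsRelWord.cases {u : FreeAlgebra (ZMod 2) (Label n)} (h : IsRelWord S u) :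
    (∃ w w', u = word w + word w' ∧ (w.map labelDeg).sum = (w'.map labelDeg).sum ∧
      (cLabels w).Perm (cLabels w')) ∨
    ∃ w, u = word w ∧ ((∃ i j : Fin n, (j : ℕ) = i + 1 ∧ (w = [R i, R j] ∨ w = [L j, L i])) ∨
      ∃ i, w = [C i, C i]) := by
  have key : ∀ A B : Label n, (cLabels [A, B]).Perm (cLabels [B, A]) →
      ∃ w w', lab A * lab B + lab B * lab A = word w + word w' ∧
        (w.map labelDeg).sum = (w'.map labelDeg).sum ∧ (cLabels w).Perm (cLabels w') :=
    fun A B hAB => ⟨[A, B], [B, A], by simp [word, lab], by simp [add_comm], hAB⟩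
  have hU : ∀ i : Fin n, (Pi.single i (1, 0) + Pi.single i (0, 1) : Fin n → ℤ × ℤ) =
      Pi.single i (1, 1) := fun i => by rw [← Pi.single_add]; rfl
  have hU' : ∀ i : Fin n, (Pi.single i (0, 1) + Pi.single i (1, 0) : Fin n → ℤ × ℤ) =
      Pi.single i (1, 1) := fun i => by rw [← Pi.single_add]; rfl
  cases h with
  | RU i j => rw [freeAlgebra_sub_eq_add]; exact Or.inl (key _ _ (by simp [cLabels]))
  | LU i j => rw [freeAlgebra_sub_eq_add]; exact Or.inl (key _ _ (by simp [cLabels]))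
  | UU i j => rw [freeAlgebra_sub_eq_add]; exact Or.inl (key _ _ (by simp [cLabels]))
  | RL i =>
    rw [freeAlgebra_sub_eq_add]
    exact Or.inl ⟨[R i, L i], [U i], by simp [word, lab], by simp [labelDeg, hU],
      by simp [cLabels]⟩
  | LR i =>
    rw [freeAlgebra_sub_eq_add]
    exact Or.inl ⟨[L i, R i], [U i], by simp [word, lab], by simp [labelDeg, hU'],
      by simp [cLabels]⟩
  | distRR i j _ => rw [freeAlgebra_sub_eq_add]; exact Or.inl (key _ _ (by simp [cLabels]))
  | distLL i j _ => rw [freeAlgebra_sub_eq_add]; exact Or.inl (key _ _ (by simp [cLabels]))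
  | distRL i j _ => rw [freeAlgebra_sub_eq_add]; exact Or.inl (key _ _ (by simp [cLabels]))
  | twoR i j hij => exact Or.inr ⟨[R i, R j], by simp [word, lab], Or.inl ⟨i, j, hij, Or.inl rfl⟩⟩
  | twoL i j hij => exact Or.inr ⟨[L j, L i], by simp [word, lab], Or.inl ⟨i, j, hij, Or.inr rfl⟩⟩
  | CC i _ => exact Or.inr ⟨[C i, C i], by simp [word, lab], Or.inr ⟨i, rfl⟩⟩
  | CR i j _ => exact Or.inl (key _ _ (by simp [cLabels]))
  | CL i j _ => exact Or.inl (key _ _ (by simp [cLabels]))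
  | CU i j _ => exact Or.inl (key _ _ (by simp [cLabels]))
  | CCcomm i j _ _ => exact Or.inl (key _ _ (List.Perm.swap _ _ _))

/-- A path with two labels passes through one intermediate vertex. -/
lemma exists_of_pathLabels_eq_pair {x y : GVert S W} {p : Quiver.Path x y} {A A' : Label n}
    (h : pathLabels p = [A, A']) :
    ∃ c : GVert S W, IsArrow S x.state c.state A ∧ IsArrow S c.state y.state A' := by
  cases p with
  | nil => simp [pathLabels] at h
  | cons p e =>
    cases p with
    | nil => simp [pathLabels] at h
    | @cons c d p e' =>
      cases p with
      | nil =>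
        simp only [pathLabels, arrowLabel, List.nil_append, List.cons_append, List.cons.injEq,
          and_true] at h
        exact ⟨_, h.1 ▸ e'.2, h.2 ▸ e.2⟩
      | cons p e'' =>
        have := congrArg List.length h
        simp [pathLabels] at this

lemma pathDeg_eq_sum {x y : GVert S W} (p : Quiver.Path x y) :
    pathDeg p = ((pathLabels p).map labelDeg).sum := rfl

lemma pathF_eq_zero_of_pair {x y : GVert S W} {p : Quiver.Path x y} {i j : Fin n}
    (hij : (j : ℕ) = i + 1)
    (h : pathLabels p = [Label.R i, Label.R j] ∨ pathLabels p = [Label.L j, Label.L i]) :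
    pathF p = 0 := by
  have hne : i ≠ j := fun h => by rw [h] at hij; omega
  rw [pathF_eq_gen]
  apply gen_eq_zero_of_bad
  rcases h with h | h
  · obtain ⟨c, h1, h2⟩ := exists_of_pathLabels_eq_pair h
    refine (ZeroRel.R i j _ _ _ hij (isStep_of_isRStep h1) (isStep_of_isRStep h2)).bad.le
      fun l => ?_
    rw [← relWeight_add _ c.state, (isStep_of_isRStep h1).relWeight_eq,
      (isStep_of_isRStep h2).relWeight_eq]
    by_cases hi : l = i
    · subst hi; simp [hne]
    · by_cases hj : l = j
      · subst hj; simp [hi]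
      · simp [hi, hj]
  · obtain ⟨c, h1, h2⟩ := exists_of_pathLabels_eq_pair h
    refine (ZeroRel.L i j _ _ _ hij (isStep_of_isLStep h1) (isStep_of_isLStep h2)).bad.le
      fun l => ?_
    rw [← relWeight_add _ c.state, (isStep_of_isLStep h1).relWeight_eq,
      (isStep_of_isLStep h2).relWeight_eq]
    by_cases hi : l = i
    · subst hi; simp [hne]
    · by_cases hj : l = j
      · subst hj; simp [hi]
      · simp [hi, hj]

lemma add_self_BS (b : BS k S) : b + b = 0 := add_self_eq_zero' n b

/-- `F` kills the relations given by words. -/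
lemma sum_pathF_eq_zero {x y : GVert S W} {a : Quiver.Path x y →₀ ZMod 2}
    (h : IsRelWord S (mu a)) :
    (a.sum fun p c => (MvPolynomial.C c : Coeff n) • pathF p) = 0 := by
  have hsingle : ∀ p : Quiver.Path x y, ((Finsupp.single p (1 : ZMod 2)).sum fun p c =>
      (MvPolynomial.C c : Coeff n) • pathF p) = pathF p := fun p => by
    rw [Finsupp.sum_single_index (by simp), map_one, one_smul]
  rcases h.cases with ⟨w, w', hw, hd, hC⟩ | ⟨w, hw, hcase⟩
  · rcases exists_of_mu_eq_word_add hw with rfl | ⟨p, q, rfl, rfl, rfl⟩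
    · simp
    · rw [Finsupp.sum_add_index' (by simp) (by simp [add_smul]), hsingle, hsingle,
        pathF_eq_of_pathDeg_eq hd (pathC_perm hC), add_self_BS]
  · obtain ⟨p, hp, rfl⟩ := exists_of_mu_eq_word hw
    rw [hsingle]
    rcases hcase with ⟨i, j, hij, h1⟩ | ⟨i, rfl⟩
    · exact pathF_eq_zero_of_pair hij (hp ▸ h1)
    · rw [pathF_eq_gen]
      refine gen_eq_zero_of_not_nodup _ _ _ fun h1 => ?_
      have h2 := h1.map Subtype.val_injective
      rw [map_val_pathC, hp] at h2
      simp [cLabels] at h2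

/-- `F` kills the loops `U_i` at vertices that do not meet the two regions next to line `i`. -/
lemma sum_pathF_eq_zero_of_U {x : GVert S W} {i : Fin n} {a : Quiver.Path x x →₀ ZMod 2}
    (h₁ : i.castSucc ∉ x.state.1) (h₂ : i.succ ∉ x.state.1) (h : mu a = lab (Label.U i)) :
    (a.sum fun p c => (MvPolynomial.C c : Coeff n) • pathF p) = 0 := by
  have hw : mu a = word [Label.U i] := by rw [h]; simp [word, lab]
  obtain ⟨p, hp, rfl⟩ := exists_of_mu_eq_word hw
  have hC : ([] : List S).Perm (pathC p) := by
    have h2 := map_val_pathC p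
    rw [hp] at h2
    rw [List.map_eq_nil_iff.1 h2]
  have hr : pathExp p = Pi.single i 1 := by
    refine pathExp_eq hC (Prod.ext (funext fun j => ?_) ?_)
    · rw [pathDeg_eq_sum, hp]
      by_cases hj : j = i
      · subst hj; simp [genDeg, relWeight_self, labelDeg]
      · simp [genDeg, relWeight_self, labelDeg, hj]
    · rw [pathDeg_eq_sum, hp]; simp [genDeg, labelDeg]
  rw [Finsupp.sum_single_index (by simp), map_one, one_smul, pathF_eq_gen, hr]
  refine gen_eq_zero_of_bad _ ((ZeroRel.U i x.state h₁ h₂).bad.le fun j => ?_)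
  by_cases hj : j = i
  · subst hj; simp
  · simp [hj]

end Words

/-! ### Relations of the full subquivers -/

section Inclusion

variable {n k : ℕ} {S : Finset (Fin n)} {W : Finset (IState n k)}

lemma pathLabels_mapPath {x y : GVert S W} (p : Quiver.Path x y) :
    pathLabels ((inclQuiver S W).mapPath p) = pathLabels p := by
  induction p with
  | nil => rfl
  | cons p e ih => rw [Prefunctor.mapPath_cons, pathLabels, pathLabels, ih]; rfl

lemma mu_mapPath {x y : GVert S W} (a : Quiver.Path x y →₀ ZMod 2) :
    mu (a.mapDomain (inclQuiver S W).mapPath) = mu a := by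
  rw [mu, Finsupp.sum_mapDomain_index (by simp) (by simp [add_smul]), mu]
  simp only [pathLabels_mapPath]

lemma incl_single (x y : GVert S W) (a : Quiver.Path x y →₀ ZMod 2) :
    incl S W (PathAlg.single (ZMod 2) x y a) =
      PathAlg.single (ZMod 2) ((inclQuiver S W).obj x) ((inclQuiver S W).obj y)
        (a.mapDomain (inclQuiver S W).mapPath) := by
  rw [incl, Finset.sum_eq_single x, Finset.sum_eq_single y]
  · rw [PathAlg.single_apply_same]
  · intro v _ hv
    rw [PathAlg.single_apply_ne (fun h => hv h.2.symm), Finsupp.mapDomain_zero,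
      PathAlg.single_zero]
  · simp
  · intro u _ hu
    refine Finset.sum_eq_zero fun v _ => ?_
    rw [PathAlg.single_apply_ne (fun h => hu h.1.symm), Finsupp.mapDomain_zero,
      PathAlg.single_zero]
  · simp

lemma single_mem_relSub {x y : GVert S W} {a : Quiver.Path x y →₀ ZMod 2}
    (h : IsRelWord S (mu a)) : PathAlg.single (ZMod 2) x y a ∈ relSub S W :=
  Or.inl ⟨_, _, _, (mu_mapPath a).symm ▸ h, incl_single x y a⟩

lemma single_mem_relSub_of_U {x : GVert S W} {a : Quiver.Path x x →₀ ZMod 2} {i : Fin n}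
    (h₁ : i.castSucc ∉ x.state.1) (h₂ : i.succ ∉ x.state.1) (h : mu a = lab (Label.U i)) :
    PathAlg.single (ZMod 2) x x a ∈ relSub S W :=
  Or.inr ⟨_, i, _, h₁, h₂, (mu_mapPath a).trans h, incl_single x x a⟩

end Inclusion

/-! ### Central elements of the quiver algebra -/

section QuiverAlgebra

variable {n k : ℕ} {S : Finset (Fin n)} {W : Finset (IState n k)} (R : Set (PathG S W))

/-- The class of a path in a quotient of the path algebra. -/
def cls {x y : GVert S W} (p : Quiver.Path x y) : Quiv R := Quiv.mk R (PathAlg.path (ZMod 2) p)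

lemma cls_comp {x y z : GVert S W} (p : Quiver.Path x y) (q : Quiver.Path y z) :
    cls R (p.comp q) = cls R p * cls R q := by
  rw [cls, cls, cls, ← map_mul, PathAlg.path_mul_path]

lemma cls_mul_ne {w x y z : GVert S W} (h : x ≠ y) (p : Quiver.Path w x)
    (q : Quiver.Path y z) : cls R p * cls R q = 0 := by
  rw [cls, cls, ← map_mul, PathAlg.path_mul_path_ne h, map_zero]

/-- The class of an arrow. -/
abbrev cl {x y : GVert S W} (e : x ⟶ y) : Quiv R := cls R e.toPath

lemma cls_cons {x y z : GVert S W} (p : Quiver.Path x y) (e : y ⟶ z) :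
    cls R (p.cons e) = cls R p * cl R e := cls_comp R p e.toPath

lemma cls_nil_mul {x y : GVert S W} (p : Quiver.Path x y) :
    cls R (Quiver.Path.nil : Quiver.Path x x) * cls R p = cls R p := by
  rw [← cls_comp, Quiver.Path.nil_comp]

lemma cls_mul_nil {x y : GVert S W} (p : Quiver.Path x y) :
    cls R p * cls R (Quiver.Path.nil : Quiver.Path y y) = cls R p := by
  rw [← cls_comp, Quiver.Path.comp_nil]

/-- The quotient of the path algebra is spanned by the classes of paths. -/
lemma Quiv.induction_cls {P : Quiv R → Prop} (q : Quiv R) (zero : P 0)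
    (add : ∀ a b, P a → P b → P (a + b))
    (cls : ∀ (x y : GVert S W) (p : Quiver.Path x y), P (cls R p)) : P q := by
  obtain ⟨a, rfl⟩ := Quiv.mk_surjective _ q
  induction a using PathAlg.induction with
  | zero => rw [map_zero]; exact zero
  | add a b ha hb => rw [map_add]; exact add _ _ ha hb
  | path x y p c =>
    have hc : c = 0 ∨ c = 1 := by revert c; decide
    rcases hc with rfl | rfl
    · rw [zero_smul, map_zero]; exact zero
    · rw [one_smul]; exact cls x y p

lemma Quiv.add_self (q : Quiv R) : q + q = 0 := by
  have h2 : (2 : ZMod 2) = 0 := rfl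
  rw [← two_smul (ZMod 2) q, h2, zero_smul]

variable {R}

lemma mu_single {x y : GVert S W} (p : Quiver.Path x y) :
    mu (Finsupp.single p 1) = word (pathLabels p) := by
  rw [mu, Finsupp.sum_single_index (by simp), one_smul]; rfl

lemma cls_eq_of_isRelWord (hR : relSub S W ⊆ R) {x y : GVert S W} {p q : Quiver.Path x y}
    (h : IsRelWord S (word (pathLabels p) + word (pathLabels q))) : cls R p = cls R q := by
  have h2 : mu (Finsupp.single p 1 + Finsupp.single q 1) =
      word (pathLabels p) + word (pathLabels q) := by
    rw [← mu_single, ← mu_single, mu, Finsupp.sum_add_index' (by simp) (by simp [add_smul])]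
    rfl
  rw [← h2] at h
  have h3 := Quiv.mk_eq_zero (hR (single_mem_relSub h))
  rw [PathAlg.single_add, map_add] at h3
  have h4 : cls R p + cls R q = cls R q + cls R q := h3.trans (Quiv.add_self R _).symm
  exact add_right_cancel h4

lemma cls_eq_zero_of_isRelWord (hR : relSub S W ⊆ R) {x y : GVert S W} {p : Quiver.Path x y}
    (h : IsRelWord S (word (pathLabels p))) : cls R p = 0 := by
  rw [← mu_single] at h
  exact Quiv.mk_eq_zero (hR (single_mem_relSub h))

lemma cl_mul_cl_eq (hR : relSub S W ⊆ R) {x y y' z : GVert S W} {e₁ : x ⟶ y} {e₂ : y ⟶ z} {e₁' : x ⟶ y'}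
    {e₂' : y' ⟶ z} (h : IsRelWord S (lab (arrowLabel e₁) * lab (arrowLabel e₂) +
      lab (arrowLabel e₁') * lab (arrowLabel e₂'))) :
    cl R e₁ * cl R e₂ = cl R e₁' * cl R e₂' := by
  rw [← cls_comp, ← cls_comp]
  apply cls_eq_of_isRelWord hR
  simpa [pathLabels, word, lab, Quiver.Hom.toPath] using h

lemma cl_mul_cl_eq_cl (hR : relSub S W ⊆ R) {x y z : GVert S W} {e₁ : x ⟶ y} {e₂ : y ⟶ z} {e : x ⟶ z}
    (h : IsRelWord S (lab (arrowLabel e₁) * lab (arrowLabel e₂) + lab (arrowLabel e))) :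
    cl R e₁ * cl R e₂ = cl R e := by
  rw [← cls_comp]
  apply cls_eq_of_isRelWord hR
  simpa [pathLabels, word, lab, Quiver.Hom.toPath] using h

lemma cl_mul_cl_eq_zero (hR : relSub S W ⊆ R) {x y z : GVert S W} {e₁ : x ⟶ y} {e₂ : y ⟶ z}
    (h : IsRelWord S (lab (arrowLabel e₁) * lab (arrowLabel e₂))) :
    cl R e₁ * cl R e₂ = 0 := by
  rw [← cls_comp]
  apply cls_eq_zero_of_isRelWord hR
  simpa [pathLabels, word, lab, Quiver.Hom.toPath] using h

/-- The loop `U_i` at a vertex. -/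
def uLoop (i : Fin n) (x : GVert S W) : x ⟶ x := ⟨Label.U i, rfl⟩

/-- The loop `C_i` at a vertex. -/
def cLoop (i : S) (x : GVert S W) : x ⟶ x := ⟨Label.C i, i.2, rfl⟩

lemma cl_uLoop_eq_zero (hR : relSub S W ⊆ R) {i : Fin n} {x : GVert S W} (h₁ : i.castSucc ∉ x.state.1)
    (h₂ : i.succ ∉ x.state.1) : cl R (uLoop i x) = 0 := by
  refine Quiv.mk_eq_zero (hR (single_mem_relSub_of_U (i := i) h₁ h₂ ?_))
  rw [mu_single]
  simp [pathLabels, word, lab, Quiver.Hom.toPath, uLoop, arrowLabel]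

variable (R) in
/-- The sum of one loop at each vertex. -/
def loopSum (e : ∀ x : GVert S W, x ⟶ x) : Quiv R := ∑ x, cl R (e x)

lemma loopSum_mul_cls (e : ∀ x : GVert S W, x ⟶ x) {x y : GVert S W} (p : Quiver.Path x y) :
    loopSum R e * cls R p = cl R (e x) * cls R p := by
  rw [loopSum, Finset.sum_mul, Finset.sum_eq_single x]
  · intro v _ hv; exact cls_mul_ne R hv _ _
  · simp

lemma cls_mul_loopSum (e : ∀ x : GVert S W, x ⟶ x) {x y : GVert S W} (p : Quiver.Path x y) :
    cls R p * loopSum R e = cls R p * cl R (e y) := by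
  rw [loopSum, Finset.mul_sum, Finset.sum_eq_single y]
  · intro v _ hv; exact cls_mul_ne R hv.symm _ _
  · simp

lemma loopSum_mem_center (e : ∀ x : GVert S W, x ⟶ x)
    (h : ∀ (x y : GVert S W) (e' : x ⟶ y), cl R (e x) * cl R e' = cl R e' * cl R (e y)) :
    loopSum R e ∈ Subring.center (Quiv R) := by
  rw [Subring.mem_center_iff]
  intro q
  induction q using Quiv.induction_cls with
  | zero => rw [zero_mul, mul_zero]
  | add a b ha hb => rw [add_mul, mul_add, ha, hb]
  | cls x y p =>
    rw [loopSum_mul_cls, cls_mul_loopSum]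
    induction p with
    | nil => rw [cls_nil_mul, cls_mul_nil]
    | cons p e' ih => rw [cls_cons, mul_assoc, ← h, ← mul_assoc, ih, mul_assoc]

open Label in
lemma cl_uLoop_comm (hR : relSub S W ⊆ R) (i : Fin n) (x y : GVert S W) (e : x ⟶ y) :
    cl R (uLoop i x) * cl R e = cl R e * cl R (uLoop i y) := by
  obtain ⟨ℓ, h⟩ := e
  cases ℓ with
  | R j =>
    refine (cl_mul_cl_eq hR ?_).symm
    have := IsRelWord.RU (S := S) j i
    rwa [freeAlgebra_sub_eq_add] at this
  | L j =>
    refine (cl_mul_cl_eq hR ?_).symm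
    have := IsRelWord.LU (S := S) j i
    rwa [freeAlgebra_sub_eq_add] at this
  | U j =>
    refine (cl_mul_cl_eq hR ?_).symm
    have := IsRelWord.UU (S := S) j i
    rwa [freeAlgebra_sub_eq_add] at this
  | C j => exact (cl_mul_cl_eq hR (by exact IsRelWord.CU j i h.1)).symm

open Label in
lemma cl_cLoop_comm (hR : relSub S W ⊆ R) (i : S) (x y : GVert S W) (e : x ⟶ y) :
    cl R (cLoop i x) * cl R e = cl R e * cl R (cLoop i y) := by
  obtain ⟨ℓ, h⟩ := e
  cases ℓ with
  | R j => exact cl_mul_cl_eq hR (IsRelWord.CR i j i.2)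
  | L j => exact cl_mul_cl_eq hR (IsRelWord.CL i j i.2)
  | U j => exact cl_mul_cl_eq hR (IsRelWord.CU i j i.2)
  | C j => exact cl_mul_cl_eq hR (by exact IsRelWord.CCcomm i j i.2 h.1)

variable (hR : relSub S W ⊆ R)

/-- The central element `U_i` of the quiver algebra. -/
def quivU (i : Fin n) : Subring.center (Quiv R) :=
  ⟨loopSum R (uLoop i), loopSum_mem_center _ (cl_uLoop_comm hR i)⟩

/-- The element `C_i` of the quiver algebra. It is central since the characteristic is two. -/
def quivC (i : S) : Subring.center (Quiv R) :=
  ⟨loopSum R (cLoop i), loopSum_mem_center _ (cl_cLoop_comm hR i)⟩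

lemma quivC_mul_self (i : S) : quivC hR i * quivC hR i = 0 := by
  refine Subtype.ext ?_
  show loopSum R (cLoop i) * loopSum R (cLoop i) = 0
  nth_rewrite 2 [loopSum]
  rw [Finset.mul_sum]
  refine Finset.sum_eq_zero fun x _ => ?_
  rw [loopSum_mul_cls]
  exact cl_mul_cl_eq_zero hR (by exact IsRelWord.CC (i : Fin n) i.2)

/-- The central element `U_1 ^ r_1 ⋯ U_n ^ r_n C_{i_1} ⋯ C_{i_l}` of the quiver algebra. -/
def centralMon (r : Fin n → ℕ) (l : List S) : Subring.center (Quiv R) :=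
  (∏ i, quivU hR i ^ r i) * (l.map (quivC hR)).prod

lemma centralMon_mul (r s : Fin n → ℕ) (l l' : List S) :
    centralMon hR r l * centralMon hR s l' = centralMon hR (r + s) (l ++ l') := by
  simp only [centralMon, Pi.add_apply, pow_add, Finset.prod_mul_distrib, List.map_append,
    List.prod_append]
  ring

lemma centralMon_perm (r : Fin n → ℕ) {l l' : List S} (h : l.Perm l') :
    centralMon hR r l = centralMon hR r l' := by
  rw [centralMon, (h.map _).prod_eq, centralMon]

lemma centralMon_eq_zero_of_not_nodup (r : Fin n → ℕ) {l : List S} (h : ¬l.Nodup) :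
    centralMon hR r l = 0 := by
  rw [List.nodup_iff_count_le_one] at h
  push Not at h
  obtain ⟨i, hi⟩ := h
  have h1 : i ∈ l := List.count_pos_iff.1 (by omega)
  have h2 : i ∈ l.erase i := List.count_pos_iff.1 (by rw [List.count_erase_self]; omega)
  rw [centralMon_perm hR r ((List.perm_cons_erase h1).trans ((List.perm_cons_erase h2).cons i)),
    centralMon, List.map_cons, List.map_cons, List.prod_cons, List.prod_cons,
    ← mul_assoc (quivC hR i), quivC_mul_self, zero_mul, mul_zero]

lemma centralMon_zero : centralMon hR 0 [] = 1 := by simp [centralMon]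

lemma centralMon_single (i : Fin n) : centralMon hR (Pi.single i 1) [] = quivU hR i := by
  rw [centralMon, Finset.prod_eq_single i]
  · simp
  · intro j _ hj; simp [Pi.single_eq_of_ne hj]
  · simp

/-- Multiplication of elements of the quiver algebra by the monomial `U^r C_{i_1} ⋯ C_{i_l}`. -/
def monSmul (r : Fin n → ℕ) (l : List S) (q : Quiv R) : Quiv R :=
  (centralMon hR r l : Quiv R) * q

lemma monSmul_monSmul (r s : Fin n → ℕ) (l l' : List S) (q : Quiv R) :
    monSmul hR r l (monSmul hR s l' q) = monSmul hR (r + s) (l ++ l') q := by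
  rw [monSmul, monSmul, monSmul, ← mul_assoc, ← Subring.coe_mul, centralMon_mul]

lemma monSmul_mul (r : Fin n → ℕ) (l : List S) (q q' : Quiv R) :
    monSmul hR r l q * q' = monSmul hR r l (q * q') := mul_assoc _ _ _

lemma mul_monSmul (r : Fin n → ℕ) (l : List S) (q q' : Quiv R) :
    q * monSmul hR r l q' = monSmul hR r l (q * q') := by
  rw [monSmul, monSmul, ← mul_assoc, ← mul_assoc,
    Subring.mem_center_iff.1 (centralMon hR r l).2 q]

lemma monSmul_zero_nil (q : Quiv R) : monSmul hR 0 [] q = q := by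
  rw [monSmul, centralMon_zero, Subring.coe_one, one_mul]

lemma monSmul_zero (r : Fin n → ℕ) (l : List S) : monSmul hR r l (0 : Quiv R) = 0 := mul_zero _

lemma cl_uLoop (i : Fin n) (x : GVert S W) :
    cl R (uLoop i x) = monSmul hR (Pi.single i 1) [] (cls R (Quiver.Path.nil : Quiver.Path x x)) := by
  rw [monSmul, centralMon_single]
  exact ((loopSum_mul_cls _ _).trans (cls_mul_nil R _)).symm

lemma cl_cLoop (i : S) (x : GVert S W) :
    cl R (cLoop i x) = monSmul hR 0 [i] (cls R (Quiver.Path.nil : Quiver.Path x x)) := by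
  have : centralMon hR 0 [i] = quivC hR i := by simp [centralMon]
  rw [monSmul, this]
  exact ((loopSum_mul_cls _ _).trans (cls_mul_nil R _)).symm

end QuiverAlgebra

/-! ### Geodesics and normal forms -/

section Geodesics

variable {n k : ℕ} {S : Finset (Fin n)} {W : Finset (IState n k)}

/-- An I-state in `W`, as a vertex of the full subquiver on `W`. -/
def GVert.of (x : IState n k) (hx : x ∈ W) : GVert S W := ⟨x, hx⟩

/-- The arrow is labelled `R_i` and `σ = 1`, or it is labelled `L_i` and `σ = -1`. -/
def IsStepArrow {x y : GVert S W} (e : x ⟶ y) (i : Fin n) (σ : ℤ) : Prop :=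
  (σ = 1 ∧ arrowLabel e = Label.R i) ∨ (σ = -1 ∧ arrowLabel e = Label.L i)

lemma IsStepArrow.sign {x y : GVert S W} {e : x ⟶ y} {i : Fin n} {σ : ℤ}
    (h : IsStepArrow e i σ) : σ = 1 ∨ σ = -1 := h.imp And.left And.left

lemma IsStepArrow.isStep {x y : GVert S W} {e : x ⟶ y} {i : Fin n} {σ : ℤ}
    (h : IsStepArrow e i σ) : IsStep i σ x.state y.state := by
  have he : IsArrow S x.state y.state (arrowLabel e) := e.2
  rcases h with ⟨rfl, h⟩ | ⟨rfl, h⟩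
  · rw [h] at he; exact isStep_of_isRStep he
  · rw [h] at he; exact isStep_of_isLStep he

lemma IsStepArrow.unique {x y : GVert S W} {e e' : x ⟶ y} {i : Fin n} {σ : ℤ}
    (h : IsStepArrow e i σ) (h' : IsStepArrow e' i σ) : e = e' := by
  refine Subtype.ext ?_
  show arrowLabel e = arrowLabel e'
  rcases h with ⟨rfl, h⟩ | ⟨rfl, h⟩ <;> rcases h' with ⟨h2, h'⟩ | ⟨h2, h'⟩
  · rw [h, h']
  · omega
  · omega
  · rw [h, h']

lemma exists_isStepArrow {x y : GVert S W} {i : Fin n} {σ : ℤ} (hσ : σ = 1 ∨ σ = -1)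
    (h : IsStep i σ x.state y.state) : ∃ e : x ⟶ y, IsStepArrow e i σ := by
  rcases hσ with rfl | rfl
  · exact ⟨⟨Label.R i, (isRStep_iff _ _ _).2 h⟩, Or.inl ⟨rfl, rfl⟩⟩
  · exact ⟨⟨Label.L i, (isLStep_iff _ _ _).2 h⟩, Or.inr ⟨rfl, rfl⟩⟩

lemma IsStepArrow.arrowC_eq {x y : GVert S W} {e : x ⟶ y} {i : Fin n} {σ : ℤ}
    (h : IsStepArrow e i σ) : arrowC e = [] := by
  obtain ⟨ℓ, he⟩ := e
  rcases h with ⟨-, rfl⟩ | ⟨-, rfl⟩ <;> rfl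

lemma IsStepArrow.labelExp_eq {x y : GVert S W} {e : x ⟶ y} {i : Fin n} {σ : ℤ}
    (h : IsStepArrow e i σ) : labelExp (arrowLabel e) = 0 := by
  rcases h with ⟨-, h⟩ | ⟨-, h⟩ <;> rw [h] <;> rfl

/-- A path without loops that never crosses a line back. -/
inductive IsGeodesic {x : GVert S W} : {y : GVert S W} → Quiver.Path x y → Prop
  | nil : IsGeodesic (Quiver.Path.nil : Quiver.Path x x)
  | cons {y z : GVert S W} (p : Quiver.Path x y) (e : y ⟶ z) (i : Fin n) (σ : ℤ)
      (he : IsStepArrow e i σ) (hpos : 0 < σ * relWeight x.state z.state i)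
      (hp : IsGeodesic p) : IsGeodesic (p.cons e)

/-- The total number of crossings needed to get from one state to another. -/
def dist (x y : IState n k) : ℕ := ∑ i, (relWeight x y i).natAbs

lemma IsStep.relWeight_left {x y z : IState n k} {i : Fin n} {σ : ℤ} (h : IsStep i σ y z)
    (j : Fin n) : relWeight x z j = relWeight x y j + if j = i then σ else 0 := by
  rw [← relWeight_add x y z, h.relWeight_eq]

lemma IsStep.dist_lt {x y z : IState n k} {i : Fin n} {σ : ℤ} (hσ : σ = 1 ∨ σ = -1)
    (h : IsStep i σ y z) (hpos : 0 < σ * relWeight x z i) : dist x y < dist x z := by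
  have hi := h.relWeight_left (x := x) i
  rw [if_pos rfl] at hi
  refine Finset.sum_lt_sum (fun j _ => ?_) ⟨i, Finset.mem_univ _, ?_⟩
  · have hj := h.relWeight_left (x := x) j
    by_cases hji : j = i
    · subst hji
      rcases hσ with rfl | rfl <;> omega
    · rw [if_neg hji, add_zero] at hj
      rw [hj]
  · rcases hσ with rfl | rfl <;> omega

/-- A step in a direction that is still needed causes no cancellation of crossings. -/
lemma IsStep.expo_eq_zero {x y z : IState n k} {i : Fin n} {σ : ℤ} (hσ : σ = 1 ∨ σ = -1)
    (h : IsStep i σ y z) (hpos : 0 < σ * relWeight x z i) : expo x y z = 0 := by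
  funext j
  have h1 := two_mul_expo x y z j
  have hj := h.relWeight_left (x := x) j
  rw [h.relWeight_eq] at h1
  simp only [abs_eq_max_neg] at h1
  rw [Pi.zero_apply]
  by_cases hji : j = i
  · subst hji
    rw [if_pos rfl] at h1 hj
    rcases hσ with rfl | rfl <;> omega
  · rw [if_neg hji] at h1 hj
    omega

/-- A step in a direction that is not needed cancels one crossing. -/
lemma IsStep.expo_eq_single {x y z : IState n k} {i : Fin n} {σ : ℤ} (hσ : σ = 1 ∨ σ = -1)
    (h : IsStep i σ y z) (hpos : ¬0 < σ * relWeight x z i) : expo x y z = Pi.single i 1 := by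
  funext j
  have h1 := two_mul_expo x y z j
  have hj := h.relWeight_left (x := x) j
  rw [h.relWeight_eq] at h1
  simp only [abs_eq_max_neg] at h1
  by_cases hji : j = i
  · subst hji
    rw [if_pos rfl] at h1 hj
    rw [Pi.single_eq_same]
    rcases hσ with rfl | rfl <;> omega
  · rw [if_neg hji] at h1 hj
    rw [Pi.single_eq_of_ne hji]
    omega

lemma IsGeodesic.pathC_eq {x y : GVert S W} {p : Quiver.Path x y} (h : IsGeodesic p) :
    pathC p = [] := by
  induction h with
  | nil => rfl
  | cons p e i σ he hpos hp ih => rw [pathC, ih, he.arrowC_eq, List.append_nil]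

lemma IsGeodesic.pathExp_eq {x y : GVert S W} {p : Quiver.Path x y} (h : IsGeodesic p) :
    pathExp p = 0 := by
  induction h with
  | nil => rfl
  | cons p e i σ he hpos hp ih =>
    rw [pathExp, ih, he.labelExp_eq, he.isStep.expo_eq_zero he.sign hpos, add_zero, add_zero]

lemma exists_isGeodesic (hW : IsConvex W) (x y : GVert S W) :
    ∃ p : Quiver.Path x y, IsGeodesic p := by
  induction h : dist x.state y.state using Nat.strong_induction_on generalizing y with
  | _ N ih =>
    by_cases hxy : x = y
    · subst hxy; exact ⟨_, .nil⟩
    · obtain ⟨i, σ, y₁, hσ, hs, hpos⟩ :=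
        exists_step_away (fun h => hxy (GVert.state_injective h))
      have hy₁ : y₁ ∈ W := hW.mem_of_step x.2 y.2 hσ hs hpos
      obtain ⟨p, hp⟩ := ih _ (h ▸ hs.dist_lt hσ hpos) (GVert.of y₁ hy₁) rfl
      obtain ⟨e, he⟩ := exists_isStepArrow (S := S) (x := (GVert.of y₁ hy₁)) (y := y) hσ hs
      exact ⟨p.cons e, .cons p e i σ he hpos hp⟩

variable {R : Set (PathG S W)}

/-- Crossings of distant lines commute. -/
lemma cl_mul_cl_eq_of_distant (hR : relSub S W ⊆ R) {z y₁ y₂ y : GVert S W} {a : z ⟶ y₁}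
    {e₁ : y₁ ⟶ y} {b : z ⟶ y₂} {e₂ : y₂ ⟶ y} {i j : Fin n} {σ τ : ℤ} (ha : IsStepArrow a j τ)
    (he₁ : IsStepArrow e₁ i σ) (hb : IsStepArrow b i σ) (he₂ : IsStepArrow e₂ j τ)
    (hij : 1 < |(i : ℤ) - j|) : cl R a * cl R e₁ = cl R b * cl R e₂ := by
  have hji : 1 < |(j : ℤ) - i| := by rwa [abs_sub_comm]
  apply cl_mul_cl_eq hR
  rcases ha with ⟨h1, ha⟩ | ⟨h1, ha⟩ <;> rcases he₂ with ⟨h2, he₂⟩ | ⟨h2, he₂⟩ <;>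
  rcases hb with ⟨h3, hb⟩ | ⟨h3, hb⟩ <;> rcases he₁ with ⟨h4, he₁⟩ | ⟨h4, he₁⟩ <;>
  first
  | omega
  | rw [ha, hb, he₁, he₂, ← freeAlgebra_sub_eq_add]; exact .distRR j i hji
  | rw [ha, hb, he₁, he₂, ← freeAlgebra_sub_eq_add]; exact .distLL j i hji
  | rw [ha, hb, he₁, he₂, ← freeAlgebra_sub_eq_add]; exact .distRL j i hji
  | rw [ha, hb, he₁, he₂, add_comm, ← freeAlgebra_sub_eq_add]; exact .distRL i j hij

/-- All geodesics between two vertices have the same class in the quiver algebra. The last steps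
of two geodesics either agree or cross distant lines; in the second case they complete to a
square, whose fourth corner lies in `W` by convexity. -/
lemma IsGeodesic.cls_eq (hR : relSub S W ⊆ R) (hW : IsConvex W) {x y : GVert S W}
    {p q : Quiver.Path x y} (hp : IsGeodesic p) (hq : IsGeodesic q) : cls R p = cls R q := by
  induction h : dist x.state y.state using Nat.strong_induction_on generalizing y with
  | _ N ih =>
    cases hp with
    | nil =>
      cases hq with
      | nil => rfl
      | cons q e j τ he hpos hq => simp [relWeight_self] at hpos
    | @cons y₁ _ p e₁ i σ he₁ hpos₁ hp =>
      cases hq with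
      | nil => simp [relWeight_self] at hpos₁
      | @cons y₂ _ q e₂ j τ he₂ hpos₂ hq =>
        have hd₁ := he₁.isStep.dist_lt he₁.sign hpos₁
        have hd₂ := he₂.isStep.dist_lt he₂.sign hpos₂
        rw [cls_cons, cls_cons]
        by_cases hij : i = j
        · subst hij
          obtain rfl : σ = τ := by
            rcases he₁.sign with h1 | h1 <;> rcases he₂.sign with h2 | h2 <;>
              rw [h1] at hpos₁ ⊢ <;> rw [h2] at hpos₂ ⊢ <;> omega
          obtain rfl := GVert.state_injective (he₁.isStep.source_unique he₂.isStep)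
          obtain rfl := he₁.unique he₂
          rw [ih _ (h ▸ hd₁) hp hq rfl]
        · have hdist := IsStep.distant he₁.sign he₂.sign he₁.isStep he₂.isStep hpos₁ hpos₂ hij
          obtain ⟨z, hz₁, hz₂⟩ := he₁.isStep.exists_square he₂.isStep hdist
          have hposa : 0 < τ * relWeight x.state y₁.state j := by
            have := he₁.isStep.relWeight_left (x := x.state) j
            rw [if_neg (Ne.symm hij), add_zero] at this
            rwa [← this]
          have hposb : 0 < σ * relWeight x.state y₂.state i := by
            have := he₂.isStep.relWeight_left (x := x.state) i
            rw [if_neg hij, add_zero] at this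
            rwa [← this]
          have hz : z ∈ W := hW.mem_of_step x.2 y₁.2 he₂.sign hz₁ hposa
          obtain ⟨g, hg⟩ := exists_isGeodesic hW x (GVert.of z hz : GVert S W)
          obtain ⟨a, ha⟩ := exists_isStepArrow (x := (GVert.of z hz : GVert S W)) he₂.sign hz₁
          obtain ⟨b, hb⟩ := exists_isStepArrow (x := (GVert.of z hz : GVert S W)) he₁.sign hz₂
          rw [ih _ (h ▸ hd₁) hp (.cons g a j τ ha hposa hg) rfl,
            ih _ (h ▸ hd₂) hq (.cons g b i σ hb hposb hg) rfl, cls_cons, cls_cons, mul_assoc,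
            mul_assoc, cl_mul_cl_eq_of_distant hR ha he₁ hb he₂ hdist]

variable (R) in
/-- The class of the geodesics from `x` to `y`. -/
def geo (hW : IsConvex W) (x y : GVert S W) : Quiv R := cls R (exists_isGeodesic hW x y).choose

lemma IsGeodesic.cls_eq_geo (hR : relSub S W ⊆ R) (hW : IsConvex W) {x y : GVert S W}
    {p : Quiver.Path x y} (hp : IsGeodesic p) : cls R p = geo R hW x y :=
  hp.cls_eq hR hW (exists_isGeodesic hW x y).choose_spec

/-- Crossing a line back and forth is multiplication by `U_i`. -/
lemma cl_mul_cl_back (hR : relSub S W ⊆ R) {x y : GVert S W} {e : x ⟶ y} {e' : y ⟶ x}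
    {i : Fin n} {σ : ℤ} (he : IsStepArrow e i σ) (he' : IsStepArrow e' i (-σ)) :
    cl R e * cl R e' = cl R (uLoop i x) := by
  apply cl_mul_cl_eq_cl hR
  have hu : arrowLabel (uLoop i x) = Label.U i := rfl
  rw [hu]
  rcases he with ⟨h1, he⟩ | ⟨h1, he⟩ <;> rcases he' with ⟨h2, he'⟩ | ⟨h2, he'⟩
  · omega
  · rw [he, he', ← freeAlgebra_sub_eq_add]; exact .RL i
  · rw [he, he', ← freeAlgebra_sub_eq_add]; exact .LR i
  · omega

lemma geo_mul_cl (hR : relSub S W ⊆ R) (hW : IsConvex W) {x y z : GVert S W} {e : y ⟶ z}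
    {i : Fin n} {σ : ℤ} (he : IsStepArrow e i σ) :
    geo R hW x y * cl R e =
      monSmul hR (expo x.state y.state z.state) [] (geo R hW x z) := by
  obtain ⟨p, hp⟩ := exists_isGeodesic hW x y
  by_cases hpos : 0 < σ * relWeight x.state z.state i
  · rw [he.isStep.expo_eq_zero he.sign hpos, monSmul_zero_nil, ← hp.cls_eq_geo hR hW, ← cls_cons,
      (IsGeodesic.cons p e i σ he hpos hp).cls_eq_geo hR hW]
  · -- The geodesic to `y` may be taken to end with the reversed step from `z`.
    rw [he.isStep.expo_eq_single he.sign hpos]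
    have hσ' : -σ = 1 ∨ -σ = -1 := by rcases he.sign with h | h <;> omega
    obtain ⟨e', he'⟩ := exists_isStepArrow hσ' he.isStep.symm
    obtain ⟨q, hq⟩ := exists_isGeodesic hW x z
    have hpos' : 0 < -σ * relWeight x.state y.state i := by
      have := he.isStep.relWeight_left (x := x.state) i
      rw [if_pos rfl] at this
      rcases he.sign with h | h <;> rw [h] at hpos this ⊢ <;> omega
    rw [← (IsGeodesic.cons q e' i (-σ) he' hpos' hq).cls_eq_geo hR hW, cls_cons, mul_assoc,
      cl_mul_cl_back hR he' ((neg_neg σ).symm ▸ he), cl_uLoop, mul_monSmul, cls_mul_nil,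
      hq.cls_eq_geo hR hW]

lemma geo_self (hR : relSub S W ⊆ R) (hW : IsConvex W) (x : GVert S W) :
    geo R hW x x = cls R (Quiver.Path.nil : Quiver.Path x x) :=
  (IsGeodesic.nil.cls_eq_geo hR hW).symm

/-- The product formula for the elements `f_{x,y}` holds in the quiver algebra. -/
lemma geo_mul_geo (hR : relSub S W ⊆ R) (hW : IsConvex W) (x y z : GVert S W) :
    geo R hW x y * geo R hW y z =
      monSmul hR (expo x.state y.state z.state) [] (geo R hW x z) := by
  obtain ⟨q, hq⟩ := exists_isGeodesic hW y z
  rw [← hq.cls_eq_geo hR hW]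
  induction hq with
  | nil =>
    obtain ⟨p, hp⟩ := exists_isGeodesic hW x y
    rw [expo_self_right, monSmul_zero_nil, ← hp.cls_eq_geo hR hW, cls_mul_nil]
  | cons q e i σ he hpos hq ih =>
    rw [cls_cons, ← mul_assoc, ih, monSmul_mul, geo_mul_cl hR hW he, monSmul_monSmul,
      expo_cocycle, he.isStep.expo_eq_zero he.sign hpos, zero_add, List.append_nil]

lemma cl_eq_monSmul_geo (hR : relSub S W ⊆ R) (hW : IsConvex W) {x y : GVert S W} (e : x ⟶ y) :
    cl R e = monSmul hR (labelExp (arrowLabel e)) (arrowC e) (geo R hW x y) := by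
  have hstep : ∀ (i : Fin n) (σ : ℤ), IsStepArrow e i σ → cl R e = geo R hW x y := by
    intro i σ he
    have h := geo_mul_cl (R := R) hR hW (x := x) he
    rwa [geo_self hR hW, cls_nil_mul, expo_self_left, monSmul_zero_nil] at h
  obtain ⟨ℓ, h⟩ := e
  cases ℓ with
  | R i =>
    rw [hstep i 1 (Or.inl ⟨rfl, rfl⟩)]
    exact (monSmul_zero_nil hR _).symm
  | L i =>
    rw [hstep i (-1) (Or.inr ⟨rfl, rfl⟩)]
    exact (monSmul_zero_nil hR _).symm
  | U i =>
    obtain rfl : x = y := GVert.state_injective h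
    rw [geo_self hR hW]
    exact cl_uLoop hR i x
  | C i =>
    obtain rfl : x = y := GVert.state_injective h.2
    rw [geo_self hR hW]
    exact cl_cLoop hR ⟨i, h.1⟩ x

/-- The normal form of the class of a path. -/
lemma cls_eq_monSmul_geo (hR : relSub S W ⊆ R) (hW : IsConvex W) {x y : GVert S W}
    (p : Quiver.Path x y) :
    cls R p = monSmul hR (pathExp p) (pathC p) (geo R hW x y) := by
  induction p with
  | nil => rw [pathExp, pathC, monSmul_zero_nil, geo_self hR hW]
  | cons p e ih =>
    rw [pathExp, pathC, cls_cons, ih, cl_eq_monSmul_geo hR hW e, monSmul_mul, mul_monSmul,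
      geo_mul_geo hR, monSmul_monSmul, monSmul_monSmul, List.append_nil]

/-- The monomial relations hold in the quiver algebra, in the same form as in `B(n,k)`. -/
lemma ZeroRel.monSmul_geo_eq_zero (hR : relSub S W ⊆ R) (hW : IsConvex W) {a b : IState n k}
    {m : Fin n → ℤ} (ha : a ∈ W) (hb : b ∈ W) (h : ZeroRel a b m) :
    ∃ r : Fin n → ℕ, (∀ i, m i = |relWeight a b i| + 2 * r i) ∧
      monSmul hR r [] (geo R hW (GVert.of a ha : GVert S W) (GVert.of b hb)) = 0 := by
  have key : ∀ (c : IState n k) (i j : Fin n) (σ : ℤ) (hσ : σ = 1 ∨ σ = -1) (hne : i ≠ j)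
      (h₁ : IsStep i σ a c) (h₂ : IsStep j σ c b)
      (hz : ∀ (c' : GVert S W) (e : (GVert.of a ha : GVert S W) ⟶ c') (e' : c' ⟶ (GVert.of b hb)), IsStepArrow e i σ →
        IsStepArrow e' j σ → cl R e * cl R e' = 0),
      (∀ l, (if l = i ∨ l = j then 1 else 0) = |relWeight a b l| + 2 * ((0 : Fin n → ℕ) l)) ∧
      monSmul hR 0 [] (geo R hW (GVert.of a ha : GVert S W) (GVert.of b hb)) = 0 := by
    intro c i j σ hσ hne h₁ h₂ hz
    have hw : ∀ l, relWeight a b l =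
        (if l = i then σ else 0) + if l = j then σ else 0 := fun l => by
      rw [← relWeight_add _ c, h₁.relWeight_eq, h₂.relWeight_eq]
    refine ⟨fun l => ?_, ?_⟩
    · rw [hw]
      by_cases hi : l = i
      · subst hi; rcases hσ with rfl | rfl <;> simp [hne]
      · by_cases hj : l = j
        · subst hj; rcases hσ with rfl | rfl <;> simp [hi]
        · simp [hi, hj]
    · have hpos : 0 < σ * relWeight a b j := by
        rw [hw, if_neg (Ne.symm hne), if_pos rfl]
        rcases hσ with rfl | rfl <;> norm_num
      have hc : c ∈ W := hW.mem_of_step ha hb hσ h₂ hpos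
      obtain ⟨e, he⟩ := exists_isStepArrow (x := (GVert.of a ha : GVert S W)) (y := (GVert.of c hc)) hσ h₁
      obtain ⟨e', he'⟩ := exists_isStepArrow (x := (GVert.of c hc : GVert S W)) (y := (GVert.of b hb)) hσ h₂
      have h3 := cl_eq_monSmul_geo hR hW e
      rw [he.labelExp_eq, he.arrowC_eq, monSmul_zero_nil] at h3
      have h4 := geo_mul_cl (R := R) hR hW (x := (GVert.of a ha)) he'
      have h5 : expo (GVert.of a ha : GVert S W).state (GVert.of c hc : GVert S W).state
          (GVert.of b hb : GVert S W).state = 0 := he'.isStep.expo_eq_zero hσ hpos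
      rw [h5] at h4
      rw [← h4, ← h3]
      exact hz _ e e' he he'
  cases h with
  | U i _ h₁ h₂ =>
    refine ⟨Pi.single i 1, fun l => ?_, ?_⟩
    · rw [relWeight_self]
      by_cases hl : l = i
      · subst hl; simp
      · simp [hl]
    · rw [geo_self hR hW, ← cl_uLoop]
      exact cl_uLoop_eq_zero hR h₁ h₂
  | R i j _ c _ hij h₁ h₂ =>
    have hne : i ≠ j := fun h => by rw [h] at hij; omega
    refine ⟨0, key c i j 1 (Or.inl rfl) hne h₁ h₂ fun c' e e' he he' => ?_⟩
    apply cl_mul_cl_eq_zero hR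
    rcases he with ⟨-, he⟩ | ⟨h, -⟩ <;> rcases he' with ⟨-, he'⟩ | ⟨h', -⟩ <;> try omega
    rw [he, he']; exact .twoR i j hij
  | L i j _ c _ hij h₁ h₂ =>
    have hne : i ≠ j := fun h => by rw [h] at hij; omega
    have h := key c j i (-1) (Or.inr rfl) hne.symm h₁ h₂ fun c' e e' he he' => ?_
    · exact ⟨0, fun l => by rw [← h.1 l]; simp only [or_comm], h.2⟩
    apply cl_mul_cl_eq_zero hR
    rcases he with ⟨h, -⟩ | ⟨-, he⟩ <;> rcases he' with ⟨h', -⟩ | ⟨-, he'⟩ <;> try omega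
    rw [he, he']; exact .twoL i j hij

lemma monSmul_eq_zero_of_le (hR : relSub S W ⊆ R) {q : Quiv R} {r s : Fin n → ℕ}
    (h : monSmul hR r [] q = 0) (hrs : ∀ i, r i ≤ s i) (l : List S) : monSmul hR s l q = 0 := by
  have h2 : s = (s - r) + r := by
    funext i
    have := hrs i
    simp only [Pi.add_apply, Pi.sub_apply]
    omega
  rw [h2, ← List.append_nil l, ← monSmul_monSmul, h, monSmul_zero]

/-- The classes `U^r C^l` times a geodesic vanish if the exponent is bad within `W`. -/
lemma monSmul_geo_eq_zero (hR : relSub S W ⊆ R) (hW : IsConvex W) {x y : GVert S W}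
    {r : Fin n → ℕ} (l : List S)
    (h : Bad (· ∈ W) x.state y.state (fun i => |relWeight x.state y.state i| + 2 * r i)) :
    monSmul hR r l (geo R hW x y) = 0 := by
  obtain ⟨a, b, m, ha, hb, hab, hm⟩ := h
  obtain ⟨r₀, hr₀, h0⟩ :=
    hab.monSmul_geo_eq_zero hR hW ha hb
  have h1 : geo R hW x (GVert.of a ha) * monSmul hR r₀ [] (geo R hW (GVert.of a ha) (GVert.of b hb)) *
      geo R hW (GVert.of b hb) y =
      monSmul hR (r₀ + expo x.state a b + expo x.state b y.state) [] (geo R hW x y) := by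
    rw [mul_monSmul, geo_mul_geo hR, monSmul_mul, monSmul_mul, geo_mul_geo hR, monSmul_monSmul,
      monSmul_monSmul]
    rfl
  rw [h0, mul_zero, zero_mul] at h1
  refine monSmul_eq_zero_of_le hR h1.symm (fun i => ?_) l
  have h2 : _ ≤ |relWeight x.state y.state i| + 2 * (r i : ℤ) := hm i
  have h3 : m i = |relWeight a b i| + 2 * r₀ i := hr₀ i
  have h4 := two_mul_expo x.state a b i
  have h5 := two_mul_expo x.state b y.state i
  simp only [Pi.add_apply]
  omega

/-- Every normal form is the class of a path. -/
lemma exists_path (hW : IsConvex W) (x y : GVert S W) (r : Fin n → ℕ) (l : List S) :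
    ∃ p : Quiver.Path x y, pathExp p = r ∧ pathC p = l := by
  induction l using List.reverseRecOn with
  | nil =>
    induction h : ∑ i, r i generalizing r with
    | zero =>
      obtain ⟨p, hp⟩ := exists_isGeodesic hW x y
      refine ⟨p, ?_, hp.pathC_eq⟩
      rw [hp.pathExp_eq]
      funext i
      exact ((Finset.sum_eq_zero_iff.1 h) i (Finset.mem_univ _)).symm
    | succ N ih =>
      obtain ⟨i, -, hi⟩ : ∃ i ∈ Finset.univ, 0 < r i := by
        by_contra! hc
        have : ∑ i, r i = 0 := Finset.sum_eq_zero fun i hi => Nat.le_zero.1 (hc i hi)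
        omega
      have hr : r = (r - Pi.single i 1 : Fin n → ℕ) + Pi.single i 1 := by
        funext j
        by_cases hj : j = i
        · subst hj; simp; omega
        · simp [hj]
      have hN : ∑ j, (r - Pi.single i 1 : Fin n → ℕ) j = N := by
        have h2 := congrArg (fun s : Fin n → ℕ => ∑ j, s j) hr
        simp only [Pi.add_apply, Finset.sum_add_distrib, Finset.sum_pi_single',
          Finset.mem_univ, if_true] at h2
        omega
      obtain ⟨p, hp, hC⟩ := ih _ hN
      refine ⟨p.cons (uLoop i y), ?_, ?_⟩
      · rw [pathExp, hp, expo_self_right, add_zero]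
        exact hr.symm
      · rw [pathC, hC]; rfl
  | append_singleton l i ih =>
    obtain ⟨p, hp, hC⟩ := ih
    refine ⟨p.cons (cLoop i y), ?_, ?_⟩
    · rw [pathExp, hp, expo_self_right, add_zero]
      exact add_zero r
    · rw [pathC, hC]; rfl

end Geodesics

/-! ### The differential -/

section Differential

variable {n k : ℕ} {S : Finset (Fin n)} {W : Finset (IState n k)}

variable (S) in
/-- The linear form on the span of the exterior variables that sends `C_i` to `U_i`. -/
def theta : Module.Dual (Coeff n) (S → Coeff n) :=
  ∑ i : S, (MvPolynomial.X (i : Fin n) : Coeff n) • LinearMap.proj (φ := fun _ : S => Coeff n) i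

variable (S) in
/-- The differential on the exterior algebra: contraction with `theta`. -/
def extD : Ext S →ₗ[Coeff n] Ext S :=
  CliffordAlgebra.contractLeft (Q := (0 : QuadraticForm (Coeff n) (S → Coeff n))) (theta S)

lemma BS.d_tmul (b : B n k) (ω : Ext S) :
    BS.d k S (b ⊗ₜ[Coeff n] ω) = b ⊗ₜ[Coeff n] extD S ω := by
  rw [BS.d, LinearMap.sum_apply, extD, theta, map_sum, LinearMap.sum_apply,
    TensorProduct.tmul_sum]
  refine Finset.sum_congr rfl fun i _ => ?_
  rw [LinearMap.smul_apply, TensorProduct.map_tmul, LinearMap.id_apply, map_smul,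
    LinearMap.smul_apply, TensorProduct.tmul_smul]

lemma BS.d_d (t : BS k S) : BS.d k S (BS.d k S t) = 0 := by
  induction t using TensorProduct.induction_on with
  | zero => rw [map_zero, map_zero]
  | add a b ha hb => rw [map_add, map_add, ha, hb, add_zero]
  | tmul b ω =>
    rw [BS.d_tmul, BS.d_tmul, extD, CliffordAlgebra.contractLeft_contractLeft,
      TensorProduct.tmul_zero]

lemma extD_mul (ω ω' : Ext S) : extD S (ω * ω') = extD S ω * ω' + ω * extD S ω' := by
  rw [extD]
  induction ω using CliffordAlgebra.left_induction with
  | algebraMap r =>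
    rw [CliffordAlgebra.contractLeft_algebraMap_mul, CliffordAlgebra.contractLeft_algebraMap,
      zero_mul, zero_add]
  | add x y hx hy => rw [add_mul, map_add, map_add, hx, hy, add_mul, add_mul]; abel
  | ι_mul x m hx =>
    -- In characteristic two the sign in the Leibniz rule disappears.
    rw [mul_assoc, CliffordAlgebra.contractLeft_ι_mul, CliffordAlgebra.contractLeft_ι_mul, hx,
      sub_eq_add_neg, sub_eq_add_neg, neg_eq_self' n, neg_eq_self' n, mul_add, add_mul,
      smul_mul_assoc, mul_assoc, mul_assoc]
    abel

lemma BS.d_mul (s t : BS k S) : BS.d k S (s * t) = BS.d k S s * t + s * BS.d k S t := by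
  induction s using TensorProduct.induction_on with
  | zero => rw [zero_mul, map_zero, zero_mul, zero_mul, add_zero]
  | add a b ha hb => rw [add_mul, map_add, map_add, ha, hb, add_mul, add_mul]; abel
  | tmul b ω =>
    induction t using TensorProduct.induction_on with
    | zero => rw [mul_zero, map_zero, mul_zero, mul_zero, add_zero]
    | add a b ha hb => rw [mul_add, map_add, map_add, ha, hb, mul_add, mul_add]; abel
    | tmul b' ω' =>
      rw [Algebra.TensorProduct.tmul_mul_tmul, BS.d_tmul, BS.d_tmul, BS.d_tmul, extD_mul,
        TensorProduct.tmul_add, Algebra.TensorProduct.tmul_mul_tmul,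
        Algebra.TensorProduct.tmul_mul_tmul]

lemma extD_one : extD S 1 = 0 := CliffordAlgebra.contractLeft_one _ _

lemma extD_C (i : S) : extD S (Ext.C S i) = (MvPolynomial.X (i : Fin n) : Coeff n) • 1 := by
  have h : theta S (Pi.single i 1) = MvPolynomial.X (i : Fin n) := by
    rw [theta, LinearMap.sum_apply, Finset.sum_eq_single i]
    · simp
    · intro j _ hj; simp [Pi.single_eq_of_ne hj]
    · simp
  rw [extD, Ext.C, ← h, ← Algebra.algebraMap_eq_smul_one]
  exact CliffordAlgebra.contractLeft_ι _ _ _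

lemma BS.d_tmul_one (b : B n k) : BS.d k S (b ⊗ₜ[Coeff n] 1) = 0 := by
  rw [BS.d_tmul, extD_one, TensorProduct.tmul_zero]

/-- The value of `F` on a linear combination of paths with common end points. -/
def pathSum {x y : GVert S W} : (Quiver.Path x y →₀ ZMod 2) →+ BS k S where
  toFun a := a.sum fun p c => (MvPolynomial.C c : Coeff n) • pathF p
  map_zero' := by simp
  map_add' a b := Finsupp.sum_add_index' (by simp) (by simp [add_smul])

lemma pathSum_apply {x y : GVert S W} (a : Quiver.Path x y →₀ ZMod 2) :
    pathSum a = a.sum fun p c => (MvPolynomial.C c : Coeff n) • pathF p := rfl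

lemma pathSum_single {x y : GVert S W} (p : Quiver.Path x y) (c : ZMod 2) :
    pathSum (Finsupp.single p c) = (MvPolynomial.C c : Coeff n) • pathF p := by
  rw [pathSum_apply, Finsupp.sum_single_index (by simp)]

lemma pathSum_smul {x y : GVert S W} (c : ZMod 2) (a : Quiver.Path x y →₀ ZMod 2) :
    pathSum (c • a) = (MvPolynomial.C c : Coeff n) • pathSum a := by
  have hc : c = 0 ∨ c = 1 := by revert c; decide
  rcases hc with rfl | rfl
  · rw [zero_smul, map_zero, map_zero, zero_smul]
  · rw [one_smul, map_one, one_smul]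

lemma pathSum_cons {x y z : GVert S W} (a : Quiver.Path x y →₀ ZMod 2) (e : y ⟶ z) :
    pathSum (a.mapDomain fun q => q.cons e) = pathSum a * arrowF e := by
  induction a using Finsupp.induction_linear with
  | zero => rw [Finsupp.mapDomain_zero, map_zero, map_zero, zero_mul]
  | add a b ha hb => rw [Finsupp.mapDomain_add, map_add, map_add, ha, hb, add_mul]
  | single p c =>
    rw [Finsupp.mapDomain_single, pathSum_single, pathSum_single, pathF, smul_mul_assoc]

lemma pathSum_arrowD {x y z : GVert S W} (p : Quiver.Path x y) (e : y ⟶ z) :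
    pathSum ((arrowD e).mapDomain fun e' => p.cons e') = pathF p * BS.d k S (arrowF e) := by
  obtain ⟨ℓ, h⟩ := e
  cases ℓ with
  | R i =>
    simp only [arrowD, arrowF, Finsupp.mapDomain_zero, map_zero, BS.d_tmul_one, mul_zero]
  | L i =>
    simp only [arrowD, arrowF, Finsupp.mapDomain_zero, map_zero, BS.d_tmul_one, mul_zero]
  | U i =>
    simp only [arrowD, arrowF, Finsupp.mapDomain_zero, map_zero, BS.d_tmul_one, mul_zero]
  | C i =>
    simp only [arrowD, arrowF, Finsupp.mapDomain_single, pathSum_single, BS.d_tmul, extD_C,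
      map_one, one_smul, pathF, TensorProduct.tmul_smul, TensorProduct.smul_tmul']

/-- `F` intertwines the differentials. -/
lemma pathSum_pathD {x y : GVert S W} (p : Quiver.Path x y) :
    pathSum (pathD p) = BS.d k S (pathF p) := by
  induction p with
  | nil => rw [pathD, map_zero, pathF, BS.d_tmul_one]
  | cons p e ih =>
    rw [pathD, map_add, pathSum_cons, pathSum_arrowD, ih, pathF, BS.d_mul]

lemma pathSum_sum_pathD {x y : GVert S W} (a : Quiver.Path x y →₀ ZMod 2) :
    pathSum (a.sum fun p c => c • pathD p) = BS.d k S (pathSum a) := by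
  induction a using Finsupp.induction_linear with
  | zero => rw [Finsupp.sum_zero_index, map_zero, map_zero]
  | add a b ha hb =>
    rw [Finsupp.sum_add_index' (by simp) (by simp [add_smul]), map_add, ha, hb, map_add, map_add]
  | single p c =>
    rw [Finsupp.sum_single_index (by simp), pathSum_smul, pathSum_pathD, pathSum_single, map_smul]

variable (S W) in
/-- The restriction of `F` to the path algebra of the full subquiver on `W`. -/
def FSub : PathG S W →+ BS k S := 
  pathLift (MvPolynomial.C : ZMod 2 →+* Coeff n) fun _ _ p => pathF p

lemma FSub_apply (a : PathG S W) : FSub S W a = ∑ x, ∑ y, pathSum (a x y) := rfl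

lemma FSub_path {x y : GVert S W} (p : Quiver.Path x y) :
    FSub S W (PathAlg.path (ZMod 2) p) = pathF p := pathLift_path _ _ p

lemma FSub_single (x y : GVert S W) (a : Quiver.Path x y →₀ ZMod 2) :
    FSub S W (PathAlg.single (ZMod 2) x y a) = pathSum a := pathLift_single _ _ x y a

lemma FSub_mul (a b : PathG S W) : FSub S W (a * b) = FSub S W a * FSub S W b :=
  pathLift_mul _ _ (fun _ _ _ p q => pathF_comp p q) (fun _ _ _ _ p q h => pathF_mul_ne h p q) a b

lemma FSub_pathAlgD (a : PathG S W) : FSub S W (pathAlgD S W a) = BS.d k S (FSub S W a) := by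
  rw [FSub_apply, FSub_apply, map_sum]
  refine Finset.sum_congr rfl fun x _ => ?_
  rw [map_sum]
  exact Finset.sum_congr rfl fun y _ => pathSum_sum_pathD (a x y)

lemma pathF_mapPath {x y : GVert S W} (p : Quiver.Path x y) :
    pathF ((inclQuiver S W).mapPath p) = pathF p := by
  induction p with
  | nil => rfl
  | cons p e ih =>
    rw [Prefunctor.mapPath_cons, pathF, pathF, ih]
    obtain ⟨ℓ, h⟩ := e
    cases ℓ <;> rfl

lemma pathSum_mapDomain {x y : GVert S W} (a : Quiver.Path x y →₀ ZMod 2) :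
    pathSum (a.mapDomain (inclQuiver S W).mapPath) = pathSum a := by
  rw [pathSum_apply, Finsupp.sum_mapDomain_index (by simp) (by simp [add_smul]), pathSum_apply]
  simp only [pathF_mapPath]

lemma F_eq_FSub (a : PathGamma k S) : F k S a = FSub S _ a := rfl

lemma F_incl (a : PathG S W) : F k S (incl S W a) = FSub S W a := by
  rw [F_eq_FSub, incl, map_sum, FSub_apply]
  refine Finset.sum_congr rfl fun x _ => ?_
  rw [map_sum]
  refine Finset.sum_congr rfl fun y _ => ?_
  rw [FSub_single, pathSum_mapDomain]

/-- `F` kills the relations that lie in the path algebra of the full subquiver. -/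
lemma FSub_eq_zero_of_mem_relSub {r : PathG S W} (h : r ∈ relSub S W) : FSub S W r = 0 := by
  rw [← F_incl, F_eq_FSub]
  rcases h with ⟨x, y, a, ha, h⟩ | ⟨x, i, a, h₁, h₂, ha, h⟩
  · rw [h, FSub_single]; exact sum_pathF_eq_zero ha
  · rw [h, FSub_single]; exact sum_pathF_eq_zero_of_U h₁ h₂ ha

end Differential

/-! ### Truncations -/

section Truncation

variable {n k : ℕ} {S : Finset (Fin n)} {W : Finset (IState n k)}

lemma BS.idemSum_eq_sum : BS.idemSum S W = ∑ x ∈ W, gen x x 0 [] := by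
  rw [BS.idemSum, TensorProduct.sum_tmul]
  refine Finset.sum_congr rfl fun x _ => ?_
  rw [gen_eq, umon_zero, one_smul, B.f_self]
  rfl

lemma BS.d_idemSum : BS.d k S (BS.idemSum S W) = 0 := BS.d_tmul_one _

lemma idemSum_mul_gen {x : IState n k} (hx : x ∈ W) (y : IState n k) (r : Fin n → ℕ)
    (l : List S) : BS.idemSum S W * gen x y r l = gen x y r l := by
  rw [BS.idemSum_eq_sum, Finset.sum_mul, Finset.sum_eq_single x]
  · rw [gen_mul, expo_self_left, add_zero, zero_add, List.nil_append]
  · intro z _ hz; exact gen_mul_ne hz _ _ _ _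
  · intro h; exact absurd hx h

lemma gen_mul_idemSum (x : IState n k) {y : IState n k} (hy : y ∈ W) (r : Fin n → ℕ)
    (l : List S) : gen x y r l * BS.idemSum S W = gen x y r l := by
  rw [BS.idemSum_eq_sum, Finset.mul_sum, Finset.sum_eq_single y]
  · rw [gen_mul, expo_self_right, add_zero, add_zero, List.append_nil]
  · intro z _ hz; exact gen_mul_ne hz.symm _ _ _ _
  · intro h; exact absurd hy h

lemma idemSum_mul_gen_of_notMem {x : IState n k} (hx : x ∉ W) (y : IState n k)
    (r : Fin n → ℕ) (l : List S) : BS.idemSum S W * gen x y r l = 0 := by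
  rw [BS.idemSum_eq_sum, Finset.sum_mul]
  exact Finset.sum_eq_zero fun z hz => gen_mul_ne (fun h : z = x => hx (h ▸ hz)) _ _ _ _

lemma gen_mul_idemSum_of_notMem (x : IState n k) {y : IState n k} (hy : y ∉ W)
    (r : Fin n → ℕ) (l : List S) : gen x y r l * BS.idemSum S W = 0 := by
  rw [BS.idemSum_eq_sum, Finset.mul_sum]
  exact Finset.sum_eq_zero fun z hz => gen_mul_ne (fun h : y = z => hy (h ▸ hz)) _ _ _ _

lemma Trunc.val_injective : Function.Injective (Trunc.val : Trunc S W → BS k S) :=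
  Subtype.val_injective

lemma Trunc.idemSum_mul_val (t : Trunc S W) : BS.idemSum S W * Trunc.val t = Trunc.val t :=
  ((Subsemigroup.mem_corner_iff (BS.isIdempotentElem_idemSum S W)).1 t.2).1

lemma Trunc.val_mul_idemSum (t : Trunc S W) : Trunc.val t * BS.idemSum S W = Trunc.val t :=
  ((Subsemigroup.mem_corner_iff (BS.isIdempotentElem_idemSum S W)).1 t.2).2

/-- An element that is fixed by the idempotent on both sides, as an element of the truncation. -/
def Trunc.mk (b : BS k S) (h₁ : BS.idemSum S W * b = b) (h₂ : b * BS.idemSum S W = b) :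
    Trunc S W :=
  ⟨b, (Subsemigroup.mem_corner_iff (BS.isIdempotentElem_idemSum S W)).2 ⟨h₁, h₂⟩⟩

lemma Trunc.val_mk (b : BS k S) (h₁ : BS.idemSum S W * b = b) (h₂ : b * BS.idemSum S W = b) :
    Trunc.val (Trunc.mk b h₁ h₂) = b := rfl

lemma Trunc.val_add (s t : Trunc S W) : Trunc.val (s + t) = Trunc.val s + Trunc.val t := rfl

lemma Trunc.val_mul (s t : Trunc S W) : Trunc.val (s * t) = Trunc.val s * Trunc.val t := rfl

lemma Trunc.val_zero : Trunc.val (0 : Trunc S W) = 0 := rfl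

/-- The differential of the truncation. -/
def Trunc.d : Trunc S W →+ Trunc S W where
  toFun t := Trunc.mk (BS.d k S (Trunc.val t))
    (by
      have h := BS.d_mul (BS.idemSum S W) (Trunc.val t)
      rw [Trunc.idemSum_mul_val, BS.d_idemSum, zero_mul, zero_add] at h
      exact h.symm)
    (by
      have h := BS.d_mul (Trunc.val t) (BS.idemSum S W)
      rw [Trunc.val_mul_idemSum, BS.d_idemSum, mul_zero, add_zero] at h
      exact h.symm)
  map_zero' := Trunc.val_injective (by rw [Trunc.val_mk, Trunc.val_zero, map_zero])
  map_add' s t := Trunc.val_injective (by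
    rw [Trunc.val_mk, Trunc.val_add, Trunc.val_add, map_add]; rfl)

lemma Trunc.val_d (t : Trunc S W) : Trunc.val (Trunc.d t) = BS.d k S (Trunc.val t) := rfl

lemma idemSum_mul_FSub (a : PathG S W) : BS.idemSum S W * FSub S W a = FSub S W a := by
  induction a using PathAlg.induction with
  | zero => rw [map_zero, mul_zero]
  | add a b ha hb => rw [map_add, mul_add, ha, hb]
  | path x y p c =>
    rw [FSub, pathLift_smul_path, mul_smul_comm, pathF_eq_gen, 
      idemSum_mul_gen (show x.state ∈ W from x.2)]

lemma FSub_mul_idemSum (a : PathG S W) : FSub S W a * BS.idemSum S W = FSub S W a := by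
  induction a using PathAlg.induction with
  | zero => rw [map_zero, zero_mul]
  | add a b ha hb => rw [map_add, add_mul, ha, hb]
  | path x y p c =>
    rw [FSub, pathLift_smul_path, smul_mul_assoc, pathF_eq_gen, 
      gen_mul_idemSum _ (show y.state ∈ W from y.2)]

lemma FSub_one : FSub S W 1 = BS.idemSum S W := by
  have h : (1 : PathG S W) = ∑ x, PathAlg.idem (ZMod 2) x := rfl
  rw [h, map_sum, BS.idemSum_eq_sum, ← Finset.sum_coe_sort W fun x => (gen x x 0 [] : BS k S)]
  refine Finset.sum_congr rfl fun x _ => ?_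
  rw [PathAlg.idem, FSub_path, pathF_eq_gen]
  rfl

variable (S W) in
/-- The map `F` from the path algebra of the full subquiver to the truncation. -/
def FTrunc : PathG S W →+* Trunc S W where
  toFun a := Trunc.mk (FSub S W a) (idemSum_mul_FSub a) (FSub_mul_idemSum a)
  map_zero' := Trunc.val_injective (map_zero (FSub S W))
  map_one' := Trunc.val_injective FSub_one
  map_add' a b := Trunc.val_injective (map_add (FSub S W) a b)
  map_mul' a b := Trunc.val_injective (FSub_mul a b)

lemma val_FTrunc (a : PathG S W) : Trunc.val (FTrunc S W a) = FSub S W a := rfl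

end Truncation

/-! ### The isomorphism -/

section Isomorphism

variable {n k : ℕ} {S : Finset (Fin n)} {W : Finset (IState n k)} {R : Set (PathG S W)}

/-- The homomorphism from the quiver algebra to the truncation induced by `F`. -/
def quivHom (hF : ∀ r ∈ R, FSub S W r = 0) : Quiv R →+* Trunc S W :=
  Quiv.lift (FTrunc S W) fun r hr => Trunc.val_injective ((val_FTrunc r).trans (hF r hr))

lemma val_quivHom_mk (hF : ∀ r ∈ R, FSub S W r = 0) (a : PathG S W) :
    Trunc.val (quivHom hF (Quiv.mk R a)) = FSub S W a := rfl

lemma val_quivHom_cls (hF : ∀ r ∈ R, FSub S W r = 0) {x y : GVert S W} (p : Quiver.Path x y) :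
    Trunc.val (quivHom hF (cls R p)) = gen x.state y.state (pathExp p) (pathC p) := by
  rw [cls, val_quivHom_mk, FSub_path, pathF_eq_gen]

/-- The homomorphism induced by `F` preserves degrees. -/
lemma val_quivHom_mem_homogB (hF : ∀ r ∈ R, FSub S W r = 0) {G : Type} (D : MultiDeg n → G)
    (g : G) {q : Quiv R} (hq : q ∈ homogQuiv D R g) :
    Trunc.val (quivHom hF q) ∈ homogB k S D g := by
  induction hq using AddSubgroup.closure_induction with
  | mem q hq =>
    obtain ⟨x, y, p, hp, rfl⟩ := hq
    have h : Trunc.val (quivHom hF (cls R p)) ∈ homogB k S D g := by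
      rw [val_quivHom_cls]
      by_cases hl : (pathC p).Nodup
      · exact AddSubgroup.subset_closure ⟨_, _, _, _, hl, by rw [genDeg_pathExp, hp], rfl⟩
      · rw [gen_eq_zero_of_not_nodup _ _ _ hl]; exact zero_mem _
    exact h
  | zero => rw [map_zero]; exact zero_mem _
  | add a b _ _ ha hb => rw [map_add]; exact add_mem ha hb
  | neg a _ ha => rw [map_neg]; exact neg_mem ha

/-- The truncation of a homogeneous element comes from a homogeneous element of the quiver
algebra. -/
lemma exists_mem_homogQuiv (hW : IsConvex W) (hF : ∀ r ∈ R, FSub S W r = 0) {G : Type}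
    (D : MultiDeg n → G) (g : G) {b : BS k S} (hb : b ∈ homogB k S D g) :
    ∃ q ∈ homogQuiv D R g,
      Trunc.val (quivHom hF q) = BS.idemSum S W * b * BS.idemSum S W := by
  induction hb using AddSubgroup.closure_induction with
  | mem b hb =>
    obtain ⟨x, y, r, l, hl, hd, rfl⟩ := hb
    by_cases hx : x ∈ W
    · by_cases hy : y ∈ W
      · obtain ⟨p, hp, hC⟩ := exists_path (S := S) hW (GVert.of x hx) (GVert.of y hy) r l
        refine ⟨cls R p, AddSubgroup.subset_closure ⟨_, _, p, ?_, rfl⟩, ?_⟩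
        · rw [← genDeg_pathExp, hp, hC]; exact hd
        · rw [val_quivHom_cls, hp, hC, idemSum_mul_gen hx, gen_mul_idemSum x hy]; rfl
      · refine ⟨0, zero_mem _, ?_⟩
        rw [mul_assoc, gen_mul_idemSum_of_notMem x hy, mul_zero, map_zero]; rfl
    · refine ⟨0, zero_mem _, ?_⟩
      rw [idemSum_mul_gen_of_notMem hx, zero_mul, map_zero]; rfl
  | zero =>
    refine ⟨0, zero_mem _, ?_⟩
    rw [mul_zero, zero_mul, map_zero]; rfl
  | add a b _ _ ha hb =>
    obtain ⟨q, hq, h⟩ := ha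
    obtain ⟨q', hq', h'⟩ := hb
    exact ⟨q + q', add_mem hq hq', by rw [map_add, Trunc.val_add, h, h', mul_add, add_mul]⟩
  | neg a _ ha =>
    obtain ⟨q, hq, h⟩ := ha
    have h2 : -a = a := neg_eq_self' n a
    exact ⟨q, hq, by rw [h2]; exact h⟩

lemma quivHom_surjective (hW : IsConvex W) (hF : ∀ r ∈ R, FSub S W r = 0) :
    Function.Surjective (quivHom hF) := fun t => by
  have ht : Trunc.val t ∈ homogB k S (fun _ => ()) () := by
    refine AddSubgroup.closure_mono ?_ (BS.mem_closure_gen (Trunc.val t))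
    rintro _ ⟨x, y, r, l, hl, rfl⟩
    exact ⟨x, y, r, l, hl, rfl, rfl⟩
  obtain ⟨q, -, hq⟩ := exists_mem_homogQuiv hW hF _ _ ht
  refine ⟨q, Trunc.val_injective ?_⟩
  rw [hq, Trunc.idemSum_mul_val, Trunc.val_mul_idemSum]

/-- The classes of the normal forms of paths with distinct exterior variables. -/
def normalForm (hR : relSub S W ⊆ R) (hW : IsConvex W)
    (i : (GVert S W × GVert S W) × (Fin n → ℕ) × Finset S) : Quiv R :=
  monSmul hR i.2.1 i.2.2.toList (geo R hW i.1.1 i.1.2)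

lemma exists_sum_normalForm (hR : relSub S W ⊆ R) (hW : IsConvex W) (q : Quiv R) :
    ∃ c : ((GVert S W × GVert S W) × (Fin n → ℕ) × Finset S) →₀ ZMod 2,
      q = c.sum fun i a => a • normalForm hR hW i := by
  classical
  induction q using Quiv.induction_cls with
  | zero => exact ⟨0, by simp⟩
  | add a b ha hb =>
    obtain ⟨c, rfl⟩ := ha
    obtain ⟨d, rfl⟩ := hb
    exact ⟨c + d, by rw [Finsupp.sum_add_index' (by simp) (by simp [add_smul])]⟩
  | cls x y p =>
    rw [cls_eq_monSmul_geo hR hW]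
    by_cases hl : (pathC p).Nodup
    · refine ⟨Finsupp.single ((x, y), pathExp p, (pathC p).toFinset) 1, ?_⟩
      rw [Finsupp.sum_single_index (by simp), one_smul, normalForm, monSmul, monSmul,
        centralMon_perm hR _ (List.toFinset_toList hl)]
    · refine ⟨0, ?_⟩
      rw [monSmul, centralMon_eq_zero_of_not_nodup hR _ hl, Finsupp.sum_zero_index]
      exact zero_mul _

lemma val_quivHom_normalForm (hR : relSub S W ⊆ R) (hW : IsConvex W)
    (hF : ∀ r ∈ R, FSub S W r = 0)
    (i : (GVert S W × GVert S W) × (Fin n → ℕ) × Finset S) :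
    Trunc.val (quivHom hF (normalForm hR hW i)) =
      gen i.1.1.state i.1.2.state i.2.1 i.2.2.toList := by
  obtain ⟨p, hp, hC⟩ := exists_path hW i.1.1 i.1.2 i.2.1 i.2.2.toList
  have h := cls_eq_monSmul_geo hR hW p
  rw [hp, hC] at h
  rw [normalForm, ← h, val_quivHom_cls, hp, hC]

/-- The homomorphism induced by `F` is injective if all normal forms with bad exponents vanish in
the quiver algebra, because the images of the other normal forms are independent. -/
lemma quivHom_injective (hR : relSub S W ⊆ R) (hW : IsConvex W) (hF : ∀ r ∈ R, FSub S W r = 0)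
    (hzero : ∀ (x y : GVert S W) (r : Fin n → ℕ),
      Bad (fun _ => True) x.state y.state (fun i => |relWeight x.state y.state i| + 2 * r i) →
        monSmul hR r [] (geo R hW x y) = 0) : Function.Injective (quivHom hF) := by
  rw [injective_iff_map_eq_zero]
  intro q hq
  obtain ⟨c, rfl⟩ := exists_sum_normalForm hR hW q
  have h1 : (c.sum fun i a => (MvPolynomial.C a : Coeff n) •
      gen i.1.1.state i.1.2.state i.2.1 i.2.2.toList) = 0 := by
    have hval : ∀ (s : Finset ((GVert S W × GVert S W) × (Fin n → ℕ) × Finset S)),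
        Trunc.val (quivHom hF (∑ i ∈ s, c i • normalForm hR hW i)) =
        ∑ i ∈ s, (MvPolynomial.C (c i) : Coeff n) •
          gen i.1.1.state i.1.2.state i.2.1 i.2.2.toList := by
      intro s
      classical
      induction s using Finset.induction_on with
      | empty => rw [Finset.sum_empty, Finset.sum_empty, map_zero]; rfl
      | insert i s hi ih =>
        rw [Finset.sum_insert hi, Finset.sum_insert hi, map_add, Trunc.val_add, ih,
          ← val_quivHom_normalForm hR hW hF]
        congr 1
        have hc : c i = 0 ∨ c i = 1 := by generalize c i = a; revert a; decide
        rcases hc with hc | hc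
        · rw [hc, zero_smul, map_zero, map_zero, zero_smul]; rfl
        · rw [hc, one_smul, map_one, one_smul]
    rw [Finsupp.sum, ← hval]
    have h2 := congrArg Trunc.val hq
    exact h2
  refine Finset.sum_eq_zero fun i hi => ?_
  have hbad := bad_of_sum_gen_eq_zero
    (fun i : (GVert S W × GVert S W) × (Fin n → ℕ) × Finset S => (i.1.1.state, i.1.2.state))
    (fun i => i.2.1) (fun i => i.2.2.toList) (fun i => i.2.2.nodup_toList)
    (fun i j h2 h3 h4 => Prod.ext
      (Prod.ext (GVert.state_injective (congrArg Prod.fst h2))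
        (GVert.state_injective (congrArg Prod.snd h2)))
      (Prod.ext h3 (by simpa using h4))) c h1 i hi
  have h0 : normalForm hR hW i = 0 :=
    monSmul_eq_zero_of_le hR (hzero _ _ _ hbad) (fun _ => le_rfl) _
  show c i • normalForm hR hW i = 0
  rw [h0, smul_zero]

/-- A set of relations on the full subquiver on a convex set of I-states induces an isomorphism if
it contains the relations of the full quiver, if it is killed by `F`, and if it makes all normal
forms with bad exponents vanish. -/
theorem inducesDGIso (hR : relSub S W ⊆ R) (hW : IsConvex W) (hF : ∀ r ∈ R, FSub S W r = 0)
    (hzero : ∀ (x y : GVert S W) (r : Fin n → ℕ),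
      Bad (fun _ => True) x.state y.state (fun i => |relWeight x.state y.state i| + 2 * r i) →
        monSmul hR r [] (geo R hW x y) = 0) : InducesDGIso W R := by
  have hinj := quivHom_injective hR hW hF hzero
  let e : Quiv R ≃+* Trunc S W :=
    RingEquiv.ofBijective (quivHom hF) ⟨hinj, quivHom_surjective hW hF⟩
  have he : ∀ q, e q = quivHom hF q := fun q => rfl
  let d : Quiv R →+ Quiv R :=
    e.symm.toAddMonoidHom.comp (Trunc.d.comp e.toAddMonoidHom)
  have hd : ∀ q, e (d q) = Trunc.d (e q) := fun q => e.apply_symm_apply _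
  have hgr : ∀ {G : Type} (D : MultiDeg n → G), RespectsGrading e D := by
    intro G D g q
    refine ⟨fun hq => val_quivHom_mem_homogB hF D g hq, fun hq => ?_⟩
    obtain ⟨q', hq', h⟩ := exists_mem_homogQuiv hW hF D g hq
    rw [Trunc.idemSum_mul_val, Trunc.val_mul_idemSum] at h
    rwa [← hinj (Trunc.val_injective h)]
  refine ⟨e, d, fun a => ?_, fun a => ?_, fun q => ?_, fun q q' => ?_, fun q => ?_, hgr _, hgr _,
    hgr _⟩
  · rw [F_incl]; rfl
  · refine e.injective (Trunc.val_injective ?_)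
    rw [hd, Trunc.val_d, he, he, val_quivHom_mk, val_quivHom_mk, FSub_pathAlgD]
  · refine e.injective (Trunc.val_injective ?_)
    rw [hd, hd, Trunc.val_d, Trunc.val_d, BS.d_d, map_zero]
    rfl
  · refine e.injective (Trunc.val_injective ?_)
    rw [hd, map_mul e, map_add e, map_mul e, map_mul e, hd, hd, Trunc.val_d, Trunc.val_add,
      Trunc.val_mul, Trunc.val_mul, Trunc.val_mul, Trunc.val_d, Trunc.val_d, BS.d_mul]
  · rw [hd, Trunc.val_d]

end Isomorphism

/-! ### The relation `U_1 ⋯ U_n` -/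

section ExtraRelation

variable {n k : ℕ} {S : Finset (Fin n)}

/-- A loop at a vertex that runs through loops `U_i`. -/
def uPath {W : Finset (IState n k)} (x : GVert S W) : List (Fin n) → Quiver.Path x x
  | [] => .nil
  | i :: l => (uLoop i x).toPath.comp (uPath x l)

lemma pathLabels_uPath {W : Finset (IState n k)} (x : GVert S W) (l : List (Fin n)) :
    pathLabels (uPath x l) = l.map Label.U := by
  induction l with
  | nil => rfl
  | cons i l ih => rw [uPath, pathLabels_comp, ih]; rfl

/-- A path with the labels `U_1, …, U_n` carries the monomial `U_1 ⋯ U_n`. -/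
lemma pathExp_of_pathLabels {W : Finset (IState n k)} {x : GVert S W} {p : Quiver.Path x x}
    (hp : pathLabels p = List.ofFn Label.U) : pathC p = [] ∧ pathExp p = fun _ => 1 := by
  have hC : pathC p = [] := by
    have h := map_val_pathC p
    have h2 : ∀ l : List (Fin n), cLabels (l.map Label.U) = [] := fun l => by
      induction l with
      | nil => rfl
      | cons i l ih => exact ih
    rw [hp, List.ofFn_eq_map, h2] at h
    exact List.map_eq_nil_iff.1 h
  refine ⟨hC, pathExp_eq (l := []) (by rw [hC]) ?_⟩
  rw [pathDeg_eq_sum, hp, List.map_ofFn, List.sum_ofFn]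
  have h2 := Finset.univ_sum_single fun _ : Fin n => ((1, 1) : ℤ × ℤ)
  refine Prod.ext ?_ ?_
  · simp only [Function.comp, labelDeg, Prod.fst_sum, h2]
    simp [genDeg, relWeight_self]
  · simp [genDeg, labelDeg, Prod.snd_sum]

lemma mem_iff_of_mem_Vrl {x : IState n k} (hx : x ∈ Vrl n k) (hk : k + 1 = n)
    (t : Fin (n + 1)) : t ∈ x.1 ↔ t ≠ 0 ∧ t ≠ Fin.last n := by
  have hx' := (Finset.mem_filter.1 hx).2
  have hsub : x.1 ⊆ (Finset.univ.erase (0 : Fin (n + 1))).erase (Fin.last n) := fun s hs =>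
    Finset.mem_erase.2 ⟨fun h => hx'.2 (h ▸ hs),
      Finset.mem_erase.2 ⟨fun h => hx'.1 (h ▸ hs), Finset.mem_univ _⟩⟩
  have hne : Fin.last n ≠ 0 := by
    rw [Ne, Fin.ext_iff, Fin.val_last, Fin.val_zero]; omega
  have heq := Finset.eq_of_subset_of_card_le hsub (by
    rw [Finset.card_erase_of_mem (Finset.mem_erase.2 ⟨hne, Finset.mem_univ _⟩),
      Finset.card_erase_of_mem (Finset.mem_univ _), Finset.card_univ, Fintype.card_fin, x.2]
    omega)
  rw [heq, Finset.mem_erase, Finset.mem_erase]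
  simp [and_comm]

/-- `F` kills the extra relation, since `U_1 ⋯ U_n` is bad at the vertex `[1,n-1]`. -/
lemma FSub_eq_zero_of_mem_relExtra {r : PathG S (Vrl n k)} (h : r ∈ relExtra k S) :
    FSub S (Vrl n k) r = 0 := by
  obtain ⟨hk, x, p, -, hp, rfl⟩ := h
  rw [FSub_path, pathF_eq_gen, (pathExp_of_pathLabels hp).2]
  refine gen_eq_zero_of_bad _ ((bad_of_mem_Vrl (show x.state ∈ Vrl n k from x.2) hk).le
    fun i => ?_)
  rw [relWeight_self]
  norm_num

/-- In the exceptional case of `Bad.to_Vrl` there is only one vertex, and the extra relation makes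
the normal form vanish. -/
lemma monSmul_geo_eq_zero_of_relExtra {R : Set (PathG S (Vrl n k))}
    (hR : relSub S (Vrl n k) ⊆ R) (hR' : relExtra k S ⊆ R) (hk : k + 1 = n)
    (x y : GVert S (Vrl n k)) {r : Fin n → ℕ}
    (hr : ∀ i, 2 ≤ |relWeight x.state y.state i| + 2 * (r i : ℤ)) :
    monSmul hR r [] (geo R isConvex_Vrl x y) = 0 := by
  have hx := mem_iff_of_mem_Vrl (show x.state ∈ Vrl n k from x.2) hk
  have hy := mem_iff_of_mem_Vrl (show y.state ∈ Vrl n k from y.2) hk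
  obtain rfl : x = y := GVert.state_injective
    (Subtype.ext (Finset.ext fun t => (hx t).trans (hy t).symm))
  have hp : pathLabels (uPath x (List.finRange n)) = List.ofFn Label.U := by
    rw [pathLabels_uPath, List.ofFn_eq_map]
  have h0 : cls R (uPath x (List.finRange n)) = 0 :=
    Quiv.mk_eq_zero (hR' ⟨hk, x, _, hx, hp, rfl⟩)
  obtain ⟨hC, hE⟩ := pathExp_of_pathLabels hp
  rw [cls_eq_monSmul_geo hR isConvex_Vrl, hC, hE] at h0
  refine monSmul_eq_zero_of_le hR h0 (fun i => ?_) _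
  have h := hr i
  rw [relWeight_self, abs_zero] at h
  omega

end ExtraRelation

end KauffmanAlg

end

theorem mainTheorem8 (n k : ℕ) (S : Finset (Fin n)) :
    KauffmanAlg.InducesDGIso (S := S) (KauffmanAlg.Vr n k)
      (KauffmanAlg.relSub S (KauffmanAlg.Vr n k)) ∧
    KauffmanAlg.InducesDGIso (S := S) (KauffmanAlg.Vl n k)
      (KauffmanAlg.relSub S (KauffmanAlg.Vl n k)) ∧
    KauffmanAlg.InducesDGIso (S := S) (KauffmanAlg.Vrl n k)
      (KauffmanAlg.relSub S (KauffmanAlg.Vrl n k) ∪ KauffmanAlg.relExtra k S) := by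
  refine ⟨?_, ?_, ?_⟩
  · exact KauffmanAlg.inducesDGIso subset_rfl KauffmanAlg.isConvex_Vr
      (fun r hr => KauffmanAlg.FSub_eq_zero_of_mem_relSub hr)
      fun x y r h => KauffmanAlg.monSmul_geo_eq_zero _ _ _ (h.to_Vr x.2 y.2)
  · exact KauffmanAlg.inducesDGIso subset_rfl KauffmanAlg.isConvex_Vl
      (fun r hr => KauffmanAlg.FSub_eq_zero_of_mem_relSub hr)
      fun x y r h => KauffmanAlg.monSmul_geo_eq_zero _ _ _ (h.to_Vl x.2 y.2)
  · refine KauffmanAlg.inducesDGIso Set.subset_union_left KauffmanAlg.isConvex_Vrl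
      (fun r hr => ?_) fun x y r h => ?_
    · exact hr.elim KauffmanAlg.FSub_eq_zero_of_mem_relSub
        KauffmanAlg.FSub_eq_zero_of_mem_relExtra
    · rcases h.to_Vrl x.2 y.2 with h | ⟨hk, h⟩
      · exact KauffmanAlg.monSmul_geo_eq_zero _ _ _ h
      · exact KauffmanAlg.monSmul_geo_eq_zero_of_relExtra _ Set.subset_union_right hk x y h
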